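/- There are an absolute constant $C$, an absolute exponent $c$ and two fixed deterministic programs, a construction program and a query program, for a random access machine with the following properties. The cells of the machine are of two kinds: words, that is, natural numbers below $(n+1)^c$ ($\Theta(\log n)$ bits), which also serve as addresses, and real cells, which hold distances. Arithmetic operations, loads, stores and comparisons (between cells of the same kind) cost one step each, and the only conversion is from words to reals. Let $(X,d)$ be a metric space with $n\ge 1$ points, enumerated as $x_0,\dots,x_{n-1}$, and let $k>1$ and $0<\epsilon<1$ be real numbers. Given $n$, $k$, $\epsilon$ and the distance matrix $(d(x_i,x_j))_{i,j}$, the construction program halts after at most $C\,n^{c}$ steps and outputs a data structure (a distance oracle) that occupies at most $C\,n^{1+1/k}$ memory cells. For all $i,j$, the query program, given only this data structure and the indices $i,j$, halts after at most $C/\epsilon$ steps and returns a real number $\hat d(x_i,x_j)$ with $$d(x_i,x_j)\;\le\;\hat d(x_i,x_j)\;\le\;8(1+\epsilon)k\cdot d(x_i,x_j).$$ In other words: for every $n$-point metric space, every $k>1$ and every $0<\epsilon<1$, there is a polynomial time deterministic construction of a distance oracle of size $O(n^{1+1/k})$ with stretch $8(1+\epsilon)k$ and query time $O(1/\epsilon)$.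 -/

import Mathlib

/-! A random access machine for algorithms on metric spaces.  It has two kinds of cells: words,
which hold natural numbers below a bound `N` and serve as identifiers, counters and addresses, and
real cells, which hold distances.  Programs are finite pieces of code; every elementary instruction
and every test costs one step.  No operation turns a real into a word, so reals influence words
only through comparisons. -/

namespace RAM

/-- A machine state: registers (named by the program) and memory (addressed by words), for each of
the two kinds of cells. -/
structure State where
  wreg : ℕ → ℕ
  rreg : ℕ → ℝ
  wmem : ℕ → ℕ
  rmem : ℕ → ℝ

/-- All words of the state are smaller than `N`. -/
def State.Bounded (N : ℕ) (σ : State) : Prop :=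
  (∀ i, σ.wreg i < N) ∧ ∀ a, σ.wmem a < N

/-- Operations on words (subtraction is truncated, division is integer division). -/
inductive WordOp
  | add | sub | mul | div | mod

def WordOp.eval : WordOp → ℕ → ℕ → ℕ
  | .add, a, b => a + b
  | .sub, a, b => a - b
  | .mul, a, b => a * b
  | .div, a, b => a / b
  | .mod, a, b => a % b

/-- Operations on reals. -/
inductive RealOp
  | add | sub | mul | div

noncomputable def RealOp.eval : RealOp → ℝ → ℝ → ℝ
  | .add, a, b => a + b
  | .sub, a, b => a - b
  | .mul, a, b => a * b
  | .div, a, b => a / b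

/-- Elementary instructions.  All natural number arguments are names of registers, except the
literal `v` of `wconst`; the first argument is the target, except in the `store` instructions,
where it is the register holding the address. -/
inductive Instr
  /-- `w[d] := v` -/
  | wconst (d v : ℕ)
  /-- `w[d] := w[a] op w[b]` -/
  | wop (op : WordOp) (d a b : ℕ)
  /-- `w[d] := wmem[w[a]]` -/
  | wload (d a : ℕ)
  /-- `wmem[w[a]] := w[s]` -/
  | wstore (a s : ℕ)
  /-- `r[d] := w[a]` -/
  | rcast (d a : ℕ)
  /-- `r[d] := r[a] op r[b]` -/
  | rop (op : RealOp) (d a b : ℕ)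
  /-- `r[d] := rmem[w[a]]` -/
  | rload (d a : ℕ)
  /-- `rmem[w[a]] := r[s]` -/
  | rstore (a s : ℕ)

noncomputable def Instr.exec : Instr → State → State
  | .wconst d v, σ => { σ with wreg := Function.update σ.wreg d v }
  | .wop op d a b, σ =>
      { σ with wreg := Function.update σ.wreg d (op.eval (σ.wreg a) (σ.wreg b)) }
  | .wload d a, σ => { σ with wreg := Function.update σ.wreg d (σ.wmem (σ.wreg a)) }
  | .wstore a s, σ => { σ with wmem := Function.update σ.wmem (σ.wreg a) (σ.wreg s) }
  | .rcast d a, σ => { σ with rreg := Function.update σ.rreg d (σ.wreg a : ℝ) }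
  | .rop op d a b, σ =>
      { σ with rreg := Function.update σ.rreg d (op.eval (σ.rreg a) (σ.rreg b)) }
  | .rload d a, σ => { σ with rreg := Function.update σ.rreg d (σ.rmem (σ.wreg a)) }
  | .rstore a s, σ => { σ with rmem := Function.update σ.rmem (σ.wreg a) (σ.rreg s) }

/-- Tests compare two registers of the same kind. -/
inductive Test
  | wle (a b : ℕ)
  | rle (a b : ℕ)

def Test.Holds : Test → State → Prop
  | .wle a b, σ => σ.wreg a ≤ σ.wreg b
  | .rle a b, σ => σ.rreg a ≤ σ.rreg b

/-- Programs. -/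
inductive Program
  | skip
  | instr (i : Instr)
  | seq (p q : Program)
  | ite (b : Test) (p q : Program)
  | loop (b : Test) (p : Program)

/-- `Exec N p σ τ t`: on the machine whose words are the numbers below `N`, the program `p` started
in the state `σ` halts in the state `τ` after exactly `t` steps.  `loop b p` is the while loop.
An instruction whose result does not fit into a word has no successor state (the run fails). -/
inductive Exec (N : ℕ) : Program → State → State → ℕ → Prop
  | skip (σ) : Exec N .skip σ σ 0
  | instr (i σ) (h : (i.exec σ).Bounded N) : Exec N (.instr i) σ (i.exec σ) 1
  | seq {p q σ τ υ s t} (hp : Exec N p σ τ s) (hq : Exec N q τ υ t) :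
      Exec N (.seq p q) σ υ (s + t)
  | ite_true {b p q σ τ t} (hb : b.Holds σ) (hp : Exec N p σ τ t) :
      Exec N (.ite b p q) σ τ (t + 1)
  | ite_false {b p q σ τ t} (hb : ¬ b.Holds σ) (hq : Exec N q σ τ t) :
      Exec N (.ite b p q) σ τ (t + 1)
  | loop_stop {b p σ} (hb : ¬ b.Holds σ) : Exec N (.loop b p) σ σ 1
  | loop_step {b p σ τ υ s t} (hb : b.Holds σ) (hp : Exec N p σ τ s)
      (hl : Exec N (.loop b p) τ υ t) : Exec N (.loop b p) σ υ (s + t + 1)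

/-- The machine is deterministic: final state and number of steps of a run are unique. -/
theorem Exec.deterministic {N : ℕ} {p : Program} {σ τ τ' : State} {t t' : ℕ}
    (h : Exec N p σ τ t) (h' : Exec N p σ τ' t') : τ = τ' ∧ t = t' := by
  induction h generalizing τ' t' with
  | skip σ => cases h'; exact ⟨rfl, rfl⟩
  | instr i σ hb => cases h'; exact ⟨rfl, rfl⟩
  | seq hp hq ihp ihq =>
    cases h' with
    | seq hp' hq' =>
      obtain ⟨rfl, rfl⟩ := ihp hp'
      obtain ⟨rfl, rfl⟩ := ihq hq'
      exact ⟨rfl, rfl⟩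
  | ite_true hb hp ih =>
    cases h' with
    | ite_true hb' hp' =>
      obtain ⟨rfl, rfl⟩ := ih hp'
      exact ⟨rfl, rfl⟩
    | ite_false hb' hq' => exact absurd hb hb'
  | ite_false hb hq ih =>
    cases h' with
    | ite_true hb' hp' => exact absurd hb' hb
    | ite_false hb' hq' =>
      obtain ⟨rfl, rfl⟩ := ih hq'
      exact ⟨rfl, rfl⟩
  | loop_stop hb =>
    cases h' with
    | loop_stop hb' => exact ⟨rfl, rfl⟩
    | loop_step hb' hp' hl' => exact absurd hb' hb
  | loop_step hb hp hl ihp ihl =>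
    cases h' with
    | loop_stop hb' => exact absurd hb hb'
    | loop_step hb' hp' hl' =>
      obtain ⟨rfl, rfl⟩ := ihp hp'
      obtain ⟨rfl, rfl⟩ := ihl hl'
      exact ⟨rfl, rfl⟩

end RAM

namespace DistanceOracle

open RAM

/-- The contents of a stored data structure: a block of words and a block of reals. -/
structure Data where
  words : List ℕ
  reals : List ℝ

/-- The size of a data structure is the number of memory cells that it occupies. -/
def Data.size (D : Data) : ℕ := D.words.length + D.reals.length

/-- The input of the construction, for points `0, …, n - 1` with distances `d`: word register `0`
holds `n`, real registers `0` and `1` hold `k` and `ε`, and the real memory holds the distance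
matrix row by row.  All other cells are zero. -/
noncomputable def buildInput (n : ℕ) (d : Fin n → Fin n → ℝ) (k ε : ℝ) : State where
  wreg := fun i => if i = 0 then n else 0
  rreg := fun i => if i = 0 then k else if i = 1 then ε else 0
  wmem := fun _ => 0
  rmem := fun a => if h : a % n < n ∧ a / n < n then d ⟨a / n, h.2⟩ ⟨a % n, h.1⟩ else 0

/-- The output of the construction: word registers `0` and `1` hold the lengths of the two blocks,
which stand at the beginning of the word memory and of the real memory. -/
def buildOutput (τ : State) : Data where
  words := (List.range (τ.wreg 0)).map τ.wmem
  reals := (List.range (τ.wreg 1)).map τ.rmem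

/-- The input of a query for the points `i` and `j`: the memory holds the data structure and nothing
else, and word registers `0` and `1` hold `i` and `j`.  All other cells are zero. -/
def queryInput (D : Data) (i j : ℕ) : State where
  wreg := fun a => if a = 0 then i else if a = 1 then j else 0
  rreg := fun _ => 0
  wmem := fun a => D.words.getD a 0
  rmem := fun a => D.reals.getD a 0

/-- `build`, run on the input `(n, d, k, ε)`, halts after `t` steps with the data structure `D`. -/
def Builds (N : ℕ) (build : Program) (n : ℕ) (d : Fin n → Fin n → ℝ) (k ε : ℝ)
    (D : Data) (t : ℕ) : Prop :=
  ∃ τ : State, Exec N build (buildInput n d k ε) τ t ∧ buildOutput τ = D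

/-- `query`, run on the data structure `D` and the points `i` and `j`, halts after `t` steps with
the answer `x` in real register `0`. -/
def Answers (N : ℕ) (query : Program) (D : Data) (i j : ℕ) (x : ℝ) (t : ℕ) : Prop :=
  ∃ τ : State, Exec N query (queryInput D i j) τ t ∧ τ.rreg 0 = x

end DistanceOracle

/-! The oracle is made of hierarchical partitions in the style of the Ramsey decompositions of
Mendel and Naor, with a potential in place of randomness. In one `Carving` the points are cut, at
decreasing scales, into balls whose radius is chosen among `K` concentric ones, with `K` about `k`;
points in the annulus around the cut lose their mark. A point that stays marked is never cut off
from points that are closer than the width of the cut (`Carving.same_of_marked`), and the classes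
left by a round have small diameter (`Carving.dist_le_of_same`). The centre is a free point with the
most marked points in its smallest ball, and the radius is the place where the balls grow by the
smallest factor. Let every marked point contribute the power `-1 / K` of the largest number of
marked points in a ball of its class. The two choices ensure that the sum of the contributions never
decreases (`potential_carve`), and comparing its first and last values shows that at least `a ^ (1 -
1 / K)` of `a` points stay marked (`Carving.le_card_marked`).

Repeating this for the points that lost their mark gives a `Family` of trees. A tree has at most `n
^ (1 / K)` times as many points as stay marked in it, and each point stays marked once, so the trees
have at most `n ^ (1 + 1 / K)` leaves altogether (`Family.sum_level_le`). Two points are compared in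
the last tree that contains both, where one of them stays marked.

The scales are drawn from the distances so that they grow by a factor of at least `6 / 5` and every
positive distance is within `6 / 5` of one of them (`IsScale.exists_scale`). Consecutive radii of a
carving have to differ by a large factor, so the scales are distributed over sixteen families
(`IsScale.scales`). In every family the two points part in a class whose diameter is at least their
distance, and in the family of the right scale it is at most `8 * k` times the distance
(`Forest.exists_le_dist`). The answer is the minimum of the sixteen estimates. It has stretch `8 *
k` and takes constant time, so nothing has to be paid for `ε`.

For constant query time all leaves are sorted lexicographically by the record of their cuts, so that
classes are intervals. The diameter of the class in which two leaves part is controlled from both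
sides by the largest of the diameters recorded between neighbours (`Gaps.exists_le`,
`Gaps.le_of_class`). This range maximum is found with bit masks in blocks of logarithmic length and
a sparse table over the blocks (`RangeMax.isMax_value`).

The programs are obtained from a language of expressions with bounded sums by a verified compiler
(`Ex.runs_comp`, `Cmd.runs_comp`), with polynomial bounds on words and time (`PolyBdd`). The
construction is a list of tables, each entry being an expression in earlier entries (`Before`); the
query is an expression without sums, and these have constant cost (`Ex.Flat.cost_eq`). -/

namespace RAM

/-! ### A language of expressions -/

/-- The sorts of expressions. -/
inductive Sort3
  | word | real | prop

/-- The values of a sort. -/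
@[reducible] def Sort3.Val : Sort3 → Type
  | .word => ℕ
  | .real => ℝ
  | .prop => Prop

/-- Expressions over the registers `0, …, 63` and the memory; `sum x m e` is `∑ x < m, e`. -/
inductive Ex : Sort3 → Type
  | const (v : ℕ) : Ex .word
  | var (x : Fin 64) : Ex .word
  | op (o : WordOp) (a b : Ex .word) : Ex .word
  | read (a : Ex .word) : Ex .word
  | sum (x : Fin 64) (m e : Ex .word) : Ex .word
  | ind (b : Ex .prop) : Ex .word
  | rvar (x : Fin 64) : Ex .real
  | cast (a : Ex .word) : Ex .real
  | rop (o : RealOp) (a b : Ex .real) : Ex .real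
  | rread (a : Ex .word) : Ex .real
  | wle (a b : Ex .word) : Ex .prop
  | rle (a b : Ex .real) : Ex .prop
  | not (a : Ex .prop) : Ex .prop
  | and (a b : Ex .prop) : Ex .prop

/-- Set a word register. -/
def State.setw (σ : State) (x i : ℕ) : State := { σ with wreg := Function.update σ.wreg x i }

/-- Set a real register. -/
def State.setr (σ : State) (x : ℕ) (v : ℝ) : State :=
  { σ with rreg := Function.update σ.rreg x v }

open Classical in
/-- The value of an expression. -/
noncomputable def Ex.eval : {s : Sort3} → Ex s → State → s.Val
  | _, .const v, _ => v
  | _, .var x, σ => σ.wreg x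
  | _, .op o a b, σ => o.eval (a.eval σ) (b.eval σ)
  | _, .read a, σ => σ.wmem (a.eval σ)
  | _, .sum x m e, σ => ∑ i ∈ Finset.range (m.eval σ), e.eval (σ.setw x i)
  | _, .ind b, σ => if b.eval σ then 1 else 0
  | _, .rvar x, σ => σ.rreg x
  | _, .cast a, σ => (a.eval σ : ℝ)
  | _, .rop o a b, σ => o.eval (a.eval σ) (b.eval σ)
  | _, .rread a, σ => σ.rmem (a.eval σ)
  | _, .wle a b, σ => a.eval σ ≤ b.eval σ
  | _, .rle a b, σ => a.eval σ ≤ b.eval σ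
  | _, .not a, σ => ¬ a.eval σ
  | _, .and a b, σ => a.eval σ ∧ b.eval σ

/-- A bound for all words that occur in the evaluation of an expression when the registers and the
memory hold words `≤ V`. -/
def Ex.peak : {s : Sort3} → Ex s → ℕ → ℕ
  | _, .const v, _ => v
  | _, .var _, V => V
  | _, .op _ a b, V => (a.peak V + 1) * (b.peak V + 1)
  | _, .read a, V => a.peak V + V
  | _, .sum _ m e, V => (m.peak V + 2) * (e.peak (V + m.peak V) + V + 2)
  | _, .ind b, V => b.peak V + 1
  | _, .rvar _, _ => 0
  | _, .cast a, V => a.peak V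
  | _, .rop _ a b, V => a.peak V + b.peak V
  | _, .rread a, V => a.peak V
  | _, .wle a b, V => a.peak V + b.peak V + 1
  | _, .rle a b, V => a.peak V + b.peak V + 1
  | _, .not a, V => a.peak V + 1
  | _, .and a b, V => a.peak V + b.peak V + 1

/-- A bound for the time of the evaluation of an expression. -/
def Ex.cost : {s : Sort3} → Ex s → ℕ → ℕ
  | _, .const _, _ => 1
  | _, .var _, _ => 2
  | _, .op _ a b, V => a.cost V + b.cost V + 1
  | _, .read a, V => a.cost V + 1
  | _, .sum _ m e, V => m.cost V + m.peak V * (e.cost (V + m.peak V) + 4) + 20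
  | _, .ind b, V => b.cost V
  | _, .rvar _, _ => 3
  | _, .cast a, V => a.cost V + 1
  | _, .rop _ a b, V => a.cost V + b.cost V + 1
  | _, .rread a, V => a.cost V + 1
  | _, .wle a b, V => a.cost V + b.cost V + 2
  | _, .rle a b, V => a.cost V + b.cost V + 2
  | _, .not a, V => a.cost V + 2
  | _, .and a b, V => a.cost V + b.cost V + 1

/-- Composition of several programs. -/
def block : List Program → Program
  | [] => .skip
  | p :: ps => .seq p (block ps)

/-- A program that computes an expression into register `t`, using only registers from `t` on. -/
def Ex.comp : {s : Sort3} → Ex s → ℕ → Program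
  | _, .const v, t => .instr (.wconst t v)
  -- The machine has no move instruction, so a register is copied by adding a zero to it.
  | _, .var x, t => block [.instr (.wconst t 0), .instr (.wop .add t t x)]
  | _, .op o a b, t => block [a.comp t, b.comp (t + 1), .instr (.wop o t t (t + 1))]
  | _, .read a, t => block [a.comp t, .instr (.wload t t)]
  | _, .sum x m e, t => block [m.comp (t + 1), .instr (.wconst t 0),
      .instr (.wop .add (t + 2) x t), .instr (.wconst (t + 4) 1),
      .instr (.wconst (t + 3) 1),
      -- As the word test is `≤`, the counter runs from `1` up to the bound and the summation
      -- variable is the counter minus one.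
      .loop (.wle (t + 3) (t + 1)) (block [.instr (.wop .sub x (t + 3) (t + 4)), e.comp (t + 5),
        .instr (.wop .add t t (t + 5)), .instr (.wop .add (t + 3) (t + 3) (t + 4))]),
      .instr (.wconst (t + 4) 0), .instr (.wop .add x (t + 2) (t + 4))]
  | _, .ind b, t => b.comp t
  | _, .rvar x, t => block [.instr (.wconst t 0), .instr (.rcast t t),
      .instr (.rop .add t x t)]
  | _, .cast a, t => block [a.comp t, .instr (.rcast t t)]
  | _, .rop o a b, t => block [a.comp t, b.comp (t + 1), .instr (.rop o t t (t + 1))]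
  | _, .rread a, t => block [a.comp t, .instr (.rload t t)]
  | _, .wle a b, t => block [a.comp t, b.comp (t + 1),
      .ite (.wle t (t + 1)) (.instr (.wconst t 1)) (.instr (.wconst t 0))]
  | _, .rle a b, t => block [a.comp t, b.comp (t + 1),
      .ite (.rle t (t + 1)) (.instr (.wconst t 1)) (.instr (.wconst t 0))]
  | _, .not a, t => block [a.comp t, .instr (.wconst (t + 1) 1),
      .instr (.wop .sub t (t + 1) t)]
  | _, .and a b, t => block [a.comp t, b.comp (t + 1), .instr (.wop .mul t t (t + 1))]

/-! ### Agreement of states -/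

/-- The states have the same memory and the same registers below `t`. -/
structure Agree (t : ℕ) (σ τ : State) : Prop where
  wreg : ∀ r < t, τ.wreg r = σ.wreg r
  rreg : ∀ r < t, τ.rreg r = σ.rreg r
  wmem : τ.wmem = σ.wmem
  rmem : τ.rmem = σ.rmem

theorem Agree.refl (t : ℕ) (σ : State) : Agree t σ σ := ⟨fun _ _ => rfl, fun _ _ => rfl, rfl, rfl⟩

theorem Agree.trans {t : ℕ} {σ τ υ : State} (h : Agree t σ τ) (h' : Agree t τ υ) : Agree t σ υ :=
  ⟨fun r hr => (h'.wreg r hr).trans (h.wreg r hr), fun r hr => (h'.rreg r hr).trans (h.rreg r hr),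
    h'.wmem.trans h.wmem, h'.rmem.trans h.rmem⟩

theorem Agree.mono {s t : ℕ} {σ τ : State} (h : Agree t σ τ) (hs : s ≤ t) : Agree s σ τ :=
  ⟨fun r hr => h.wreg r (hr.trans_le hs), fun r hr => h.rreg r (hr.trans_le hs), h.wmem, h.rmem⟩

theorem Agree.setw {t : ℕ} {σ τ : State} (h : Agree t σ τ) (x i : ℕ) :
    Agree t (σ.setw x i) (τ.setw x i) := by
  refine ⟨fun r hr => ?_, h.rreg, h.wmem, h.rmem⟩
  by_cases hx : r = x
  · simp [State.setw, hx]
  · simp [State.setw, Function.update_of_ne hx, h.wreg r hr]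

theorem Agree.setw_right {t : ℕ} {σ τ : State} (h : Agree t σ τ) {x : ℕ} (hx : t ≤ x) (i : ℕ) :
    Agree t σ (τ.setw x i) := by
  refine ⟨fun r hr => ?_, h.rreg, h.wmem, h.rmem⟩
  have : r ≠ x := by omega
  simp [State.setw, Function.update_of_ne this, h.wreg r hr]

theorem Agree.setr_right {t : ℕ} {σ τ : State} (h : Agree t σ τ) {x : ℕ} (hx : t ≤ x) (v : ℝ) :
    Agree t σ (τ.setr x v) := by
  refine ⟨h.wreg, fun r hr => ?_, h.wmem, h.rmem⟩
  have : r ≠ x := by omega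
  simp [State.setr, Function.update_of_ne this, h.rreg r hr]

theorem Agree.setr {t : ℕ} {σ τ : State} (h : Agree t σ τ) (x : ℕ) (v : ℝ) :
    Agree t (σ.setr x v) (τ.setr x v) := by
  refine ⟨h.wreg, fun r hr => ?_, h.wmem, h.rmem⟩
  by_cases hx : r = x
  · simp [State.setr, hx]
  · simp [State.setr, Function.update_of_ne hx, h.rreg r hr]

/-- Expressions mention only registers below `64`. The scratch registers of compiled code start at
`64`, so they cannot influence a value. -/
theorem Ex.eval_congr {s : Sort3} (e : Ex s) {σ τ : State} (h : Agree 64 σ τ) :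
    e.eval τ = e.eval σ := by
  induction e generalizing σ τ with
  | const v => rfl
  | var x => exact h.wreg _ x.2
  | op o a b iha ihb => simp only [Ex.eval, iha h, ihb h]
  | read a ih => simp only [Ex.eval, ih h, h.wmem]
  | sum x m e ihm ihe => simp only [Ex.eval, ihm h, fun i => ihe (h.setw x i)]
  | ind b ih =>
    have hb := ih h
    simp only [Ex.eval]
    split_ifs <;> simp_all
  | rvar x => exact h.rreg _ x.2
  | cast a ih => simp only [Ex.eval, ih h]
  | rop o a b iha ihb => simp only [Ex.eval, iha h, ihb h]
  | rread a ih => simp only [Ex.eval, ih h, h.rmem]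
  | wle a b iha ihb => simp only [Ex.eval, iha h, ihb h]
  | rle a b iha ihb => simp only [Ex.eval, iha h, ihb h]
  | not a ih => simp only [Ex.eval, ih h]
  | and a b iha ihb => simp only [Ex.eval, iha h, ihb h]

/-- The words that expressions can see are at most `V`. -/
structure Small (V : ℕ) (σ : State) : Prop where
  wreg : ∀ r < 64, σ.wreg r ≤ V
  wmem : ∀ a, σ.wmem a ≤ V

theorem Small.agree {V t : ℕ} {σ τ : State} (h : Small V σ) (ha : Agree t σ τ) (ht : 64 ≤ t) :
    Small V τ :=
  ⟨fun r hr => (ha.wreg r (hr.trans_le ht)).trans_le (h.wreg r hr),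
    fun a => by rw [ha.wmem]; exact h.wmem a⟩

theorem Small.mono {V W : ℕ} {σ : State} (h : Small V σ) (hV : V ≤ W) : Small W σ :=
  ⟨fun r hr => (h.wreg r hr).trans hV, fun a => (h.wmem a).trans hV⟩

theorem Small.setw {V x i : ℕ} {σ : State} (h : Small V σ) (hi : i ≤ V) : Small V (σ.setw x i) := by
  refine ⟨fun r hr => ?_, h.wmem⟩
  by_cases hx : r = x
  · simpa [State.setw, hx] using hi
  · simpa [State.setw, Function.update_of_ne hx] using h.wreg r hr

theorem WordOp.eval_le (o : WordOp) (a b : ℕ) : o.eval a b ≤ (a + 1) * (b + 1) := by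
  cases o <;> simp only [WordOp.eval]
  · nlinarith
  · exact (Nat.sub_le a b).trans (by nlinarith)
  · nlinarith
  · exact (Nat.div_le_self a b).trans (by nlinarith)
  · exact (Nat.mod_le a b).trans (by nlinarith)

theorem Ex.eval_le_peak {e : Ex .word} {V : ℕ} {σ : State} (h : Small V σ) :
    @LE.le ℕ _ (e.eval σ) (e.peak V) := by
  -- The sort is an index of `Ex`, so the induction must range over all sorts; the equation `s =
  -- .word` disposes of the others.
  suffices H : ∀ {s : Sort3} (e : Ex s) (hs : s = .word) (V : ℕ) (σ : State), Small V σ →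
      @LE.le ℕ _ ((hs ▸ e).eval σ) (e.peak V) from H e rfl V σ h
  intro s e
  induction e with
  | const v => intro _ V σ _; exact le_rfl
  | var x => intro _ V σ h; exact h.wreg _ x.2
  | op o a b iha ihb =>
    intro _ V σ h
    exact (o.eval_le _ _).trans (Nat.mul_le_mul (Nat.succ_le_succ (iha rfl V σ h))
      (Nat.succ_le_succ (ihb rfl V σ h)))
  | read a ih => intro _ V σ h; exact (h.wmem _).trans (Nat.le_add_left _ _)
  | sum x m e ihm ihe =>
    intro _ V σ h
    have hm : @LE.le ℕ _ (m.eval σ) (m.peak V) := ihm rfl V σ h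
    have h1 : ∀ i ∈ Finset.range (m.eval σ), e.eval (σ.setw x i) ≤ e.peak (V + m.peak V) := by
      intro i hi
      -- The summation variable can be as large as the bound, which is why the body is estimated at
      -- `V + m.peak V`.
      refine ihe rfl _ _ ((h.mono (Nat.le_add_right _ _)).setw ?_)
      have := Finset.mem_range.1 hi
      omega
    have h2 := Finset.sum_le_card_nsmul _ _ _ h1
    simp only [Finset.card_range, smul_eq_mul] at h2
    exact h2.trans (Nat.mul_le_mul (by omega) (by omega))
  | ind b ih =>
    intro _ V σ h
    simp only [Ex.eval, Ex.peak]
    split_ifs <;> omega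
  | rvar x => intro h; cases h
  | cast a ih => intro h; cases h
  | rop o a b iha ihb => intro h; cases h
  | rread a ih => intro h; cases h
  | wle a b iha ihb => intro h; cases h
  | rle a b iha ihb => intro h; cases h
  | not a ih => intro h; cases h
  | and a b iha ihb => intro h; cases h

/-! ### Runs -/

/-- `p`, started in `σ`, halts after at most `T` steps in a state with bounded words that satisfies
`Q`. -/
def Runs (N : ℕ) (p : Program) (σ : State) (T : ℕ) (Q : State → Prop) : Prop :=
  ∃ τ s, Exec N p σ τ s ∧ s ≤ T ∧ τ.Bounded N ∧ Q τ

theorem Runs.mono {N : ℕ} {p : Program} {σ : State} {T T' : ℕ} {Q Q' : State → Prop}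
    (h : Runs N p σ T Q) (hT : T ≤ T') (hQ : ∀ τ, τ.Bounded N → Q τ → Q' τ) :
    Runs N p σ T' Q' := by
  obtain ⟨τ, s, h1, h2, h3, h4⟩ := h
  exact ⟨τ, s, h1, h2.trans hT, h3, hQ τ h3 h4⟩

theorem Runs.seq {N : ℕ} {p q : Program} {σ : State} {T T' : ℕ} {Q Q' : State → Prop}
    (h : Runs N p σ T Q) (h' : ∀ τ, τ.Bounded N → Q τ → Runs N q τ T' Q') :
    Runs N (.seq p q) σ (T + T') Q' := by
  obtain ⟨τ, s, h1, h2, h3, h4⟩ := h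
  obtain ⟨υ, s', h1', h2', h3', h4'⟩ := h' τ h3 h4
  exact ⟨υ, _, .seq h1 h1', Nat.add_le_add h2 h2', h3', h4'⟩

theorem runs_nil {N : ℕ} {σ : State} {Q : State → Prop} (hσ : σ.Bounded N) (h : Q σ) :
    Runs N (block []) σ 0 Q :=
  ⟨σ, 0, .skip σ, le_rfl, hσ, h⟩

theorem Runs.cons {N : ℕ} {p : Program} {ps : List Program} {σ : State} {T T' U : ℕ}
    {Q Q' : State → Prop} (h : Runs N p σ T Q)
    (h' : ∀ τ, τ.Bounded N → Q τ → Runs N (block ps) τ T' Q') (hU : T + T' ≤ U := by omega) :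
    Runs N (block (p :: ps)) σ U Q' :=
  (h.seq h').mono hU fun _ _ => id

theorem runs_instr {N : ℕ} {i : Instr} {σ : State} {Q : State → Prop} (h : (i.exec σ).Bounded N)
    (hQ : Q (i.exec σ)) : Runs N (.instr i) σ 1 Q :=
  ⟨_, 1, .instr i σ h, le_rfl, h, hQ⟩

theorem State.Bounded.setw {N x i : ℕ} {σ : State} (h : σ.Bounded N) (hi : i < N) :
    (σ.setw x i).Bounded N := by
  refine ⟨fun r => ?_, h.2⟩
  by_cases hx : r = x
  · simpa [State.setw, hx] using hi
  · simpa [State.setw, Function.update_of_ne hx] using h.1 r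

section instructions

variable {N : ℕ} {σ : State} {Q : State → Prop}

theorem runs_wconst {d v : ℕ} (h : σ.Bounded N) (hv : v < N) (hQ : Q (σ.setw d v)) :
    Runs N (.instr (.wconst d v)) σ 1 Q :=
  runs_instr (h.setw hv) hQ

theorem runs_wop {o : WordOp} {d a b : ℕ} (h : σ.Bounded N)
    (hv : o.eval (σ.wreg a) (σ.wreg b) < N)
    (hQ : Q (σ.setw d (o.eval (σ.wreg a) (σ.wreg b)))) : Runs N (.instr (.wop o d a b)) σ 1 Q :=
  runs_instr (h.setw hv) hQ

theorem runs_wload {d a : ℕ} (h : σ.Bounded N) (hQ : Q (σ.setw d (σ.wmem (σ.wreg a)))) :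
    Runs N (.instr (.wload d a)) σ 1 Q :=
  runs_instr (h.setw (h.2 _)) hQ

theorem runs_rcast {d a : ℕ} (h : σ.Bounded N) (hQ : Q (σ.setr d (σ.wreg a))) :
    Runs N (.instr (.rcast d a)) σ 1 Q :=
  runs_instr h hQ

theorem runs_rop {o : RealOp} {d a b : ℕ} (h : σ.Bounded N)
    (hQ : Q (σ.setr d (o.eval (σ.rreg a) (σ.rreg b)))) : Runs N (.instr (.rop o d a b)) σ 1 Q :=
  runs_instr h hQ

theorem runs_rload {d a : ℕ} (h : σ.Bounded N) (hQ : Q (σ.setr d (σ.rmem (σ.wreg a)))) :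
    Runs N (.instr (.rload d a)) σ 1 Q :=
  runs_instr h hQ

theorem runs_ite {b : Test} {p q : Program} {T : ℕ} (ht : b.Holds σ → Runs N p σ T Q)
    (hf : ¬ b.Holds σ → Runs N q σ T Q) : Runs N (.ite b p q) σ (T + 1) Q := by
  by_cases hb : b.Holds σ
  · obtain ⟨τ, s, h1, h2, h3⟩ := ht hb
    exact ⟨τ, s + 1, .ite_true hb h1, Nat.succ_le_succ h2, h3⟩
  · obtain ⟨τ, s, h1, h2, h3⟩ := hf hb
    exact ⟨τ, s + 1, .ite_false hb h1, Nat.succ_le_succ h2, h3⟩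

/-- A loop that runs through `m` rounds, with an invariant. -/
theorem runs_loop {b : Test} {p : Program} {T m : ℕ} (I : ℕ → State → Prop)
    (hp : ∀ i < m, ∀ τ, τ.Bounded N → I i τ → b.Holds τ ∧ Runs N p τ T (I (i + 1)))
    (hm : ∀ τ, τ.Bounded N → I m τ → ¬ b.Holds τ) (hσ : σ.Bounded N) (h0 : I 0 σ) :
    Runs N (.loop b p) σ (m * (T + 1) + 1) (I m) := by
  -- Induction on the number `j` of remaining rounds: `loop_step` splits off the first round, so the
  -- invariant enters at index `m - j`.
  suffices H : ∀ j ≤ m, ∀ τ, τ.Bounded N → I (m - j) τ →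
      Runs N (.loop b p) τ (j * (T + 1) + 1) (I m) from H m le_rfl σ hσ (by simpa using h0)
  intro j
  induction j with
  | zero =>
    intro _ τ hτ hI
    simp only [Nat.sub_zero] at hI
    exact ⟨τ, 1, by constructor; exact hm τ hτ hI, by omega, hτ, hI⟩
  | succ j ih =>
    intro hj τ hτ hI
    obtain ⟨hb, υ, s, h1, h2, h3, h4⟩ := hp (m - (j + 1)) (by omega) τ hτ hI
    rw [show m - (j + 1) + 1 = m - j by omega] at h4
    obtain ⟨φ, s', h1', h2', h3', h4'⟩ := ih (by omega) υ h3 h4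
    exact ⟨φ, _, .loop_step hb h1 h1', by rw [Nat.succ_mul]; omega, h3', h4'⟩

end instructions

/-- Register `t` holds the value `v`. -/
def Holds : {s : Sort3} → State → ℕ → s.Val → Prop
  | .word, σ, t, v => σ.wreg t = v
  | .real, σ, t, v => σ.rreg t = v
  | .prop, σ, t, v => (v → σ.wreg t = 1) ∧ (¬ v → σ.wreg t = 0)

theorem Holds.agree {s : Sort3} {σ τ : State} {t u : ℕ} {v : s.Val} (h : Holds σ t v)
    (ha : Agree u σ τ) (ht : t < u) : Holds τ t v := by
  cases s
  · exact (ha.wreg t ht).trans h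
  · exact (ha.rreg t ht).trans h
  · exact ⟨fun hv => (ha.wreg t ht).trans (h.1 hv), fun hv => (ha.wreg t ht).trans (h.2 hv)⟩

@[simp] theorem State.setw_wreg_same (σ : State) (x i : ℕ) : (σ.setw x i).wreg x = i := by
  simp [State.setw]

theorem State.setw_wreg_ne (σ : State) {x y : ℕ} (i : ℕ) (h : y ≠ x) :
    (σ.setw x i).wreg y = σ.wreg y := by
  simp [State.setw, h]

theorem State.setw_wreg (σ : State) (x y i : ℕ) :
    (σ.setw x i).wreg y = if y = x then i else σ.wreg y := by
  simp [State.setw, Function.update_apply]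

@[simp] theorem State.setw_wmem (σ : State) (x i : ℕ) : (σ.setw x i).wmem = σ.wmem := rfl
@[simp] theorem State.setw_rmem (σ : State) (x i : ℕ) : (σ.setw x i).rmem = σ.rmem := rfl
@[simp] theorem State.setw_rreg (σ : State) (x i : ℕ) : (σ.setw x i).rreg = σ.rreg := rfl
@[simp] theorem State.setr_rreg_same (σ : State) (x : ℕ) (v : ℝ) : (σ.setr x v).rreg x = v := by
  simp [State.setr]

theorem State.setr_rreg (σ : State) (x y : ℕ) (v : ℝ) :
    (σ.setr x v).rreg y = if y = x then v else σ.rreg y := by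
  simp [State.setr, Function.update_apply]

/-- Two subexpressions evaluated into consecutive registers. -/
theorem Runs.cons_two {N t V Ta Tb T' U : ℕ} {s s' : Sort3} {a : Ex s} {b : Ex s'} {σ : State}
    {ps : List Program} {Q' : State → Prop} (ht : 64 ≤ t) (hs : Small V σ)
    (ha : Runs N (a.comp t) σ Ta (fun τ => Agree t σ τ ∧ Holds τ t (a.eval σ)))
    (hb : ∀ τ : State, τ.Bounded N → Small V τ →
      Runs N (b.comp (t + 1)) τ Tb (fun υ => Agree (t + 1) τ υ ∧ Holds υ (t + 1) (b.eval τ)))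
    (h' : ∀ υ : State, υ.Bounded N → Agree t σ υ → Holds υ t (a.eval σ) →
      Holds υ (t + 1) (b.eval σ) → Runs N (block ps) υ T' Q')
    (hU : Ta + Tb + T' ≤ U := by omega) :
    Runs N (block (a.comp t :: b.comp (t + 1) :: ps)) σ U Q' := by
  refine ha.cons (T' := Tb + T') (fun τ hτ h1 => (hb τ hτ (hs.agree h1.1 ht)).cons
    (fun υ hυ h2 => h' υ hυ (h1.1.trans (h2.1.mono (by omega))) (h1.2.agree h2.1 (by omega)) ?_))
  rw [← b.eval_congr (h1.1.mono ht)]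
  exact h2.2

/-- The compiled expression computes the value of the expression. -/
theorem Ex.runs_comp {N : ℕ} {s : Sort3} (e : Ex s) :
    ∀ (t V : ℕ) (σ : State), 64 ≤ t → Small V σ → σ.Bounded N → e.peak V + 2 ≤ N →
      Runs N (e.comp t) σ (e.cost V) (fun τ => Agree t σ τ ∧ Holds τ t (e.eval σ)) := by
  induction e with
  | const v =>
    intro t V σ ht hs hσ hN
    simp only [Ex.peak] at hN
    exact runs_wconst hσ (by omega) ⟨(Agree.refl t σ).setw_right le_rfl _, by simp [Holds, Ex.eval]⟩
  | var x =>
    intro t V σ ht hs hσ hN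
    simp only [Ex.peak] at hN
    refine (runs_wconst hσ (by omega) (Q := fun τ => τ = σ.setw t 0) rfl).cons (T' := 1) ?_
      (by simp [Ex.cost])
    rintro τ hτ rfl
    have hx : (x : ℕ) ≠ t := by have := x.2; omega
    refine (runs_wop hτ ?_ ?_).cons (fun τ hτ h => runs_nil hτ h)
    · simpa [WordOp.eval, State.setw_wreg, hx] using hσ.1 x
    · refine ⟨((Agree.refl t σ).setw_right le_rfl _).setw_right le_rfl _, ?_⟩
      simp [Holds, WordOp.eval, State.setw_wreg, hx, Ex.eval]
  | op o a b iha ihb =>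
    intro t V σ ht hs hσ hN
    simp only [Ex.peak] at hN
    have h1 : a.peak V + 1 ≤ (a.peak V + 1) * (b.peak V + 1) :=
      Nat.le_mul_of_pos_right _ (Nat.succ_pos _)
    have h2 : b.peak V + 1 ≤ (a.peak V + 1) * (b.peak V + 1) :=
      Nat.le_mul_of_pos_left _ (Nat.succ_pos _)
    refine Runs.cons_two ht hs (iha t V σ ht hs hσ (by omega))
      (fun τ hτ hsτ => ihb (t + 1) V τ (by omega) hsτ hτ (by omega)) (T' := 1) ?_ le_rfl
    intro υ hυ hag h3 h4
    simp only [Holds] at h3 h4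
    refine (runs_wop hυ ?_ ?_).cons (fun τ hτ h => runs_nil hτ h)
    · rw [h3, h4]
      have := (Ex.op o a b).eval_le_peak hs
      simp only [Ex.eval, Ex.peak] at this
      omega
    · rw [h3, h4]
      exact ⟨hag.setw_right le_rfl _, by simp [Holds, Ex.eval]⟩
  | read a ih =>
    intro t V σ ht hs hσ hN
    simp only [Ex.peak] at hN
    refine (ih t V σ ht hs hσ (by omega)).cons (T' := 1) ?_ le_rfl
    rintro τ hτ ⟨hag, h3⟩
    simp only [Holds] at h3
    refine (runs_wload hτ ?_).cons (fun τ hτ h => runs_nil hτ h)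
    exact ⟨hag.setw_right le_rfl _, by simp [Holds, Ex.eval, h3, hag.wmem]⟩
  | sum x m e ihm ihe =>
    intro t V σ ht hs hσ hN
    have hx : (x : ℕ) < 64 := x.2
    simp only [Ex.peak] at hN
    have hp1 : m.peak V + 2 ≤ (m.peak V + 2) * (e.peak (V + m.peak V) + V + 2) :=
      Nat.le_mul_of_pos_right _ (by omega)
    have hp2 : 2 * (e.peak (V + m.peak V) + V + 2) ≤
        (m.peak V + 2) * (e.peak (V + m.peak V) + V + 2) :=
      Nat.mul_le_mul_right _ (by omega)
    have hmle : @LE.le ℕ _ (m.eval σ) (m.peak V) := Ex.eval_le_peak hs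
    -- No partial sum overflows: there are at most `m.peak V` terms, each at most the peak of the
    -- body.
    have hpart : ∀ i : ℕ, @LE.le ℕ _ i (m.eval σ) →
        @LE.le ℕ _ (∑ j ∈ Finset.range i, e.eval (σ.setw x j) + 4) N := by
      intro i hi
      have h1 : ∀ j ∈ Finset.range i, e.eval (σ.setw x j) ≤ e.peak (V + m.peak V) := by
        intro j hj
        have := Finset.mem_range.1 hj
        exact Ex.eval_le_peak ((hs.mono (Nat.le_add_right _ _)).setw (by omega))
      have h2 : @LE.le ℕ _ (∑ j ∈ Finset.range i, e.eval (σ.setw x j))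
          (i * e.peak (V + m.peak V)) := by
        simpa using Finset.sum_le_card_nsmul _ _ _ h1
      have h3 : (m.peak V + 2) * (e.peak (V + m.peak V) + V + 2) ≥
        i * e.peak (V + m.peak V) + 4 := by
        have := Nat.mul_le_mul_right (e.peak (V + m.peak V)) (hi.trans hmle)
        nlinarith
      omega
    refine (ihm (t + 1) V σ (by omega) hs hσ (by omega)).cons
      (T' := m.peak V * (e.cost (V + m.peak V) + 4) + 20) ?_ (by simp only [Ex.cost]; omega)
    rintro τ1 hτ1 ⟨hag1, hm1⟩
    simp only [Holds] at hm1
    refine (runs_wconst hτ1 (by omega) (Q := fun τ => τ = τ1.setw t 0) rfl).cons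
      (T' := m.peak V * (e.cost (V + m.peak V) + 4) + 19) ?_ (by omega)
    rintro τ2 hτ2 rfl
    have hxt : (x : ℕ) ≠ t := by omega
    have hσx : (τ1.setw t 0).wreg x + (τ1.setw t 0).wreg t = σ.wreg x := by
      simp [State.setw_wreg, hxt, hag1.wreg x (by omega)]
    refine (runs_wop hτ2 (by simp only [WordOp.eval]; rw [hσx]; exact hσ.1 _)
      (Q := fun τ => τ = (τ1.setw t 0).setw (t + 2) (σ.wreg x))
      (by simp only [WordOp.eval]; rw [hσx])).cons
      (T' := m.peak V * (e.cost (V + m.peak V) + 4) + 18) ?_ (by omega)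
    rintro τ3 hτ3 rfl
    refine (runs_wconst hτ3 (by omega) (Q := fun τ => τ = ((τ1.setw t 0).setw (t + 2)
      (σ.wreg x)).setw (t + 4) 1) rfl).cons
      (T' := m.peak V * (e.cost (V + m.peak V) + 4) + 17) ?_ (by omega)
    rintro τ4 hτ4 rfl
    -- The loop overwrites `x`, so agreement is claimed with `σ` after `x` has been given its
    -- current value; the last instruction restores the old value from `t + 2`.
    let I : ℕ → State → Prop := fun i τ => Agree t (σ.setw x (τ.wreg x)) τ ∧
      τ.wreg t = ∑ j ∈ Finset.range i, e.eval (σ.setw x j) ∧ τ.wreg (t + 1) = m.eval σ ∧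
      τ.wreg (t + 2) = σ.wreg x ∧ τ.wreg (t + 3) = i + 1 ∧ τ.wreg (t + 4) = 1
    refine (runs_wconst hτ4 (by omega) (Q := I 0) ?_).cons
      (T' := m.peak V * (e.cost (V + m.peak V) + 4) + 16) ?_ (by omega)
    · refine ⟨?_, ?_⟩
      · refine Agree.setw_right (Agree.setw_right (Agree.setw_right (Agree.setw_right ?_
          le_rfl _) (by omega) _) (by omega) _) (by omega) _
        have : (((((τ1.setw t 0).setw (t + 2) (σ.wreg x)).setw (t + 4) 1).setw (t + 3) 1).wreg x)
          = σ.wreg x := by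
          have h1 : (x : ℕ) ≠ t + 2 := by omega
          have h2 : (x : ℕ) ≠ t + 3 := by omega
          have h3 : (x : ℕ) ≠ t + 4 := by omega
          simp [State.setw_wreg, hxt, h1, h2, h3, hag1.wreg x (by omega)]
        rw [this, State.setw, Function.update_eq_self]
        exact hag1.mono (by omega)
      · simp [State.setw_wreg, hm1]
    rintro τ5 hτ5 hI5
    have hloop : Runs N (.loop (.wle (t + 3) (t + 1)) (block
        [.instr (.wop .sub x (t + 3) (t + 4)), e.comp (t + 5),
        .instr (.wop .add t t (t + 5)), .instr (.wop .add (t + 3) (t + 3) (t + 4))])) τ5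
        ((m.eval σ : ℕ) * (e.cost (V + m.peak V) + 3 + 1) + 1) (I (m.eval σ)) := by
      refine runs_loop I ?_ ?_ hτ5 hI5
      · rintro i hi τ hτ ⟨hag, h0, h1, h2, h3, h4⟩
        refine ⟨by simp only [Test.Holds]; omega, ?_⟩
        have hsub : WordOp.sub.eval (τ.wreg (t + 3)) (τ.wreg (t + 4)) = i := by
          simp only [WordOp.eval]; omega
        refine (runs_wop hτ (by rw [hsub]; omega) (Q := fun υ => υ = τ.setw x i)
          (by rw [hsub])).cons (T' := e.cost (V + m.peak V) + 2) ?_ (by omega)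
        rintro υ hυ rfl
        have hagυ : Agree t (σ.setw x i) (τ.setw x i) := by
          have := hag.setw x i
          simpa [State.setw] using this
        have hsυ : Small (V + m.peak V) (σ.setw x i) :=
          (hs.mono (Nat.le_add_right _ _)).setw (by omega)
        refine (ihe (t + 5) (V + m.peak V) _ (by omega) (hsυ.agree hagυ ht) hυ (by omega)).cons
          (T' := 2) ?_ (by omega)
        rintro φ hφ ⟨hagφ, hvφ⟩
        simp only [Holds] at hvφ
        rw [e.eval_congr (hagυ.mono ht)] at hvφ
        have ne : ∀ j, t + j ≠ (x : ℕ) := by intro j; omega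
        have hφ0 : φ.wreg t = ∑ j ∈ Finset.range i, e.eval (σ.setw x j) := by
          rw [hagφ.wreg t (by omega), State.setw_wreg_ne _ _ hxt.symm, h0]
        have hφ1 : φ.wreg (t + 1) = m.eval σ := by
          rw [hagφ.wreg _ (by omega), State.setw_wreg_ne _ _ (ne 1), h1]
        have hφ2 : φ.wreg (t + 2) = σ.wreg x := by
          rw [hagφ.wreg _ (by omega), State.setw_wreg_ne _ _ (ne 2), h2]
        have hφ3 : φ.wreg (t + 3) = i + 1 := by
          rw [hagφ.wreg _ (by omega), State.setw_wreg_ne _ _ (ne 3), h3]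
        have hφ4 : φ.wreg (t + 4) = 1 := by
          rw [hagφ.wreg _ (by omega), State.setw_wreg_ne _ _ (ne 4), h4]
        have hφx : φ.wreg x = i := by
          rw [hagφ.wreg _ (by omega), State.setw_wreg_same]
        have hadd : WordOp.add.eval (φ.wreg t) (φ.wreg (t + 5)) =
            ∑ j ∈ Finset.range (i + 1), e.eval (σ.setw x j) := by
          rw [Finset.sum_range_succ, hφ0, hvφ]; rfl
        refine (runs_wop hφ (by rw [hadd]; have := hpart (i + 1) hi; omega)
          (Q := fun υ => υ = φ.setw t (∑ j ∈ Finset.range (i + 1), e.eval (σ.setw x j)))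
          (by rw [hadd])).cons (T' := 1) ?_ (by omega)
        rintro ψ hψ rfl
        have hinc : WordOp.add.eval ((φ.setw t (∑ j ∈ Finset.range (i + 1),
            e.eval (σ.setw x j))).wreg (t + 3)) ((φ.setw t (∑ j ∈ Finset.range (i + 1),
            e.eval (σ.setw x j))).wreg (t + 4)) = i + 1 + 1 := by
          simp [WordOp.eval, State.setw_wreg, hφ3, hφ4]
        refine (runs_wop hψ (by rw [hinc]; omega) (Q := I (i + 1)) ?_).cons (T' := 0)
          (fun τ hτ h => runs_nil hτ h)
        rw [hinc]
        refine ⟨?_, ?_⟩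
        · refine Agree.setw_right (Agree.setw_right ?_ le_rfl _) (by omega) _
          have hx3 : (x : ℕ) ≠ t + 3 := by omega
          rw [State.setw_wreg_ne _ _ hx3, State.setw_wreg_ne _ _ hxt, hφx]
          exact hagυ.trans (hagφ.mono (by omega))
        · simp [State.setw_wreg, hφ1, hφ2, hφ4]
      · rintro τ hτ ⟨hag, h0, h1, h2, h3, h4⟩
        simp only [Test.Holds]; omega
    refine hloop.cons (T' := 2) ?_ ?_
    · rintro τ6 hτ6 ⟨hag, h0, h1, h2, h3, h4⟩
      refine (runs_wconst hτ6 (by omega) (Q := fun τ => τ = τ6.setw (t + 4) 0) rfl).cons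
        (T' := 1) ?_ (by omega)
      rintro τ7 hτ7 rfl
      have hres : WordOp.add.eval ((τ6.setw (t + 4) 0).wreg (t + 2))
          ((τ6.setw (t + 4) 0).wreg (t + 4)) = σ.wreg x := by
        simp [WordOp.eval, State.setw_wreg, h2]
      refine (runs_wop hτ7 (by rw [hres]; exact hσ.1 _) ?_).cons (T' := 0)
        (fun τ hτ h => runs_nil hτ h)
      rw [hres]
      refine ⟨?_, ?_⟩
      · have := (hag.setw_right (x := t + 4) (by omega) 0).setw x (σ.wreg x)
        simpa [State.setw] using this
      · have := hxt.symm
        simp [Holds, State.setw_wreg, this, h0, Ex.eval]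
    · have := Nat.mul_le_mul_right (e.cost (V + m.peak V) + 4) hmle
      change (m.eval σ : ℕ) * (e.cost (V + m.peak V) + 4) + 1 + 2 ≤
        m.peak V * (e.cost (V + m.peak V) + 4) + 16
      exact (Nat.add_le_add_right this 3).trans (Nat.add_le_add_left (by norm_num) _)
  | ind b ih =>
    intro t V σ ht hs hσ hN
    simp only [Ex.peak] at hN
    -- Truth values are already stored as `0` or `1`, so an indicator needs no further code.
    refine (ih t V σ ht hs hσ (by omega)).mono le_rfl ?_
    rintro τ hτ ⟨hag, h1, h2⟩
    refine ⟨hag, ?_⟩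
    simp only [Holds, Ex.eval]
    split_ifs with h
    · exact h1 h
    · exact h2 h
  | rvar x =>
    intro t V σ ht hs hσ hN
    simp only [Ex.peak] at hN
    have hx : (x : ℕ) ≠ t := by have := x.2; omega
    refine (runs_wconst hσ (by omega) (Q := fun τ => τ = σ.setw t 0) rfl).cons (T' := 2) ?_
      (by simp [Ex.cost])
    rintro τ hτ rfl
    refine (runs_rcast hτ (Q := fun τ => τ = (σ.setw t 0).setr t 0) (by simp)).cons (T' := 1) ?_
    rintro τ hτ rfl
    refine (runs_rop hτ ?_).cons (fun τ hτ h => runs_nil hτ h)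
    refine ⟨(((Agree.refl t σ).setw_right le_rfl _).setr_right le_rfl _).setr_right le_rfl _, ?_⟩
    simp [Holds, RealOp.eval, State.setr_rreg, hx, Ex.eval]
  | cast a ih =>
    intro t V σ ht hs hσ hN
    simp only [Ex.peak] at hN
    refine (ih t V σ ht hs hσ (by omega)).cons (T' := 1) ?_ le_rfl
    rintro τ hτ ⟨hag, h3⟩
    simp only [Holds] at h3
    refine (runs_rcast hτ ?_).cons (fun τ hτ h => runs_nil hτ h)
    exact ⟨hag.setr_right le_rfl _, by simp [Holds, Ex.eval, h3]⟩
  | rop o a b iha ihb =>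
    intro t V σ ht hs hσ hN
    simp only [Ex.peak] at hN
    refine Runs.cons_two ht hs (iha t V σ ht hs hσ (by omega))
      (fun τ hτ hsτ => ihb (t + 1) V τ (by omega) hsτ hτ (by omega)) (T' := 1) ?_ le_rfl
    intro υ hυ hag h3 h4
    simp only [Holds] at h3 h4
    refine (runs_rop hυ ?_).cons (fun τ hτ h => runs_nil hτ h)
    rw [h3, h4]
    exact ⟨hag.setr_right le_rfl _, by simp [Holds, Ex.eval]⟩
  | rread a ih =>
    intro t V σ ht hs hσ hN
    simp only [Ex.peak] at hN
    refine (ih t V σ ht hs hσ (by omega)).cons (T' := 1) ?_ le_rfl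
    rintro τ hτ ⟨hag, h3⟩
    simp only [Holds] at h3
    refine (runs_rload hτ ?_).cons (fun τ hτ h => runs_nil hτ h)
    exact ⟨hag.setr_right le_rfl _, by simp [Holds, Ex.eval, h3, hag.rmem]⟩
  | wle a b iha ihb =>
    intro t V σ ht hs hσ hN
    simp only [Ex.peak] at hN
    refine Runs.cons_two ht hs (iha t V σ ht hs hσ (by omega))
      (fun τ hτ hsτ => ihb (t + 1) V τ (by omega) hsτ hτ (by omega)) (T' := 2) ?_ le_rfl
    intro υ hυ hag h3 h4
    simp only [Holds] at h3 h4
    refine (runs_ite (T := 1) (fun h => runs_wconst hυ (by omega) ?_)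
      (fun h => runs_wconst hυ (by omega) ?_)).cons (T' := 0) (fun τ hτ h => runs_nil hτ h)
    all_goals
      simp only [Test.Holds, h3, h4] at h
      exact ⟨hag.setw_right le_rfl _, by simp [Holds, Ex.eval, h]⟩
  | rle a b iha ihb =>
    intro t V σ ht hs hσ hN
    simp only [Ex.peak] at hN
    refine Runs.cons_two ht hs (iha t V σ ht hs hσ (by omega))
      (fun τ hτ hsτ => ihb (t + 1) V τ (by omega) hsτ hτ (by omega)) (T' := 2) ?_ le_rfl
    intro υ hυ hag h3 h4
    simp only [Holds] at h3 h4
    refine (runs_ite (T := 1) (fun h => runs_wconst hυ (by omega) ?_)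
      (fun h => runs_wconst hυ (by omega) ?_)).cons (T' := 0) (fun τ hτ h => runs_nil hτ h)
    all_goals
      simp only [Test.Holds, h3, h4] at h
      exact ⟨hag.setw_right le_rfl _, by simp [Holds, Ex.eval, h]⟩
  | not a ih =>
    intro t V σ ht hs hσ hN
    simp only [Ex.peak] at hN
    refine (ih t V σ ht hs hσ (by omega)).cons (T' := 2) ?_ le_rfl
    rintro τ hτ ⟨hag, h3⟩
    simp only [Holds] at h3
    refine (runs_wconst hτ (by omega) (Q := fun υ => υ = τ.setw (t + 1) 1) rfl).cons (T' := 1) ?_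
    rintro υ hυ rfl
    refine (runs_wop hυ ?_ ?_).cons (fun τ hτ h => runs_nil hτ h)
    · simp only [WordOp.eval, State.setw_wreg_same]; omega
    · refine ⟨(hag.setw_right (by omega) _).setw_right le_rfl _, ?_⟩
      by_cases h : a.eval σ
      · simp [Holds, Ex.eval, h, h3.1 h, WordOp.eval, State.setw_wreg]
      · simp [Holds, Ex.eval, h, h3.2 h, WordOp.eval, State.setw_wreg]
  | and a b iha ihb =>
    intro t V σ ht hs hσ hN
    simp only [Ex.peak] at hN
    refine Runs.cons_two ht hs (iha t V σ ht hs hσ (by omega))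
      (fun τ hτ hsτ => ihb (t + 1) V τ (by omega) hsτ hτ (by omega)) (T' := 1) ?_ le_rfl
    intro υ hυ hag h3 h4
    simp only [Holds] at h3 h4
    refine (runs_wop hυ ?_ ?_).cons (fun τ hτ h => runs_nil hτ h)
    all_goals
      by_cases ha : a.eval σ <;> by_cases hb : b.eval σ
    all_goals first
      | (simp [WordOp.eval, ha, hb, h3, h4]; omega)
      | exact ⟨hag.setw_right le_rfl _, by simp [Holds, Ex.eval, ha, hb, h3, h4, WordOp.eval]⟩

end RAM

namespace RAM

/-! ### Polynomial bounds -/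

/-- `f` is bounded by a power of its argument. -/
def PolyBdd (f : ℕ → ℕ) : Prop := ∃ d, ∀ V, 2 ≤ V → f V ≤ V ^ d

theorem PolyBdd.const (v : ℕ) : PolyBdd fun _ => v :=
  ⟨v, fun _ hV => Nat.lt_two_pow_self.le.trans (Nat.pow_le_pow_left hV v)⟩

theorem PolyBdd.id : PolyBdd fun V => V := ⟨1, fun _ _ => (pow_one _).ge⟩

theorem PolyBdd.mul {f g : ℕ → ℕ} (hf : PolyBdd f) (hg : PolyBdd g) :
    PolyBdd fun V => f V * g V := by
  obtain ⟨a, ha⟩ := hf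
  obtain ⟨b, hb⟩ := hg
  exact ⟨a + b, fun V hV => by rw [pow_add]; exact Nat.mul_le_mul (ha V hV) (hb V hV)⟩

/-- Both summands are at most `V ^ (a + b)`, and one more factor `V ≥ 2` absorbs the sum. -/
theorem PolyBdd.add {f g : ℕ → ℕ} (hf : PolyBdd f) (hg : PolyBdd g) :
    PolyBdd fun V => f V + g V := by
  obtain ⟨a, ha⟩ := hf
  obtain ⟨b, hb⟩ := hg
  refine ⟨a + b + 1, fun V hV => ?_⟩
  have h1 : V ^ a ≤ V ^ (a + b) := Nat.pow_le_pow_right (by omega) (by omega)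
  have h2 : V ^ b ≤ V ^ (a + b) := Nat.pow_le_pow_right (by omega) (by omega)
  have h3 : V ^ (a + b) * 2 ≤ V ^ (a + b) * V := Nat.mul_le_mul_left _ hV
  have := ha V hV
  have := hb V hV
  change f V + g V ≤ _
  rw [pow_succ]
  omega

/-- The hypothesis `V ≤ g V` keeps the argument of `f` at least `2`, where the bound for `f` is
valid. -/
theorem PolyBdd.comp {f g : ℕ → ℕ} (hf : PolyBdd f) (hg : PolyBdd g) (h2 : ∀ V, V ≤ g V) :
    PolyBdd fun V => f (g V) := by
  obtain ⟨a, ha⟩ := hf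
  obtain ⟨b, hb⟩ := hg
  refine ⟨b * a, fun V hV => (ha _ (hV.trans (h2 V))).trans ?_⟩
  rw [pow_mul]
  exact Nat.pow_le_pow_left (hb V hV) a

theorem Ex.polyBdd_peak {s : Sort3} (e : Ex s) : PolyBdd e.peak := by
  induction e with
  | const v => exact .const v
  | var x => exact .id
  | op o a b iha ihb => exact (iha.add (.const 1)).mul (ihb.add (.const 1))
  | read a ih => exact ih.add .id
  | sum x m e ihm ihe =>
    exact (ihm.add (.const 2)).mul
      (((ihe.comp (PolyBdd.id.add ihm) fun V => Nat.le_add_right _ _).add .id).add (.const 2))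
  | ind b ih => exact ih.add (.const 1)
  | rvar x => exact .const 0
  | cast a ih => exact ih
  | rop o a b iha ihb => exact iha.add ihb
  | rread a ih => exact ih
  | wle a b iha ihb => exact (iha.add ihb).add (.const 1)
  | rle a b iha ihb => exact (iha.add ihb).add (.const 1)
  | not a ih => exact ih.add (.const 1)
  | and a b iha ihb => exact (iha.add ihb).add (.const 1)

theorem Ex.polyBdd_cost {s : Sort3} (e : Ex s) : PolyBdd e.cost := by
  induction e with
  | const v => exact .const 1
  | var x => exact .const 2
  | op o a b iha ihb => exact (iha.add ihb).add (.const 1)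
  | read a ih => exact ih.add (.const 1)
  | sum x m e ihm ihe =>
    exact (ihm.add (m.polyBdd_peak.mul ((ihe.comp (PolyBdd.id.add m.polyBdd_peak)
      fun V => Nat.le_add_right _ _).add (.const 4)))).add (.const 20)
  | ind b ih => exact ih
  | rvar x => exact .const 3
  | cast a ih => exact ih.add (.const 1)
  | rop o a b iha ihb => exact (iha.add ihb).add (.const 1)
  | rread a ih => exact ih.add (.const 1)
  | wle a b iha ihb => exact (iha.add ihb).add (.const 2)
  | rle a b iha ihb => exact (iha.add ihb).add (.const 2)
  | not a ih => exact ih.add (.const 2)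
  | and a b iha ihb => exact (iha.add ihb).add (.const 1)

/-! ### Notation for expressions -/

instance : Add (Ex .word) := ⟨.op .add⟩
instance : Sub (Ex .word) := ⟨.op .sub⟩
instance : Mul (Ex .word) := ⟨.op .mul⟩
instance : Div (Ex .word) := ⟨.op .div⟩
instance : Mod (Ex .word) := ⟨.op .mod⟩
instance (n : ℕ) : OfNat (Ex .word) n := ⟨.const n⟩
instance : Add (Ex .real) := ⟨.rop .add⟩
instance : Sub (Ex .real) := ⟨.rop .sub⟩
instance : Mul (Ex .real) := ⟨.rop .mul⟩
instance : Div (Ex .real) := ⟨.rop .div⟩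
instance (n : ℕ) : OfNat (Ex .real) n := ⟨.cast (.const n)⟩

/-- Powers of expressions with a fixed exponent. -/
def Ex.pow (a : Ex .word) : ℕ → Ex .word
  | 0 => 1
  | k + 1 => a.pow k * a

section eval

variable (σ : State)

@[simp] theorem Ex.eval_const (v : ℕ) : (Ex.const v).eval σ = v := rfl
@[simp] theorem Ex.eval_ofNat (v : ℕ) :
    (no_index (OfNat.ofNat v : Ex .word)).eval σ = (OfNat.ofNat v : ℕ) := rfl
@[simp] theorem Ex.eval_ofNat_real (v : ℕ) [v.AtLeastTwo] :
    (no_index (OfNat.ofNat v : Ex .real)).eval σ = (OfNat.ofNat v : ℝ) := rfl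
@[simp] theorem Ex.eval_zero_real : (0 : Ex .real).eval σ = (0 : ℝ) := Nat.cast_zero
@[simp] theorem Ex.eval_one_real : (1 : Ex .real).eval σ = (1 : ℝ) := Nat.cast_one
@[simp] theorem Ex.eval_var (x : Fin 64) : (Ex.var x).eval σ = σ.wreg x := rfl
@[simp] theorem Ex.eval_add (a b : Ex .word) :
    (a + b).eval σ = (a.eval σ + b.eval σ : ℕ) := rfl
@[simp] theorem Ex.eval_sub (a b : Ex .word) :
    (a - b).eval σ = (a.eval σ - b.eval σ : ℕ) := rfl
@[simp] theorem Ex.eval_mul (a b : Ex .word) :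
    (a * b).eval σ = (a.eval σ * b.eval σ : ℕ) := rfl
@[simp] theorem Ex.eval_div (a b : Ex .word) :
    (a / b).eval σ = (a.eval σ / b.eval σ : ℕ) := rfl
@[simp] theorem Ex.eval_mod (a b : Ex .word) :
    (a % b).eval σ = (a.eval σ % b.eval σ : ℕ) := rfl
@[simp] theorem Ex.eval_add_real (a b : Ex .real) :
    (a + b).eval σ = (a.eval σ + b.eval σ : ℝ) := rfl
@[simp] theorem Ex.eval_mul_real (a b : Ex .real) :
    (a * b).eval σ = (a.eval σ * b.eval σ : ℝ) := rfl
@[simp] theorem Ex.eval_div_real (a b : Ex .real) :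
    (a / b).eval σ = (a.eval σ / b.eval σ : ℝ) := rfl
@[simp] theorem Ex.eval_pow (a : Ex .word) (k : ℕ) :
    (a.pow k).eval σ = (a.eval σ ^ k : ℕ) := by
  induction k with
  | zero => exact (pow_zero _).symm
  | succ k ih => rw [Ex.pow, Ex.eval_mul, ih]; rfl
@[simp] theorem Ex.eval_read (a : Ex .word) : (Ex.read a).eval σ = σ.wmem (a.eval σ) := rfl
@[simp] theorem Ex.eval_sum (x : Fin 64) (m e : Ex .word) :
    (Ex.sum x m e).eval σ = ∑ i ∈ Finset.range (m.eval σ), e.eval (σ.setw x i) := rfl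
open Classical in
@[simp] theorem Ex.eval_ind (b : Ex .prop) :
    (Ex.ind b).eval σ = if b.eval σ then 1 else 0 := rfl
@[simp] theorem Ex.eval_rvar (x : Fin 64) : (Ex.rvar x).eval σ = σ.rreg x := rfl
@[simp] theorem Ex.eval_cast (a : Ex .word) : (Ex.cast a).eval σ = ((a.eval σ : ℕ) : ℝ) := rfl
@[simp] theorem Ex.eval_rread (a : Ex .word) : (Ex.rread a).eval σ = σ.rmem (a.eval σ) := rfl
@[simp] theorem Ex.eval_wle (a b : Ex .word) :
    (Ex.wle a b).eval σ = @LE.le ℕ _ (a.eval σ) (b.eval σ) := rfl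
@[simp] theorem Ex.eval_rle (a b : Ex .real) :
    (Ex.rle a b).eval σ = @LE.le ℝ _ (a.eval σ) (b.eval σ) := rfl
@[simp] theorem Ex.eval_not (a : Ex .prop) : a.not.eval σ = ¬ a.eval σ := rfl
@[simp] theorem Ex.eval_and (a b : Ex .prop) : (a.and b).eval σ = (a.eval σ ∧ b.eval σ) := rfl

end eval

/-! ### Commands -/

/-- The capacity of the tables, as an expression; register `0` holds the number of points. -/
def Ex.cap : Ex .word := (Ex.var 0 + 1).pow 12

/-- The capacity of the tables. -/
def State.cap (σ : State) : ℕ := (σ.wreg 0 + 1) ^ 12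

@[simp] theorem Ex.eval_cap (σ : State) : Ex.cap.eval σ = σ.cap := by
  simp [Ex.cap, State.cap]

/-- Commands: stores of words modulo the capacity, stores of reals, assignments, sequences and
loops over `x < m`. -/
inductive Cmd
  | store (a e : Ex .word)
  | rstore (a : Ex .word) (e : Ex .real)
  | rassign (x : Fin 64) (e : Ex .real)
  | seq (c d : Cmd)
  | iter (x : Fin 64) (m : Ex .word) (c : Cmd)

/-- The effect of a command. -/
noncomputable def Cmd.eval : Cmd → State → State
  | .store a e, σ => { σ with wmem := Function.update σ.wmem (a.eval σ) ((e % Ex.cap).eval σ) }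
  | .rstore a e, σ => { σ with rmem := Function.update σ.rmem (a.eval σ) (e.eval σ) }
  | .rassign x e, σ => σ.setr x (e.eval σ)
  | .seq c d, σ => d.eval (c.eval σ)
  | .iter x m c, σ => Nat.rec (motive := fun _ => State) σ
      (fun i τ => (c.eval (τ.setw x i)).setw x (σ.wreg x)) (m.eval σ)

/-- The state in a loop after `i` rounds. -/
noncomputable def Cmd.round (x : Fin 64) (c : Cmd) (σ : State) (i : ℕ) : State :=
  Nat.rec (motive := fun _ => State) σ (fun i τ => (c.eval (τ.setw x i)).setw x (σ.wreg x)) i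

/-- No loop uses register `0`. -/
def Cmd.Ok : Cmd → Prop
  | .store _ _ => True
  | .rstore _ _ => True
  | .rassign _ _ => True
  | .seq c d => c.Ok ∧ d.Ok
  | .iter x _ c => x ≠ 0 ∧ c.Ok

def Cmd.peak : Cmd → ℕ → ℕ
  | .store a e, V => a.peak V + (e % Ex.cap).peak V
  | .rstore a e, V => a.peak V + e.peak V
  | .rassign _ e, V => e.peak V
  | .seq c d, V => c.peak V + d.peak V
  | .iter _ m c, V => V + m.peak V + c.peak (V + m.peak V) + 2

def Cmd.cost : Cmd → ℕ → ℕ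
  | .store a e, V => a.cost V + (e % Ex.cap).cost V + 1
  | .rstore a e, V => a.cost V + e.cost V + 1
  | .rassign _ e, V => e.cost V + 3
  | .seq c d, V => c.cost V + d.cost V
  | .iter _ m c, V => m.cost V + m.peak V * (c.cost (V + m.peak V) + 3) + 20

theorem Cmd.polyBdd_peak (c : Cmd) : PolyBdd c.peak := by
  induction c with
  | store a e => exact a.polyBdd_peak.add (e % Ex.cap).polyBdd_peak
  | rstore a e => exact a.polyBdd_peak.add e.polyBdd_peak
  | rassign x e => exact e.polyBdd_peak
  | seq c d ihc ihd => exact ihc.add ihd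
  | iter x m c ih =>
    exact ((PolyBdd.id.add m.polyBdd_peak).add (ih.comp (PolyBdd.id.add m.polyBdd_peak)
      fun V => Nat.le_add_right _ _)).add (.const 2)

theorem Cmd.polyBdd_cost (c : Cmd) : PolyBdd c.cost := by
  induction c with
  | store a e => exact (a.polyBdd_cost.add (e % Ex.cap).polyBdd_cost).add (.const 1)
  | rstore a e => exact (a.polyBdd_cost.add e.polyBdd_cost).add (.const 1)
  | rassign x e => exact e.polyBdd_cost.add (.const 3)
  | seq c d ihc ihd => exact ihc.add ihd
  | iter x m c ih =>
    exact (m.polyBdd_cost.add (m.polyBdd_peak.mul ((ih.comp (PolyBdd.id.add m.polyBdd_peak)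
      fun V => Nat.le_add_right _ _).add (.const 3)))).add (.const 20)

def Cmd.comp : Cmd → ℕ → Program
  | .store a e, t => block [a.comp t, (e % Ex.cap).comp (t + 1), .instr (.wstore t (t + 1))]
  | .rstore a e, t => block [a.comp t, e.comp (t + 1), .instr (.rstore t (t + 1))]
  | .rassign x e, t => block [e.comp t, .instr (.wconst (t + 1) 0), .instr (.rcast (t + 1) (t + 1)),
      .instr (.rop .add x t (t + 1))]
  | .seq c d, t => .seq (c.comp t) (d.comp t)
  | .iter x m c, t => block [m.comp t, .instr (.wconst (t + 3) 0),
      .instr (.wop .add (t + 1) x (t + 3)), .instr (.wconst (t + 3) 1),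
      .instr (.wconst (t + 2) 1),
      .loop (.wle (t + 2) t) (block [.instr (.wop .sub x (t + 2) (t + 3)), c.comp (t + 4),
        .instr (.wop .add (t + 2) (t + 2) (t + 3))]),
      .instr (.wconst (t + 3) 0), .instr (.wop .add x (t + 1) (t + 3))]

theorem State.setw_setw (σ : State) (x i j : ℕ) : (σ.setw x i).setw x j = σ.setw x j := by
  simp [State.setw]

theorem State.setw_self (σ : State) (x : ℕ) : σ.setw x (σ.wreg x) = σ := by
  simp [State.setw]

-- Stores do not touch registers, assignments concern real registers only, and every loop puts its
-- variable back. Hence the number of points, and with it the capacity, is preserved by commands.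
@[simp] theorem Cmd.eval_wreg (c : Cmd) (σ : State) : (c.eval σ).wreg = σ.wreg := by
  induction c generalizing σ with
  | store a e => rfl
  | rstore a e => rfl
  | rassign x e => rfl
  | seq c d ihc ihd => rw [Cmd.eval, ihd, ihc]
  | iter x m c ih =>
    suffices H : ∀ i, (Cmd.round x c σ i).wreg = σ.wreg from H _
    intro i
    induction i with
    | zero => rfl
    | succ i ihi =>
      change Function.update (c.eval ((Cmd.round x c σ i).setw x i)).wreg x (σ.wreg x) = σ.wreg
      rw [ih]
      simp [State.setw, ihi]

theorem Cmd.round_wreg (x : Fin 64) (c : Cmd) (σ : State) (i : ℕ) :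
    (c.round x σ i).wreg = σ.wreg := by
  exact (Cmd.iter x (.const i) c).eval_wreg σ

theorem Cmd.round_succ (x : Fin 64) (c : Cmd) (σ : State) (i : ℕ) :
    c.round x σ (i + 1) = (c.eval ((c.round x σ i).setw x i)).setw x (σ.wreg x) := rfl

theorem Agree.setw_eval {t : ℕ} {σ τ : State} (ht : 64 ≤ t) (h : Agree t σ τ) (c : Cmd) :
    Agree t (c.eval σ) (c.eval τ) := by
  have h' := h.mono ht
  induction c generalizing σ τ with
  | store a e =>
    refine ⟨h.wreg, h.rreg, ?_, h.rmem⟩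
    simp only [Cmd.eval, a.eval_congr h', (e % Ex.cap).eval_congr h', h.wmem]
  | rstore a e =>
    refine ⟨h.wreg, h.rreg, h.wmem, ?_⟩
    simp only [Cmd.eval, a.eval_congr h', e.eval_congr h', h.rmem]
  | rassign x e =>
    simp only [Cmd.eval, e.eval_congr h']
    exact h.setr _ _
  | seq c d ihc ihd => exact ihd (ihc h h') ((ihc h h').mono ht)
  | iter x m c ih =>
    have hx : τ.wreg x = σ.wreg x := h.wreg x (x.2.trans_le ht)
    suffices H : ∀ i, Agree t (c.round x σ i) (c.round x τ i) by
      have := H (m.eval σ)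
      simp only [Cmd.eval, m.eval_congr h']
      exact this
    intro i
    induction i with
    | zero => exact h
    | succ i ihi =>
      rw [Cmd.round_succ, Cmd.round_succ, hx]
      exact (ih (ihi.setw x i) ((ihi.setw x i).mono ht)).setw _ _

theorem State.cap_pos (σ : State) : 0 < σ.cap := by unfold State.cap; positivity

/-- Stored words are reduced modulo the capacity, and the capacity is constant because no loop runs
over register `0`. So the bound survives any number of stores. -/
theorem Cmd.wmem_le {V : ℕ} (c : Cmd) (hc : c.Ok) {σ : State} (hσ : ∀ a, σ.wmem a ≤ V)
    (hV : σ.cap ≤ V) (a : ℕ) : (c.eval σ).wmem a ≤ V := by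
  induction c generalizing σ a with
  | store b e =>
    simp only [Cmd.eval, Function.update_apply]
    split_ifs
    · simp only [Ex.eval_mod, Ex.eval_cap]
      exact (Nat.mod_lt _ σ.cap_pos).le.trans hV
    · exact hσ a
  | rstore b e => exact hσ a
  | rassign x e => exact hσ a
  | seq c d ihc ihd =>
    refine ihd hc.2 (fun b => ihc hc.1 hσ hV b) ?_ a
    simpa [State.cap] using hV
  | iter x m c ih =>
    suffices H : ∀ i a, (c.round x σ i).wmem a ≤ V from H _ a
    intro i
    induction i with
    | zero => exact hσ
    | succ i ihi =>
      intro a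
      rw [Cmd.round_succ]
      refine ih hc.2 (σ := (c.round x σ i).setw x i) ihi ?_ a
      have h0 : (0 : ℕ) ≠ (x : ℕ) := fun h => hc.1 (Fin.ext h.symm)
      simpa [State.cap, State.setw_wreg, h0, Cmd.round_wreg] using hV

theorem Small.eval {V : ℕ} {c : Cmd} (hc : c.Ok) {σ : State} (h : Small V σ) (hV : σ.cap ≤ V) :
    Small V (c.eval σ) :=
  ⟨fun r hr => by rw [c.eval_wreg]; exact h.wreg r hr, fun a => c.wmem_le hc h.wmem hV a⟩

/-- The compiled command has the effect of the command. -/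
theorem Cmd.runs_comp {N : ℕ} (c : Cmd) :
    ∀ (t V : ℕ) (σ : State), c.Ok → 64 ≤ t → Small V σ → σ.cap ≤ V → σ.Bounded N →
      c.peak V + 2 ≤ N → Runs N (c.comp t) σ (c.cost V) (fun τ => Agree t (c.eval σ) τ) := by
  induction c with
  | store a e =>
    intro t V σ hc ht hs hV hσ hN
    simp only [Cmd.peak] at hN
    refine Runs.cons_two ht hs (a.runs_comp t V σ ht hs hσ (by omega))
      (fun τ hτ hsτ => (e % Ex.cap).runs_comp (t + 1) V τ (by omega) hsτ hτ (by omega)) (T' := 1)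
      ?_ le_rfl
    intro υ hυ hag h3 h4
    simp only [Holds] at h3 h4
    refine (runs_instr ?_ ?_).cons (fun τ hτ h => runs_nil hτ h)
    · refine ⟨hυ.1, fun b => ?_⟩
      simp only [Instr.exec, Function.update_apply]
      split_ifs
      · exact hυ.1 _
      · exact hυ.2 b
    · refine ⟨hag.wreg, hag.rreg, ?_, hag.rmem⟩
      simp only [Instr.exec, Cmd.eval, h3, h4, hag.wmem]
  | rstore a e =>
    intro t V σ hc ht hs hV hσ hN
    simp only [Cmd.peak] at hN
    refine Runs.cons_two ht hs (a.runs_comp t V σ ht hs hσ (by omega))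
      (fun τ hτ hsτ => e.runs_comp (t + 1) V τ (by omega) hsτ hτ (by omega)) (T' := 1)
      ?_ le_rfl
    intro υ hυ hag h3 h4
    simp only [Holds] at h3 h4
    refine (runs_instr hυ ?_).cons (fun τ hτ h => runs_nil hτ h)
    refine ⟨hag.wreg, hag.rreg, hag.wmem, ?_⟩
    simp only [Instr.exec, Cmd.eval, h3, h4, hag.rmem]
  | rassign x e =>
    intro t V σ hc ht hs hV hσ hN
    simp only [Cmd.peak] at hN
    have hx := x.2
    refine (e.runs_comp t V σ ht hs hσ hN).cons (T' := 3) ?_ le_rfl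
    rintro τ1 hτ1 ⟨hag, h3⟩
    simp only [Holds] at h3
    refine (runs_wconst hτ1 (by omega) (Q := fun τ => τ = τ1.setw (t + 1) 0) rfl).cons
      (T' := 2) ?_
    rintro τ hτ rfl
    refine (runs_rcast hτ (Q := fun τ => τ = (τ1.setw (t + 1) 0).setr (t + 1) 0)
      (by simp)).cons (T' := 1) ?_
    rintro τ hτ rfl
    refine (runs_rop hτ ?_).cons (fun τ hτ h => runs_nil hτ h)
    have : RealOp.add.eval (((τ1.setw (t + 1) 0).setr (t + 1) 0).rreg t)
        (((τ1.setw (t + 1) 0).setr (t + 1) 0).rreg (t + 1)) = e.eval σ := by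
      simp [RealOp.eval, State.setr_rreg, h3]
    rw [this]
    exact ((hag.setw_right (by omega) _).setr_right (by omega) _).setr _ _
  | seq c d ihc ihd =>
    intro t V σ hc ht hs hV hσ hN
    simp only [Cmd.peak] at hN
    refine (ihc t V σ hc.1 ht hs hV hσ (by omega)).seq fun τ hτ hag => ?_
    have hs' : Small V τ := (hs.eval hc.1 hV).agree hag ht
    have hV' : τ.cap ≤ V := by
      rw [State.cap, hag.wreg 0 (by omega), c.eval_wreg]; exact hV
    exact (ihd t V τ hc.2 ht hs' hV' hτ (by omega)).mono le_rfl
      fun υ _ h => (hag.setw_eval ht d).trans h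
  | iter x m c ih =>
    intro t V σ hc ht hs hV hσ hN
    have hx : (x : ℕ) < 64 := x.2
    have h0x : (0 : ℕ) ≠ (x : ℕ) := fun h => hc.1 (Fin.ext h.symm)
    simp only [Cmd.peak] at hN
    have hmle : @LE.le ℕ _ (m.eval σ) (m.peak V) := Ex.eval_le_peak hs
    refine (m.runs_comp t V σ ht hs hσ (by omega)).cons
      (T' := m.peak V * (c.cost (V + m.peak V) + 3) + 20) ?_ (by simp only [Cmd.cost]; omega)
    rintro τ1 hτ1 ⟨hag1, hm1⟩
    simp only [Holds] at hm1
    refine (runs_wconst hτ1 (by omega) (Q := fun τ => τ = τ1.setw (t + 3) 0) rfl).cons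
      (T' := m.peak V * (c.cost (V + m.peak V) + 3) + 19) ?_ (by omega)
    rintro τ2 hτ2 rfl
    have hx3 : (x : ℕ) ≠ t + 3 := by omega
    have hx2 : (x : ℕ) ≠ t + 2 := by omega
    have hx1 : (x : ℕ) ≠ t + 1 := by omega
    have hσx : (τ1.setw (t + 3) 0).wreg x + (τ1.setw (t + 3) 0).wreg (t + 3) = σ.wreg x := by
      simp [State.setw_wreg, hx3, hag1.wreg x (by omega)]
    refine (runs_wop hτ2 (by simp only [WordOp.eval]; rw [hσx]; exact hσ.1 _)
      (Q := fun τ => τ = (τ1.setw (t + 3) 0).setw (t + 1) (σ.wreg x))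
      (by simp only [WordOp.eval]; rw [hσx])).cons
      (T' := m.peak V * (c.cost (V + m.peak V) + 3) + 18) ?_ (by omega)
    rintro τ3 hτ3 rfl
    refine (runs_wconst hτ3 (by omega) (Q := fun τ => τ = ((τ1.setw (t + 3) 0).setw (t + 1)
      (σ.wreg x)).setw (t + 3) 1) rfl).cons
      (T' := m.peak V * (c.cost (V + m.peak V) + 3) + 17) ?_ (by omega)
    rintro τ4 hτ4 rfl
    let I : ℕ → State → Prop := fun i τ => Agree t ((c.round x σ i).setw x (τ.wreg x)) τ ∧
      τ.wreg t = m.eval σ ∧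
      τ.wreg (t + 1) = σ.wreg x ∧ τ.wreg (t + 2) = i + 1 ∧ τ.wreg (t + 3) = 1
    -- The state after `i` rounds is the value of the loop with the constant bound `i`.
    have hround : ∀ i, Small V (c.round x σ i) := by
      intro i
      exact hs.eval (c := .iter x (.const i) c) hc hV
    refine (runs_wconst hτ4 (by omega) (Q := I 0) ?_).cons
      (T' := m.peak V * (c.cost (V + m.peak V) + 3) + 16) ?_ (by omega)
    · refine ⟨?_, ?_⟩
      · refine Agree.setw_right (Agree.setw_right (Agree.setw_right (Agree.setw_right ?_
          (by omega) _) (by omega) _) (by omega) _) (by omega) _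
        have : (((((τ1.setw (t + 3) 0).setw (t + 1) (σ.wreg x)).setw (t + 3) 1).setw
            (t + 2) 1).wreg x) = σ.wreg x := by
          simp [State.setw_wreg, hx1, hx2, hx3, hag1.wreg x (by omega)]
        rw [this]
        change Agree t (σ.setw x (σ.wreg x)) τ1
        rw [State.setw_self]
        exact hag1
      · simp [State.setw_wreg, hm1]
    rintro τ5 hτ5 hI5
    have hloop : Runs N (.loop (.wle (t + 2) t) (block
        [.instr (.wop .sub x (t + 2) (t + 3)), c.comp (t + 4),
        .instr (.wop .add (t + 2) (t + 2) (t + 3))])) τ5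
        ((m.eval σ : ℕ) * (c.cost (V + m.peak V) + 2 + 1) + 1) (I (m.eval σ)) := by
      refine runs_loop I ?_ ?_ hτ5 hI5
      · rintro i hi τ hτ ⟨hag, h0, h1, h2, h3⟩
        refine ⟨by simp only [Test.Holds]; omega, ?_⟩
        have hsub : WordOp.sub.eval (τ.wreg (t + 2)) (τ.wreg (t + 3)) = i := by
          simp only [WordOp.eval]; omega
        refine (runs_wop hτ (by rw [hsub]; omega) (Q := fun υ => υ = τ.setw x i)
          (by rw [hsub])).cons (T' := c.cost (V + m.peak V) + 1) ?_ (by omega)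
        rintro υ hυ rfl
        have hagυ : Agree t ((c.round x σ i).setw x i) (τ.setw x i) := by
          have := hag.setw x i
          rwa [State.setw_setw] at this
        have hsυ : Small (V + m.peak V) ((c.round x σ i).setw x i) :=
          ((hround i).mono (Nat.le_add_right _ _)).setw (by omega)
        have hcapυ : (τ.setw x i).cap ≤ V + m.peak V := by
          rw [State.cap, hagυ.wreg 0 (by omega), State.setw_wreg_ne _ _ h0x, Cmd.round_wreg]
          exact hV.trans (Nat.le_add_right _ _)
        refine (ih (t + 4) (V + m.peak V) _ hc.2 (by omega) (hsυ.agree hagυ ht) hcapυ hυ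
          (by omega)).cons (T' := 1) ?_ (by omega)
        intro φ hφ hagφ
        have hreg : ∀ j < t + 4, φ.wreg j = (τ.setw x i).wreg j := fun j hj => by
          rw [hagφ.wreg j hj, Cmd.eval_wreg]
        have ne : ∀ j, t + j ≠ (x : ℕ) := by intro j; omega
        have hφ0 : φ.wreg t = m.eval σ := by
          rw [hreg _ (by omega), State.setw_wreg_ne _ _ (by omega : t ≠ (x : ℕ)), h0]
        have hφ1 : φ.wreg (t + 1) = σ.wreg x := by
          rw [hreg _ (by omega), State.setw_wreg_ne _ _ (ne 1), h1]
        have hφ2 : φ.wreg (t + 2) = i + 1 := by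
          rw [hreg _ (by omega), State.setw_wreg_ne _ _ (ne 2), h2]
        have hφ3 : φ.wreg (t + 3) = 1 := by
          rw [hreg _ (by omega), State.setw_wreg_ne _ _ (ne 3), h3]
        have hφx : φ.wreg x = i := by rw [hreg _ (by omega), State.setw_wreg_same]
        have hinc : WordOp.add.eval (φ.wreg (t + 2)) (φ.wreg (t + 3)) = i + 1 + 1 := by
          simp [WordOp.eval, hφ2, hφ3]
        refine (runs_wop hφ (by rw [hinc]; omega) (Q := I (i + 1)) ?_).cons (T' := 0)
          (fun τ hτ h => runs_nil hτ h)
        rw [hinc]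
        refine ⟨?_, ?_⟩
        · refine Agree.setw_right ?_ (by omega) _
          rw [State.setw_wreg_ne _ _ hx2, hφx, Cmd.round_succ, State.setw_setw]
          have h5 : Agree t (c.eval ((c.round x σ i).setw x i)) φ :=
            (hagυ.setw_eval ht c).trans (hagφ.mono (by omega))
          have h6 : (c.eval ((c.round x σ i).setw x i)).wreg x = i := by
            rw [Cmd.eval_wreg, State.setw_wreg_same]
          have h7 := State.setw_self (c.eval ((c.round x σ i).setw x i)) x
          rw [h6] at h7
          rwa [h7]
        · simp [State.setw_wreg, hφ1, hφ0, hφ3]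
      · rintro τ hτ ⟨hag, h0, h1, h2, h3⟩
        simp only [Test.Holds]; omega
    refine hloop.cons (T' := 2) ?_ ?_
    · rintro τ6 hτ6 ⟨hag, h0, h1, h2, h3⟩
      refine (runs_wconst hτ6 (by omega) (Q := fun τ => τ = τ6.setw (t + 3) 0) rfl).cons
        (T' := 1) ?_ (by omega)
      rintro τ7 hτ7 rfl
      have hres : WordOp.add.eval ((τ6.setw (t + 3) 0).wreg (t + 1))
          ((τ6.setw (t + 3) 0).wreg (t + 3)) = σ.wreg x := by
        simp [WordOp.eval, State.setw_wreg, h1]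
      refine (runs_wop hτ7 (by rw [hres]; exact hσ.1 _) ?_).cons (T' := 0)
        (fun τ hτ h => runs_nil hτ h)
      rw [hres]
      have h5 := (hag.setw_right (x := t + 3) (by omega) 0).setw x (σ.wreg x)
      rw [State.setw_setw] at h5
      have h6 := State.setw_self (c.round x σ (m.eval σ)) x
      rw [Cmd.round_wreg] at h6
      rw [h6] at h5
      exact h5
    · have := Nat.mul_le_mul_right (c.cost (V + m.peak V) + 3) hmle
      exact (Nat.add_le_add_right this 3).trans (Nat.add_le_add_left (by norm_num) _)

theorem State.cap_setw (σ : State) {x : ℕ} (hx : x ≠ 0) (i : ℕ) : (σ.setw x i).cap = σ.cap := by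
  simp [State.cap, State.setw_wreg, hx.symm]

theorem State.cap_congr {σ τ : State} (h : τ.wreg = σ.wreg) : τ.cap = σ.cap := by
  rw [State.cap, h, State.cap]

attribute [irreducible] State.cap

end RAM

namespace RAM

/-! ### Derived expressions -/

/-- The least `i < m` with `P i`, and `m` if there is none. -/
noncomputable def least (m : ℕ) (P : ℕ → Prop) : ℕ :=
  -- The `i` without a witness up to and including `i` are those below the least witness, so
  -- counting them yields that witness, or `m`.
  open Classical in ∑ i ∈ Finset.range m, if ∀ j < i + 1, ¬ P j then 1 else 0

theorem least_le (m : ℕ) (P : ℕ → Prop) : least m P ≤ m := by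
  classical
  calc least m P ≤ ∑ _i ∈ Finset.range m, 1 :=
        Finset.sum_le_sum fun i _ => by split_ifs <;> omega
    _ = m := by simp

/-- The case `a = m` stands for the absence of a witness; therefore `P a` is required only when `a <
m`. -/
theorem least_eq {m a : ℕ} {P : ℕ → Prop} (ha : a ≤ m) (h : ∀ j < a, ¬ P j)
    (hP : a < m → P a) : least m P = a := by
  classical
  have h1 : ∀ i ∈ Finset.range m, (if ∀ j < i + 1, ¬ P j then 1 else 0) =
      if i < a then 1 else 0 := by
    intro i hi
    have hi := Finset.mem_range.1 hi
    by_cases hia : i < a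
    · rw [if_pos hia, if_pos fun j hj => h j (by omega)]
    · rw [if_neg hia, if_neg]
      intro hall
      exact hall a (by omega) (hP (by omega))
  rw [least, Finset.sum_congr rfl h1, ← Finset.sum_filter, Finset.sum_const, smul_eq_mul, mul_one]
  have : (Finset.range m).filter (fun i => i < a) = Finset.range a := by
    ext i; simp only [Finset.mem_filter, Finset.mem_range]; omega
  rw [this, Finset.card_range]

theorem least_spec {m : ℕ} {P : ℕ → Prop} (h : ∃ i < m, P i) :
    least m P < m ∧ P (least m P) ∧ ∀ j < least m P, ¬ P j := by
  classical
  have h' : ∃ i, i < m ∧ P i := h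
  have hs := Nat.find_spec h'
  have hm := fun j (hj : j < Nat.find h') => Nat.find_min h' hj
  have heq : least m P = Nat.find h' :=
    least_eq hs.1.le (fun j hj hPj => hm j hj ⟨hj.trans hs.1, hPj⟩) fun _ => hs.2
  rw [heq]
  exact ⟨hs.1, hs.2, fun j hj hPj => hm j hj ⟨hj.trans hs.1, hPj⟩⟩

theorem least_of_forall_not {m : ℕ} {P : ℕ → Prop} (h : ∀ i < m, ¬ P i) : least m P = m :=
  least_eq le_rfl h fun hm => absurd hm (lt_irrefl m)

theorem not_of_lt_least {m j : ℕ} {P : ℕ → Prop} (h : j < least m P) : ¬ P j := by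
  by_cases hex : ∃ i < m, P i
  · exact (least_spec hex).2.2 j h
  · exact fun hj => hex ⟨j, h.trans_le (least_le m P), hj⟩

theorem least_congr {m : ℕ} {P Q : ℕ → Prop} (h : ∀ i < m, (P i ↔ Q i)) :
    least m P = least m Q := by
  classical
  refine Finset.sum_congr rfl fun i hi => ?_
  have hi := Finset.mem_range.1 hi
  have : (∀ j < i + 1, ¬ P j) ↔ ∀ j < i + 1, ¬ Q j :=
    forall₂_congr fun j hj => not_congr (h j (by omega))
  simp only [this]

/-- Strict comparison. -/
def Ex.lt (a b : Ex .word) : Ex .prop := (Ex.wle b a).not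

/-- Equality of words. -/
def Ex.eq (a b : Ex .word) : Ex .prop := (Ex.wle a b).and (Ex.wle b a)

/-- Strict comparison of reals. -/
def Ex.rlt (a b : Ex .real) : Ex .prop := (Ex.rle b a).not

/-- Bounded universal quantification. -/
def Ex.all (x : Fin 64) (m : Ex .word) (b : Ex .prop) : Ex .prop :=
  .wle (.sum x m (.ind b.not)) 0

/-- Bounded existential quantification. -/
def Ex.exs (x : Fin 64) (m : Ex .word) (b : Ex .prop) : Ex .prop := (Ex.all x m b.not).not

/-- The least `x < m` with a property, and `m` if there is none. -/
def Ex.least (x : Fin 64) (m : Ex .word) (b : Ex .prop) : Ex .word :=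
  .sum x m (.ind (.all x (.var x + 1) b.not))

/-- The pairing function. -/
def Ex.pair (a b : Ex .word) : Ex .word :=
  .ind (a.lt b) * (b * b + a) + .ind (a.lt b).not * (a * a + a + b)

/-- Case distinction between words. -/
def Ex.ite (c : Ex .prop) (a b : Ex .word) : Ex .word := .ind c * a + .ind c.not * b

/-- Case distinction between reals. -/
def Ex.rite (c : Ex .prop) (a b : Ex .real) : Ex .real :=
  .cast (.ind c) * a + .cast (.ind c.not) * b

section eval

variable (σ : State)

@[simp] theorem Ex.eval_lt (a b : Ex .word) :
    (a.lt b).eval σ ↔ @LT.lt ℕ _ (a.eval σ) (b.eval σ) := by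
  simp [Ex.lt]

@[simp] theorem Ex.eval_eq (a b : Ex .word) :
    (a.eq b).eval σ ↔ @Eq ℕ (a.eval σ) (b.eval σ) := by
  simp only [Ex.eq, Ex.eval_and, Ex.eval_wle]
  exact ⟨fun h => le_antisymm h.1 h.2, fun h => ⟨h.le, h.ge⟩⟩

@[simp] theorem Ex.eval_rlt (a b : Ex .real) :
    (a.rlt b).eval σ ↔ @LT.lt ℝ _ (a.eval σ) (b.eval σ) := by
  simp [Ex.rlt]

@[simp] theorem Ex.eval_all (x : Fin 64) (m : Ex .word) (b : Ex .prop) :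
    (Ex.all x m b).eval σ ↔ ∀ i : ℕ, @LT.lt ℕ _ i (m.eval σ) → b.eval (σ.setw x i) := by
  classical
  simp only [Ex.all, Ex.eval_wle, Ex.eval_sum, Ex.eval_ind, Ex.eval_not, Ex.eval_ofNat]
  rw [show (OfNat.ofNat 0 : ℕ) = 0 from rfl, Nat.le_zero]
  constructor
  · intro h i hi
    have := (Finset.sum_eq_zero_iff.1 h) i (Finset.mem_range.2 hi)
    by_contra hb
    simp [hb] at this
  · intro h
    refine Finset.sum_eq_zero fun i hi => ?_
    simp [h i (Finset.mem_range.1 hi)]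

@[simp] theorem Ex.eval_exs (x : Fin 64) (m : Ex .word) (b : Ex .prop) :
    (Ex.exs x m b).eval σ ↔ ∃ i : ℕ, @LT.lt ℕ _ i (m.eval σ) ∧ b.eval (σ.setw x i) := by
  simp only [Ex.exs, Ex.eval_not, Ex.eval_all]
  push Not
  rfl

@[simp] theorem Ex.eval_least (x : Fin 64) (m : Ex .word) (b : Ex .prop) :
    (Ex.least x m b).eval σ = RAM.least (m.eval σ) fun i => b.eval (σ.setw x i) := by
  classical
  simp only [Ex.least, Ex.eval_sum, Ex.eval_ind, RAM.least]
  refine Finset.sum_congr rfl fun i _ => ?_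
  simp only [Ex.eval_all, Ex.eval_add, Ex.eval_var, Ex.eval_not, State.setw_setw,
    State.setw_wreg_same, Ex.eval_ofNat]

@[simp] theorem Ex.eval_pair (a b : Ex .word) :
    (a.pair b).eval σ = Nat.pair (a.eval σ) (b.eval σ) := by
  simp only [Ex.pair, Ex.eval_add, Ex.eval_mul, Ex.eval_ind, Ex.eval_lt, Ex.eval_not, Nat.pair]
  by_cases h : @LT.lt ℕ _ (a.eval σ) (b.eval σ) <;> simp [h]

open Classical in
@[simp] theorem Ex.eval_ite (c : Ex .prop) (a b : Ex .word) :
    (Ex.ite c a b).eval σ = if c.eval σ then a.eval σ else b.eval σ := by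
  simp only [Ex.ite, Ex.eval_add, Ex.eval_mul, Ex.eval_ind, Ex.eval_not]
  by_cases h : c.eval σ <;> simp [h]

open Classical in
@[simp] theorem Ex.eval_rite (c : Ex .prop) (a b : Ex .real) :
    (Ex.rite c a b).eval σ = if c.eval σ then a.eval σ else b.eval σ := by
  simp only [Ex.rite, Ex.eval_add_real, Ex.eval_mul_real, Ex.eval_cast, Ex.eval_ind, Ex.eval_not]
  by_cases h : c.eval σ <;> simp [h]

end eval

/-! ### Tables -/

/-- Entry `u` of word table `k`. -/
def State.wa (σ : State) (k u : ℕ) : ℕ := σ.wmem (σ.cap + Nat.pair k u)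

/-- Entry `u` of real table `k`. -/
def State.ra (σ : State) (k u : ℕ) : ℝ := σ.rmem (σ.cap + Nat.pair k u)

/-- Entry `u` of word table `k`. -/
def Ex.rd (k : ℕ) (u : Ex .word) : Ex .word := .read (Ex.cap + Ex.pair (.const k) u)

/-- Entry `u` of real table `k`. -/
def Ex.rrd (k : ℕ) (u : Ex .word) : Ex .real := .rread (Ex.cap + Ex.pair (.const k) u)

@[simp] theorem Ex.eval_rd (σ : State) (k : ℕ) (u : Ex .word) :
    (Ex.rd k u).eval σ = σ.wa k (u.eval σ) := by
  simp [Ex.rd, State.wa]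

@[simp] theorem Ex.eval_rrd (σ : State) (k : ℕ) (u : Ex .word) :
    (Ex.rrd k u).eval σ = σ.ra k (u.eval σ) := by
  simp [Ex.rrd, State.ra]

theorem State.wa_setw (σ : State) {x : ℕ} (hx : x ≠ 0) (i k u : ℕ) :
    (σ.setw x i).wa k u = σ.wa k u := by
  simp [State.wa, State.cap_setw _ hx]

theorem State.ra_setw (σ : State) {x : ℕ} (hx : x ≠ 0) (i k u : ℕ) :
    (σ.setw x i).ra k u = σ.ra k u := by
  simp [State.ra, State.cap_setw _ hx]

/-- A table: its entries are the values of an expression, which may refer to the index of the entry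
as register `1`, to previous tables and to previous entries. -/
inductive Table
  | word (e : Ex .word)
  | real (e : Ex .real)

/-- The command that computes table number `k`. -/
def Table.cmd (k : ℕ) : Table → Cmd
  | .word e => .iter 1 (Ex.cap.pow 4) (.store (Ex.cap + Ex.pair (.const k) (.var 1)) e)
  | .real e => .iter 1 (Ex.cap.pow 4) (.rstore (Ex.cap + Ex.pair (.const k) (.var 1)) e)

/-- The command that computes the tables `k, k + 1, …`, followed by another command. -/
def Table.cmds : ℕ → List Table → Cmd → Cmd
  | _, [], c => c
  | k, T :: l, c => .seq (T.cmd k) (Table.cmds (k + 1) l c)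

/-- The state after the computation of the tables `k, k + 1, …`. -/
noncomputable def Table.run : ℕ → List Table → State → State
  | _, [], σ => σ
  | k, T :: l, σ => Table.run (k + 1) l ((T.cmd k).eval σ)

theorem Table.eval_cmds (k : ℕ) (l : List Table) (c : Cmd) (σ : State) :
    (Table.cmds k l c).eval σ = c.eval (Table.run k l σ) := by
  induction l generalizing k σ with
  | nil => rfl
  | cons T l ih => exact ih _ _

theorem Table.cmds_ok (k : ℕ) (l : List Table) {c : Cmd} (hc : c.Ok) : (Table.cmds k l c).Ok := by
  induction l generalizing k with
  | nil => exact hc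
  | cons T l ih =>
    refine ⟨?_, ih _⟩
    cases T <;> exact ⟨by decide, trivial⟩

/-- The states agree outside table `k`. -/
structure SameBut (P : ℕ → ℕ → Prop) (σ τ : State) : Prop where
  wreg : τ.wreg = σ.wreg
  rreg : τ.rreg = σ.rreg
  wflat : ∀ a < σ.cap, τ.wmem a = σ.wmem a
  rflat : ∀ a < σ.cap, τ.rmem a = σ.rmem a
  wa : ∀ k u, P k u → τ.wa k u = σ.wa k u
  ra : ∀ k u, P k u → τ.ra k u = σ.ra k u

theorem SameBut.cap {P : ℕ → ℕ → Prop} {σ τ : State} (h : SameBut P σ τ) : τ.cap = σ.cap :=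
  State.cap_congr h.wreg

theorem SameBut.trans {P : ℕ → ℕ → Prop} {σ τ υ : State} (h : SameBut P σ τ)
    (h' : SameBut P τ υ) : SameBut P σ υ where
  wreg := h'.wreg.trans h.wreg
  rreg := h'.rreg.trans h.rreg
  wflat a ha := (h'.wflat a (by rwa [h.cap])).trans (h.wflat a ha)
  rflat a ha := (h'.rflat a (by rwa [h.cap])).trans (h.rflat a ha)
  wa k u hk := (h'.wa k u hk).trans (h.wa k u hk)
  ra k u hk := (h'.ra k u hk).trans (h.ra k u hk)

theorem SameBut.mono {P Q : ℕ → ℕ → Prop} {σ τ : State} (h : SameBut P σ τ)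
    (hQ : ∀ k u, Q k u → P k u) : SameBut Q σ τ :=
  { h with
    wa := fun k u hk => h.wa k u (hQ k u hk)
    ra := fun k u hk => h.ra k u (hQ k u hk) }

/-- The state `ψ` in which entry `u` of table `k` is computed, compared with the final state `τ`. -/
def Before (k u : ℕ) (τ ψ : State) : Prop :=
  SameBut (fun k' u' => k' < k ∨ k' = k ∧ u' < u) (τ.setw 1 u) ψ

theorem Cmd.eval_iter (x : Fin 64) (m : Ex .word) (c : Cmd) (σ : State) :
    (Cmd.iter x m c).eval σ = c.round x σ (m.eval σ) := rfl

theorem SameBut.refl (P : ℕ → ℕ → Prop) (σ : State) : SameBut P σ σ :=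
  ⟨rfl, rfl, fun _ _ => rfl, fun _ _ => rfl, fun _ _ _ => rfl, fun _ _ _ => rfl⟩

theorem SameBut.symm {P : ℕ → ℕ → Prop} {σ τ : State} (h : SameBut P σ τ) : SameBut P τ σ where
  wreg := h.wreg.symm
  rreg := h.rreg.symm
  wflat a ha := (h.wflat a (by rwa [h.cap] at ha)).symm
  rflat a ha := (h.rflat a (by rwa [h.cap] at ha)).symm
  wa k u hk := (h.wa k u hk).symm
  ra k u hk := (h.ra k u hk).symm

theorem SameBut.setw {P : ℕ → ℕ → Prop} {σ τ : State} (h : SameBut P σ τ) {x : ℕ} (i : ℕ)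
    (hx : x ≠ 0) : SameBut P (σ.setw x i) (τ.setw x i) := by
  refine ⟨by simp [State.setw, h.wreg], h.rreg, fun a ha => ?_, fun a ha => ?_, fun k u hk => ?_,
    fun k u hk => ?_⟩
  · exact h.wflat a (by rwa [State.cap_setw _ hx] at ha)
  · exact h.rflat a (by rwa [State.cap_setw _ hx] at ha)
  · rw [State.wa_setw _ hx, State.wa_setw _ hx, h.wa k u hk]
  · rw [State.ra_setw _ hx, State.ra_setw _ hx, h.ra k u hk]

/-- The address of entry `u` of table `k`, where register `1` holds `u`. -/
def Table.addr (k : ℕ) : Ex .word := Ex.cap + Ex.pair (.const k) (.var 1)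

theorem Table.eval_addr (k u : ℕ) (σ : State) :
    (Table.addr k).eval (σ.setw 1 u) = σ.cap + Nat.pair k u := by
  simp [Table.addr, State.cap_setw]

/-- The table `k` of words is filled. -/
theorem Table.word_round (k : ℕ) (e : Ex .word) (σ : State) (i : ℕ) :
    SameBut (fun k' u' => k' ≠ k ∨ u' ≠ i) ((Cmd.store (Table.addr k) e).round 1 σ i)
      ((Cmd.store (Table.addr k) e).round 1 σ (i + 1)) ∧
    (∀ k' u', ((Cmd.store (Table.addr k) e).round 1 σ (i + 1)).ra k' u' =
      ((Cmd.store (Table.addr k) e).round 1 σ i).ra k' u') ∧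
    ((Cmd.store (Table.addr k) e).round 1 σ (i + 1)).wa k i =
      (e.eval (((Cmd.store (Table.addr k) e).round 1 σ i).setw 1 i) : ℕ) % σ.cap := by
  generalize hR : (Cmd.store (Table.addr k) e).round 1 σ i = R
  generalize hR' : (Cmd.store (Table.addr k) e).round 1 σ (i + 1) = R'
  have hw : R.wreg = σ.wreg := hR ▸ Cmd.round_wreg _ _ _ _
  have hw' : R'.wreg = σ.wreg := hR' ▸ Cmd.round_wreg _ _ _ _
  have hc : R.cap = σ.cap := State.cap_congr hw
  have hc' : R'.cap = σ.cap := State.cap_congr hw'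
  rw [Cmd.round_succ, hR] at hR'
  have hrm : R'.rmem = R.rmem := by rw [← hR']; rfl
  have hrr : R'.rreg = R.rreg := by rw [← hR']; rfl
  have hwm : R'.wmem = Function.update R.wmem (σ.cap + Nat.pair k i)
      ((e.eval (R.setw 1 i) : ℕ) % σ.cap) := by
    have h1 := Table.eval_addr k i R
    have h2 : (e % Ex.cap).eval (R.setw 1 i) = (e.eval (R.setw 1 i) : ℕ) % σ.cap := by
      simp [State.cap_setw, hc]
    rw [← hc, ← h1, hc, ← h2, ← hR']; rfl
  refine ⟨⟨hw'.trans hw.symm, hrr, fun a ha => ?_, fun a _ => by rw [hrm], fun k' u' hk => ?_,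
    fun k' u' _ => ?_⟩, fun k' u' => ?_, ?_⟩
  · rw [hwm, Function.update_of_ne]; omega
  · rw [State.wa, State.wa, hc, hc', hwm, Function.update_of_ne]
    intro h
    have := Nat.pair_eq_pair.1 (Nat.add_left_cancel h)
    tauto
  · rw [State.ra, State.ra, hc, hc', hrm]
  · rw [State.ra, State.ra, hc, hc', hrm]
  · rw [State.wa, hc', hwm, Function.update_self]

/-- The table `k` of reals is filled. -/
theorem Table.real_round (k : ℕ) (e : Ex .real) (σ : State) (i : ℕ) :
    SameBut (fun k' u' => k' ≠ k ∨ u' ≠ i) ((Cmd.rstore (Table.addr k) e).round 1 σ i)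
      ((Cmd.rstore (Table.addr k) e).round 1 σ (i + 1)) ∧
    (∀ k' u', ((Cmd.rstore (Table.addr k) e).round 1 σ (i + 1)).wa k' u' =
      ((Cmd.rstore (Table.addr k) e).round 1 σ i).wa k' u') ∧
    ((Cmd.rstore (Table.addr k) e).round 1 σ (i + 1)).ra k i =
      e.eval (((Cmd.rstore (Table.addr k) e).round 1 σ i).setw 1 i) := by
  generalize hR : (Cmd.rstore (Table.addr k) e).round 1 σ i = R
  generalize hR' : (Cmd.rstore (Table.addr k) e).round 1 σ (i + 1) = R'
  have hw : R.wreg = σ.wreg := hR ▸ Cmd.round_wreg _ _ _ _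
  have hw' : R'.wreg = σ.wreg := hR' ▸ Cmd.round_wreg _ _ _ _
  have hc : R.cap = σ.cap := State.cap_congr hw
  have hc' : R'.cap = σ.cap := State.cap_congr hw'
  rw [Cmd.round_succ, hR] at hR'
  have hwm : R'.wmem = R.wmem := by rw [← hR']; rfl
  have hrr : R'.rreg = R.rreg := by rw [← hR']; rfl
  have hrm : R'.rmem = Function.update R.rmem (σ.cap + Nat.pair k i)
      (e.eval (R.setw 1 i)) := by
    have h1 := Table.eval_addr k i R
    rw [← hc, ← h1, ← hR']; rfl
  refine ⟨⟨hw'.trans hw.symm, hrr, fun a _ => by rw [hwm], fun a ha => ?_, fun k' u' _ => ?_,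
    fun k' u' hk => ?_⟩, fun k' u' => ?_, ?_⟩
  · rw [hrm, Function.update_of_ne]; omega
  · rw [State.wa, State.wa, hc, hc', hwm]
  · rw [State.ra, State.ra, hc, hc', hrm, Function.update_of_ne]
    intro h
    have := Nat.pair_eq_pair.1 (Nat.add_left_cancel h)
    tauto
  · rw [State.wa, State.wa, hc, hc', hwm]
  · rw [State.ra, hc', hrm, Function.update_self]

/-- Round `i` writes only entry `i` of table `k`, so an entry is final once its round is over. -/
theorem SameBut.of_rounds {k : ℕ} {R : ℕ → State}
    (h : ∀ i, SameBut (fun k' u' => k' ≠ k ∨ u' ≠ i) (R i) (R (i + 1))) {i j : ℕ} (hij : i ≤ j) :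
    SameBut (fun k' u' => k' ≠ k ∨ u' < i) (R i) (R j) := by
  induction j, hij using Nat.le_induction with
  | base => exact .refl _ _
  | succ j hj ih =>
    refine ih.trans ((h j).mono fun k' u' hk => ?_)
    rcases hk with hk | hk
    · exact .inl hk
    · exact .inr (by omega)

/-- The witness `ψ` is the state of round `u` with register `1` set to `u`. Later rounds spare the
entries below `u` and the other tables, so `ψ` sees final values wherever `Before` asks for them. -/
theorem Table.eval_word (k : ℕ) (e : Ex .word) (σ : State) :
    SameBut (fun k' _ => k' ≠ k) σ (((Table.word e).cmd k).eval σ) ∧ ∀ u < σ.cap ^ 4,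
    ∃ ψ, Before k u (((Table.word e).cmd k).eval σ) ψ ∧
      (((Table.word e).cmd k).eval σ).wa k u = (e.eval ψ : ℕ) % σ.cap := by
  have hm : (Ex.cap.pow 4).eval σ = σ.cap ^ 4 := by simp
  rw [Table.cmd, Cmd.eval_iter, hm]
  have h := Table.word_round k e σ
  change ∀ i, _ at h
  simp only [Table.addr] at h
  set R := fun i => (Cmd.store (Ex.cap + Ex.pair (.const k) (.var 1)) e).round 1 σ i with hR
  have hs : ∀ i j, i ≤ j → SameBut (fun k' u' => k' ≠ k ∨ u' < i) (R i) (R j) :=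
    fun i j hij => SameBut.of_rounds (fun i => (h i).1) hij
  have h0 : R 0 = σ := rfl
  refine ⟨?_, fun u hu => ⟨(R u).setw 1 u, ?_, ?_⟩⟩
  · have := hs 0 (σ.cap ^ 4) (Nat.zero_le _)
    rw [h0] at this
    exact this.mono fun _ _ hk => .inl hk
  · refine SameBut.setw ((hs u _ hu.le).symm.mono fun k' u' hk => ?_) u (by decide)
    rcases hk with hk | hk
    · exact .inl hk.ne
    · exact .inr hk.2
  · rw [← (h u).2.2]
    exact (hs (u + 1) _ hu).wa k u (.inr (Nat.lt_succ_self u))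

theorem Table.eval_real (k : ℕ) (e : Ex .real) (σ : State) :
    SameBut (fun k' _ => k' ≠ k) σ (((Table.real e).cmd k).eval σ) ∧ ∀ u < σ.cap ^ 4,
    ∃ ψ, Before k u (((Table.real e).cmd k).eval σ) ψ ∧
      (((Table.real e).cmd k).eval σ).ra k u = e.eval ψ := by
  have hm : (Ex.cap.pow 4).eval σ = σ.cap ^ 4 := by simp
  rw [Table.cmd, Cmd.eval_iter, hm]
  have h := Table.real_round k e σ
  change ∀ i, _ at h
  simp only [Table.addr] at h
  set R := fun i => (Cmd.rstore (Ex.cap + Ex.pair (.const k) (.var 1)) e).round 1 σ i with hR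
  have hs : ∀ i j, i ≤ j → SameBut (fun k' u' => k' ≠ k ∨ u' < i) (R i) (R j) :=
    fun i j hij => SameBut.of_rounds (fun i => (h i).1) hij
  have h0 : R 0 = σ := rfl
  refine ⟨?_, fun u hu => ⟨(R u).setw 1 u, ?_, ?_⟩⟩
  · have := hs 0 (σ.cap ^ 4) (Nat.zero_le _)
    rw [h0] at this
    exact this.mono fun _ _ hk => .inl hk
  · refine SameBut.setw ((hs u _ hu.le).symm.mono fun k' u' hk => ?_) u (by decide)
    rcases hk with hk | hk
    · exact .inl hk.ne
    · exact .inr hk.2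
  · rw [← (h u).2.2]
    exact (hs (u + 1) _ hu).ra k u (.inr (Nat.lt_succ_self u))

theorem Table.sameBut_cmd (k : ℕ) (T : Table) (σ : State) :
    SameBut (fun k' _ => k' ≠ k) σ ((T.cmd k).eval σ) := by
  cases T with
  | word e => exact (Table.eval_word k e σ).1
  | real e => exact (Table.eval_real k e σ).1

theorem Table.sameBut_run (k : ℕ) (l : List Table) (σ : State) :
    SameBut (fun k' _ => k' < k) σ (Table.run k l σ) := by
  induction l generalizing k σ with
  | nil => exact .refl _ _
  | cons T l ih =>
    exact ((T.sameBut_cmd k σ).mono fun _ _ h => h.ne).trans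
      ((ih (k + 1) _).mono fun _ _ h => h.trans (Nat.lt_succ_self k))

/-- Tables computed later change neither table `k` nor the ones before it. -/
theorem Before.final {k u : ℕ} {τ τ' ψ : State} (h : Before k u τ ψ)
    (h' : SameBut (fun k' _ => k' < k + 1) τ τ') : Before k u τ' ψ := by
  have h1 := (h'.setw (x := 1) u (by decide)).symm
  refine (h1.mono ?_).trans h
  rintro k' u' (hk | ⟨rfl, -⟩)
  · exact hk.trans (Nat.lt_succ_self k)
  · exact Nat.lt_succ_self k'

theorem Table.run_word {k j : ℕ} {l : List Table} {e : Ex .word} {σ : State}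
    (hj : l[j]? = some (.word e)) {u : ℕ} (hu : u < σ.cap ^ 4) :
    ∃ ψ, Before (k + j) u (Table.run k l σ) ψ ∧
      (Table.run k l σ).wa (k + j) u = (e.eval ψ : ℕ) % σ.cap := by
  induction l generalizing k j σ with
  | nil => simp at hj
  | cons T l ih =>
    have hT := T.sameBut_cmd k σ
    cases j with
    | zero =>
      simp only [List.getElem?_cons_zero, Option.some.injEq] at hj
      subst hj
      obtain ⟨ψ, h1, h2⟩ := (Table.eval_word k e σ).2 u hu
      have h3 := Table.sameBut_run (k + 1) l (((Table.word e).cmd k).eval σ)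
      refine ⟨ψ, h1.final h3, ?_⟩
      rw [← h2]
      exact h3.wa k u (Nat.lt_succ_self k)
    | succ j =>
      simp only [List.getElem?_cons_succ] at hj
      have := ih (k := k + 1) (σ := (T.cmd k).eval σ) hj (by rwa [hT.cap])
      rw [hT.cap, show k + 1 + j = k + (j + 1) by omega] at this
      exact this

theorem Table.run_real {k j : ℕ} {l : List Table} {e : Ex .real} {σ : State}
    (hj : l[j]? = some (.real e)) {u : ℕ} (hu : u < σ.cap ^ 4) :
    ∃ ψ, Before (k + j) u (Table.run k l σ) ψ ∧
      (Table.run k l σ).ra (k + j) u = e.eval ψ := by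
  induction l generalizing k j σ with
  | nil => simp at hj
  | cons T l ih =>
    have hT := T.sameBut_cmd k σ
    cases j with
    | zero =>
      simp only [List.getElem?_cons_zero, Option.some.injEq] at hj
      subst hj
      obtain ⟨ψ, h1, h2⟩ := (Table.eval_real k e σ).2 u hu
      have h3 := Table.sameBut_run (k + 1) l (((Table.real e).cmd k).eval σ)
      refine ⟨ψ, h1.final h3, ?_⟩
      rw [← h2]
      exact h3.ra k u (Nat.lt_succ_self k)
    | succ j =>
      simp only [List.getElem?_cons_succ] at hj
      have := ih (k := k + 1) (σ := (T.cmd k).eval σ) hj (by rwa [hT.cap])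
      rw [show k + 1 + j = k + (j + 1) by omega] at this
      exact this

end RAM

namespace DistanceOracle

open Finset

/-! ### The potential of a partial partition -/

/-- The `K` ratios `m (i + 1) / m i` have product `m K / m 0`, so the smallest of them, at `j`, is
at most the `K`-th root of this quotient. -/
theorem exists_min_ratio_le {K : ℕ} {m : ℕ → ℕ} (h0 : 0 < m 0) (hm : Monotone m) {j : ℕ}
    (hj : j < K) (hmin : ∀ i < K, m (j + 1) * m i ≤ m (i + 1) * m j) :
    (m (j + 1) : ℝ) * (m K : ℝ) ^ (-(1 / K : ℝ)) ≤ m j * (m 0 : ℝ) ^ (-(1 / K : ℝ)) := by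
  have hpos : ∀ i, (0 : ℝ) < m i := fun i => by exact_mod_cast h0.trans_le (hm (Nat.zero_le i))
  have hK : (0 : ℝ) < K := by exact_mod_cast (Nat.zero_le j).trans_lt hj
  have hratio : ∀ i ∈ range K, (m (j + 1) : ℝ) / m j ≤ m (i + 1) / m i := by
    intro i hi
    rw [div_le_div_iff₀ (hpos j) (hpos i)]
    exact_mod_cast hmin i (mem_range.1 hi)
  have hprod : ((m (j + 1) : ℝ) / m j) ^ K ≤ m K / m 0 := by
    have htel : ∀ n, ∏ i ∈ range n, (m (i + 1) : ℝ) / m i = m n / m 0 := by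
      intro n
      induction n with
      | zero => simp [(hpos 0).ne']
      | succ n ih =>
        rw [prod_range_succ, ih]
        have := (hpos n).ne'
        have := (hpos 0).ne'
        field_simp
    calc ((m (j + 1) : ℝ) / m j) ^ K = ∏ _i ∈ range K, (m (j + 1) : ℝ) / m j := by
          rw [prod_const, card_range]
      _ ≤ ∏ i ∈ range K, (m (i + 1) : ℝ) / m i :=
          prod_le_prod (fun i _ => (div_pos (hpos _) (hpos _)).le) hratio
      _ = m K / m 0 := htel K
  have hroot : (m (j + 1) : ℝ) / m j ≤ (m K / m 0 : ℝ) ^ (1 / K : ℝ) := by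
    have h := Real.rpow_le_rpow (pow_nonneg (div_pos (hpos _) (hpos _)).le K) hprod
      (one_div_pos.2 hK).le
    rwa [← Real.rpow_natCast, ← Real.rpow_mul (div_pos (hpos _) (hpos _)).le,
      mul_one_div_cancel hK.ne', Real.rpow_one] at h
  rw [Real.div_rpow (hpos K).le (hpos 0).le, div_le_div_iff₀ (hpos j)
    (Real.rpow_pos_of_pos (hpos 0) _)] at hroot
  rw [Real.rpow_neg (hpos K).le, Real.rpow_neg (hpos 0).le, ← div_eq_mul_inv, ← div_eq_mul_inv,
    div_le_div_iff₀ (Real.rpow_pos_of_pos (hpos K) _) (Real.rpow_pos_of_pos (hpos 0) _)]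
  linarith

section potential

open Classical in
/-- The number of marked points of the class of `u` within distance `r` of `u`. -/
noncomputable def ballCard (d : ℕ → ℕ → ℝ) (M : Finset ℕ) (E : ℕ → ℕ → Prop) (u : ℕ) (r : ℝ) : ℕ :=
  #{z ∈ M | E u z ∧ d u z ≤ r}

open Classical in
/-- The largest number of marked points in a ball around a point of the class of `y`. -/
noncomputable def localSize (d : ℕ → ℕ → ℝ) (X M : Finset ℕ) (E : ℕ → ℕ → Prop) (rad : ℕ → ℝ)
    (y : ℕ) : ℕ :=
  {u ∈ X | E y u}.sup fun u => ballCard d M E u (rad u)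

/-- The potential of a partial partition with marked points `M`. -/
noncomputable def potential (d : ℕ → ℕ → ℝ) (K : ℕ) (X M : Finset ℕ) (E : ℕ → ℕ → Prop)
    (rad : ℕ → ℝ) : ℝ :=
  ∑ y ∈ M, (localSize d X M E rad y : ℝ) ^ (-(1 / K : ℝ))

variable {d : ℕ → ℕ → ℝ} {X M M' : Finset ℕ} {E E' : ℕ → ℕ → Prop} {rad rad' : ℕ → ℝ}

theorem ballCard_le (hM : M' ⊆ M) {u : ℕ} (hE : ∀ z ∈ M', E' u z → E u z) {r s : ℝ} (hr : r ≤ s) :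
    ballCard d M' E' u r ≤ ballCard d M E u s := by
  classical
  refine card_le_card fun z hz => ?_
  rw [mem_filter] at hz ⊢
  exact ⟨hM hz.1, hE z hz.1 hz.2.1, hz.2.2.trans hr⟩

theorem ballCard_le_localSize {y u : ℕ} (hu : u ∈ X) (hE : E y u) :
    ballCard d M E u (rad u) ≤ localSize d X M E rad y := by
  classical
  exact le_sup (f := fun u => ballCard d M E u (rad u)) (mem_filter.2 ⟨hu, hE⟩)

theorem localSize_le {y b : ℕ} (h : ∀ u ∈ X, E y u → ballCard d M E u (rad u) ≤ b) :
    localSize d X M E rad y ≤ b := by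
  classical
  refine Finset.sup_le fun u hu => ?_
  rw [mem_filter] at hu
  exact h u hu.1 hu.2

theorem localSize_pos (hMX : M ⊆ X) {y : ℕ} (hy : y ∈ M) (hE : E y y) (hd : d y y ≤ rad y) :
    0 < localSize d X M E rad y := by
  classical
  refine lt_of_lt_of_le ?_ (ballCard_le_localSize (hMX hy) hE)
  exact card_pos.2 ⟨y, mem_filter.2 ⟨hy, hE, hd⟩⟩

theorem rpow_neg_anti {K a b : ℕ} (ha : 0 < a) (hab : a ≤ b) :
    (b : ℝ) ^ (-(1 / K : ℝ)) ≤ (a : ℝ) ^ (-(1 / K : ℝ)) :=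
  Real.rpow_le_rpow_of_nonpos (by exact_mod_cast ha) (by exact_mod_cast hab)
    (by simp)

/-- Carving a ball does not decrease the potential. -/
theorem potential_carve {K : ℕ} {v j : ℕ} {R r0 δ : ℝ} {A : ℕ → Prop} (hE : Equivalence E)
    (hMX : M ⊆ X) (hv : v ∈ X) (hrad : ∀ u ∈ X, 0 ≤ rad u) (hd : ∀ u ∈ X, d u u = 0)
    (hR : ∀ u ∈ X, E v u → rad u = R)
    (hmax : ∀ u ∈ X, E v u → ballCard d M E u r0 ≤ ballCard d M E v r0)
    (hr0 : 0 ≤ r0) (hδ : 0 ≤ δ) (hKR : r0 + 2 * δ * K ≤ R) (hj : j < K)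
    (hmin : ∀ i < K, ballCard d M E v (r0 + 2 * δ * (j + 1 : ℕ)) *
      ballCard d M E v (r0 + 2 * δ * i) ≤
      ballCard d M E v (r0 + 2 * δ * (i + 1 : ℕ)) * ballCard d M E v (r0 + 2 * δ * j))
    (hA : ∀ x ∈ X, (A x ↔ E v x ∧ d v x ≤ r0 + 2 * δ * j + δ))
    (hM' : ∀ x, x ∈ M' ↔ x ∈ M ∧
      ¬ (E v x ∧ r0 + 2 * δ * j < d v x ∧ d v x ≤ r0 + 2 * δ * (j + 1 : ℕ)))
    (hE' : ∀ x ∈ X, ∀ y ∈ X, (E' x y ↔ E x y ∧ (A x ↔ A y)))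
    (hradA : ∀ x ∈ X, A x → rad' x = r0) (hradn : ∀ x ∈ X, ¬ A x → rad' x = rad x) :
    potential d K X M E rad ≤ potential d K X M' E' rad' := by
  classical
  have hsub : M' ⊆ M := fun x hx => ((hM' x).1 hx).1
  have hcast : ((j + 1 : ℕ) : ℝ) = j + 1 := by push_cast; ring
  have hrj : r0 ≤ r0 + 2 * δ * j := by
    have : (0 : ℝ) ≤ j := Nat.cast_nonneg j
    nlinarith
  set m : ℕ → ℕ := fun i => ballCard d M E v (r0 + 2 * δ * i) with hm
  have hmono : Monotone m := by
    intro a b hab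
    refine ballCard_le Subset.rfl (fun _ _ h => h) ?_
    have : (a : ℝ) ≤ b := by exact_mod_cast hab
    nlinarith
  set T : ℕ → Prop := fun y => E v y ∧ d v y ≤ r0 + 2 * δ * (j + 1 : ℕ) with hT
  have hAT : ∀ x ∈ X, A x → T x := by
    intro x hx hAx
    have := (hA x hx).1 hAx
    refine ⟨this.1, this.2.trans ?_⟩
    rw [hcast]; nlinarith
  rw [potential, potential, ← sum_filter_add_sum_filter_not M T,
    ← sum_filter_add_sum_filter_not M' T]
  refine add_le_add ?_ ?_
  · -- points of the ball
    have hfil : {y ∈ M' | T y} = {y ∈ M | E v y ∧ d v y ≤ r0 + 2 * δ * j} := by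
      ext y
      simp only [mem_filter, hM', hT]
      constructor
      · rintro ⟨⟨h1, h2⟩, h3, h4⟩
        refine ⟨h1, h3, ?_⟩
        by_contra h5
        exact h2 ⟨h3, lt_of_not_ge h5, h4⟩
      · rintro ⟨h1, h2, h3⟩
        refine ⟨⟨h1, fun h => absurd h3 (not_le.2 h.2.1)⟩, h2, h3.trans ?_⟩
        rw [hcast]; nlinarith
    -- If the ball of radius `r0` around the centre has no marked point, then by maximality the
    -- class of the centre has none at all, because a marked point counts itself.
    by_cases h0 : m 0 = 0
    · have hempty : {y ∈ M | T y} = ∅ := by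
        refine filter_eq_empty_iff.2 fun y hy hTy => ?_
        have h1 := hmax y (hMX hy) hTy.1
        have h2 : ballCard d M E v r0 = 0 := by simpa [hm] using h0
        rw [h2, Nat.le_zero, ballCard, card_eq_zero, filter_eq_empty_iff] at h1
        exact h1 hy ⟨hE.refl y, by rw [hd y (hMX hy)]; exact hr0⟩
      rw [hempty, sum_empty]
      exact sum_nonneg fun y _ => Real.rpow_nonneg (Nat.cast_nonneg _) _
    · have h0' : 0 < m 0 := Nat.pos_of_ne_zero h0
      -- The ball of radius `R` around `v` contains the largest concentric ball, so each of the `m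
      -- (j + 1)` old terms is at most the power `-1 / K` of `m K`.
      have hold : ∑ y ∈ M with T y, (localSize d X M E rad y : ℝ) ^ (-(1 / K : ℝ)) ≤
          m (j + 1) * (m K : ℝ) ^ (-(1 / K : ℝ)) := by
        have hcard : #{y ∈ M | T y} = m (j + 1) := rfl
        rw [← hcard, ← nsmul_eq_mul]
        refine sum_le_card_nsmul _ _ _ fun y hy => ?_
        rw [mem_filter] at hy
        refine rpow_neg_anti (h0'.trans_le (hmono (Nat.zero_le K))) ?_
        refine le_trans ?_ (ballCard_le_localSize hv (hE.symm hy.2.1))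
        refine ballCard_le Subset.rfl (fun _ _ h => h) ?_
        rw [hR v hv (hE.refl v)]
        exact hKR
      -- The `m j` survivors of the inner ball are in a class where the radius is now `r0`, and by
      -- the choice of `v` no ball of this radius has more than `m 0` marked points.
      have hnew : m j * (m 0 : ℝ) ^ (-(1 / K : ℝ)) ≤
          ∑ y ∈ M' with T y, (localSize d X M' E' rad' y : ℝ) ^ (-(1 / K : ℝ)) := by
        have hcard : #{y ∈ M' | T y} = m j := by rw [hfil]; rfl
        rw [← hcard, ← nsmul_eq_mul]
        refine card_nsmul_le_sum _ _ _ fun y hy => ?_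
        have hy' := hy
        rw [hfil, mem_filter] at hy'
        rw [mem_filter] at hy
        have hyX : y ∈ X := hMX hy'.1
        have hAy : A y := (hA y hyX).2 ⟨hy'.2.1, hy'.2.2.trans (by linarith)⟩
        refine rpow_neg_anti (localSize_pos (hsub.trans hMX) hy.1 ?_ ?_) ?_
        · exact (hE' y hyX y hyX).2 ⟨hE.refl y, Iff.rfl⟩
        · rw [hd y hyX, hradA y hyX hAy]; exact hr0
        · refine localSize_le fun u hu hyu => ?_
          obtain ⟨h1, h2⟩ := (hE' y hyX u hu).1 hyu
          have hAu := h2.1 hAy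
          have hvu := ((hA u hu).1 hAu).1
          rw [hradA u hu hAu]
          have h3 := hmax u hu hvu
          have h4 : m 0 = ballCard d M E v r0 := by simp [hm]
          rw [h4]
          refine le_trans (ballCard_le hsub (fun z hz h => ?_) le_rfl) h3
          exact ((hE' u hu z (hMX (hsub hz))).1 h).1
      exact hold.trans ((exists_min_ratio_le h0' hmono hj hmin).trans hnew)
  · -- points outside the ball
    have hfil : {y ∈ M' | ¬ T y} = {y ∈ M | ¬ T y} := by
      ext y
      simp only [mem_filter, hM', hT]
      constructor
      · rintro ⟨⟨h1, h2⟩, h3⟩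
        exact ⟨h1, h3⟩
      · rintro ⟨h1, h2⟩
        exact ⟨⟨h1, fun h => h2 ⟨h.1, h.2.2⟩⟩, h2⟩
    rw [hfil]
    refine sum_le_sum fun y hy => ?_
    have hyM' : y ∈ M' := (mem_filter.1 (hfil ▸ hy)).1
    rw [mem_filter] at hy
    have hyX : y ∈ X := hMX hy.1
    have hAy : ¬ A y := fun h => hy.2 (hAT y hyX h)
    refine rpow_neg_anti (localSize_pos (hsub.trans hMX) hyM' ?_ ?_) ?_
    · exact (hE' y hyX y hyX).2 ⟨hE.refl y, Iff.rfl⟩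
    · rw [hd y hyX, hradn y hyX hAy]; exact hrad y hyX
    -- Outside the ball radii are unchanged, while classes and marked sets only shrink, so local
    -- sizes do not grow.
    · refine localSize_le fun u hu hyu => ?_
      obtain ⟨h1, h2⟩ := (hE' y hyX u hu).1 hyu
      have hAu : ¬ A u := fun h => hAy (h2.2 h)
      refine le_trans ?_ (ballCard_le_localSize hu h1)
      rw [hradn u hu hAu]
      refine ballCard_le hsub (fun z hz h => ?_) le_rfl
      exact ((hE' u hu z (hMX (hsub hz))).1 h).1

theorem potential_congr {K : ℕ} (hMX : M ⊆ X) (hM : M' = M)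
    (hE : ∀ x ∈ X, ∀ y ∈ X, (E' x y ↔ E x y)) (hrad : ∀ x ∈ X, rad' x = rad x) :
    potential d K X M' E' rad' = potential d K X M E rad := by
  classical
  subst hM
  refine sum_congr rfl fun y hy => ?_
  have : localSize d X M' E' rad' y = localSize d X M' E rad y := by
    refine sup_congr ?_ fun u hu => ?_
    · ext u
      simp only [mem_filter]
      exact and_congr_right fun hu => hE y (hMX hy) u hu
    · rw [mem_filter] at hu
      simp only [ballCard]
      congr 1
      ext z
      simp only [mem_filter]
      refine and_congr_right fun hz => ?_
      rw [hE u hu.1 z (hMX hz), hrad u hu.1]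
  rw [this]

/-- A marked point counts itself, so its local size is at least `1` and its term at most `1`. -/
theorem potential_le_card {K : ℕ} (hMX : M ⊆ X) (hE : ∀ x, E x x)
    (hrad : ∀ u ∈ X, d u u ≤ rad u) : potential d K X M E rad ≤ #M := by
  have h : ∀ y ∈ M, (localSize d X M E rad y : ℝ) ^ (-(1 / K : ℝ)) ≤ 1 := by
    intro y hy
    have := rpow_neg_anti (K := K) one_pos
      (Nat.succ_le_of_lt (localSize_pos hMX hy (hE y) (hrad y (hMX hy))))
    simpa using this
  have h2 := sum_le_card_nsmul _ _ _ h
  rw [nsmul_eq_mul, mul_one] at h2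
  exact h2

/-- No local size exceeds the number of points, which bounds every term from below. -/
theorem le_potential {K : ℕ} (hE : ∀ x, E x x) (hrad : ∀ u ∈ X, d u u ≤ rad u) :
    (#X : ℝ) * (#X : ℝ) ^ (-(1 / K : ℝ)) ≤ potential d K X X E rad := by
  classical
  rw [← nsmul_eq_mul]
  refine card_nsmul_le_sum _ _ _ fun y hy => ?_
  refine rpow_neg_anti (localSize_pos Subset.rfl hy (hE y) (hrad y hy)) ?_
  exact localSize_le fun u _ _ => card_le_card (filter_subset _ _)

end potential

end DistanceOracle

namespace DistanceOracle

open Finset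

/-! ### Carving a metric space scale by scale -/

/-- The points `x` and `y` have not been separated before time `t`. -/
def Same (A : ℕ → ℕ → Prop) (t x y : ℕ) : Prop := ∀ s < t, (A s x ↔ A s y)

theorem Same.equivalence (A : ℕ → ℕ → Prop) (t : ℕ) : Equivalence (Same A t) :=
  ⟨fun _ _ _ => Iff.rfl, fun h s hs => (h s hs).symm, fun h h' s hs => (h s hs).trans (h' s hs)⟩

theorem Same.mono {A : ℕ → ℕ → Prop} {s t x y : ℕ} (h : Same A t x y) (hs : s ≤ t) :
    Same A s x y := fun i hi => h i (hi.trans_le hs)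

theorem same_succ {A : ℕ → ℕ → Prop} {t x y : ℕ} :
    Same A (t + 1) x y ↔ Same A t x y ∧ (A t x ↔ A t y) := by
  constructor
  · exact fun h => ⟨h.mono (Nat.le_succ t), h t (Nat.lt_succ_self t)⟩
  · rintro ⟨h1, h2⟩ s hs
    rcases Nat.lt_succ_iff_lt_or_eq.1 hs with h | rfl
    · exact h1 s h
    · exact h2

/-- The point `x` has not been carved in the present round, which started at time `n * (t / n)`. -/
def Free (n : ℕ) (X : ℕ → Prop) (A : ℕ → ℕ → Prop) (t x : ℕ) : Prop :=
  X x ∧ ∀ s < t, n * (t / n) ≤ s → ¬ A s x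

/-- The point `x` has not been near the boundary of a carved ball. -/
def Marked (X : ℕ → Prop) (B : ℕ → ℕ → Prop) (t x : ℕ) : Prop := X x ∧ ∀ s < t, ¬ B s x

/-- The number of marked points in the class of `u` within distance `r` of `u`. -/
noncomputable def markCard (n : ℕ) (d : ℕ → ℕ → ℝ) (X : ℕ → Prop) (A B : ℕ → ℕ → Prop) (t u : ℕ)
    (r : ℝ) : ℕ :=
  open Classical in #{z ∈ range n | (Marked X B t z ∧ Same A t u z) ∧ d u z ≤ r}

/-- In round `σ`, at the times `n * σ, …, n * σ + n - 1`, all points of `X` are carved into balls of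
radius between `R (σ + 1)` and `R σ`: `A t x` means that `x` belongs to the ball carved at time `t`,
and `B t x` means that it is near its boundary. -/
structure Carving (n K Q : ℕ) (d : ℕ → ℕ → ℝ) (X : ℕ → Prop) (R δ : ℕ → ℝ) (A B : ℕ → ℕ → Prop) :
    Prop where
  step : ∀ t < n * Q, ∃ v j,
    ((∃ x < n, Free n X A t x) → v < n ∧ Free n X A t v ∧ ∀ u < n, Free n X A t u →
      markCard n d X A B t u (R (t / n + 1)) ≤ markCard n d X A B t v (R (t / n + 1))) ∧
    (j < K ∧ ∀ i < K,
      markCard n d X A B t v (R (t / n + 1) + 2 * δ (t / n) * (j + 1 : ℕ)) *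
        markCard n d X A B t v (R (t / n + 1) + 2 * δ (t / n) * i) ≤
      markCard n d X A B t v (R (t / n + 1) + 2 * δ (t / n) * (i + 1 : ℕ)) *
        markCard n d X A B t v (R (t / n + 1) + 2 * δ (t / n) * j)) ∧
    (∀ x < n, (A t x ↔ Free n X A t x ∧ Same A t v x ∧
      d v x ≤ R (t / n + 1) + 2 * δ (t / n) * j + δ (t / n))) ∧
    (∀ x < n, (B t x ↔ Free n X A t x ∧ Same A t v x ∧
      R (t / n + 1) + 2 * δ (t / n) * j < d v x ∧
      d v x ≤ R (t / n + 1) + 2 * δ (t / n) * (j + 1 : ℕ)))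

/-- Symmetric distances with the triangle inequality between the points below `n`. -/
structure IsDist (n : ℕ) (d : ℕ → ℕ → ℝ) : Prop where
  self : ∀ x < n, d x x = 0
  symm : ∀ x < n, ∀ y < n, d x y = d y x
  triangle : ∀ x < n, ∀ y < n, ∀ z < n, d x z ≤ d x y + d y z

/-- The scales decrease fast enough. -/
structure Scales (K Q : ℕ) (R δ : ℕ → ℝ) : Prop where
  nonneg : ∀ σ, 0 ≤ R σ
  delta_nonneg : ∀ σ, 0 ≤ δ σ
  le : ∀ σ < Q, R (σ + 1) + 2 * δ σ * K ≤ R σ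

namespace Carving

variable {n K Q : ℕ} {d : ℕ → ℕ → ℝ} {X : ℕ → Prop} {R δ : ℕ → ℝ} {A B : ℕ → ℕ → Prop}

/-- Points of one class have been in the same balls so far, so the points of `X` in a class are free
all together or not at all. -/
theorem free_of_same {t x y : ℕ} (hf : Free n X A t x)
    (hy : X y) (hs : Same A t x y) : Free n X A t y :=
  ⟨hy, fun s hst hns hA => hf.2 s hst hns ((hs s hst).2 hA)⟩

/-- Since `j ≤ K - 1`, the cut stays at least `δ` inside the outermost radius. This gain is what
`radius_sub_width` turns into a clean factor `8 * k`. -/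
theorem radius_le (hR : Scales K Q R δ) {σ j : ℕ} (hσ : σ < Q) (hj : j < K) :
    R (σ + 1) + 2 * δ σ * j + δ σ ≤ R σ - δ σ := by
  have h1 := hR.le σ hσ
  have h2 := hR.delta_nonneg σ
  have h3 : (j : ℝ) + 1 ≤ K := by exact_mod_cast hj
  nlinarith

open Classical in
/-- All points are carved in each round. -/
theorem card_free_le (h : Carving n K Q d X R δ A B) (hd : IsDist n d) (hR : Scales K Q R δ)
    {σ : ℕ} (hσ : σ < Q) {c : ℕ} (hc : c ≤ n) :
    #{x ∈ range n | X x ∧ ∀ s < n * σ + c, n * σ ≤ s → ¬ A s x} ≤ n - c := by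
  induction c with
  | zero => simpa using card_filter_le (range n) _
  | succ c ih =>
    have ih := ih (by omega)
    have hdiv : (n * σ + c) / n = σ := by
      rw [Nat.mul_add_div (by omega), Nat.div_eq_of_lt (by omega), add_zero]
    have hfree : ∀ x, Free n X A (n * σ + c) x ↔
        X x ∧ ∀ s < n * σ + c, n * σ ≤ s → ¬ A s x := by
      intro x; rw [Free, hdiv]
    have ht : n * σ + c < n * Q := by
      have := Nat.mul_le_mul_left n hσ
      rw [Nat.mul_succ] at this
      omega
    obtain ⟨v, j, hv, hj, hA, -⟩ := h.step _ ht
    have hsub : {x ∈ range n | X x ∧ ∀ s < n * σ + (c + 1), n * σ ≤ s → ¬ A s x} ⊆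
        {x ∈ range n | X x ∧ ∀ s < n * σ + c, n * σ ≤ s → ¬ A s x} := by
      intro x hx
      rw [mem_filter] at hx ⊢
      exact ⟨hx.1, hx.2.1, fun s hs => hx.2.2 s (by omega)⟩
    by_cases hex : ∃ x < n, Free n X A (n * σ + c) x
    · obtain ⟨hvn, hvf, -⟩ := hv hex
      -- The centre lies in its own ball, so as long as there are free points at least one of them
      -- is carved.
      have hAv : A (n * σ + c) v := by
        refine (hA v hvn).2 ⟨hvf, fun _ _ => Iff.rfl, ?_⟩
        rw [hd.self v hvn]
        have := hR.nonneg ((n * σ + c) / n + 1)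
        have := hR.delta_nonneg ((n * σ + c) / n)
        positivity
      have hlt := card_lt_card (_root_.ssubset_iff_subset_ne.2 ⟨hsub, fun heq => ?_⟩)
      · omega
      · have hmem : v ∈ {x ∈ range n | X x ∧ ∀ s < n * σ + c, n * σ ≤ s → ¬ A s x} :=
          mem_filter.2 ⟨mem_range.2 hvn, (hfree v).1 hvf⟩
        rw [← heq, mem_filter] at hmem
        exact hmem.2.2 _ (by omega) (by omega) hAv
    · have : {x ∈ range n | X x ∧ ∀ s < n * σ + (c + 1), n * σ ≤ s → ¬ A s x} = ∅ := by
        refine filter_eq_empty_iff.2 fun x hx hx' => hex ⟨x, mem_range.1 hx, (hfree x).2 ?_⟩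
        exact ⟨hx'.1, fun s hs => hx'.2 s (by omega)⟩
      rw [this, card_empty]
      exact Nat.zero_le _

/-- Each time step removes a free point while there is one, so the `n` steps of a round suffice for
all. -/
theorem exists_carved (h : Carving n K Q d X R δ A B) (hd : IsDist n d) (hR : Scales K Q R δ)
    {σ : ℕ} (hσ : σ < Q) {x : ℕ} (hx : X x) (hxn : x < n) :
    ∃ s, n * σ ≤ s ∧ s < n * (σ + 1) ∧ A s x := by
  classical
  have h0 := h.card_free_le hd hR hσ (c := n) le_rfl
  rw [Nat.sub_self, Nat.le_zero, card_eq_zero, filter_eq_empty_iff] at h0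
  have := h0 (mem_range.2 hxn)
  by_contra hcon
  push Not at hcon
  exact this ⟨hx, fun s hs hns hA => hcon s hns (by rw [Nat.mul_succ]; exact hs) hA⟩

/-- Points that are not separated by the rounds `0, …, σ` are close to each other. -/
theorem dist_le_of_same (h : Carving n K Q d X R δ A B) (hd : IsDist n d) (hR : Scales K Q R δ)
    {σ : ℕ} (hσ : σ < Q) {x y : ℕ} (hx : X x) (hxn : x < n) (hyn : y < n)
    (hs : Same A (n * (σ + 1)) x y) : d x y ≤ 2 * (R σ - δ σ) := by
  obtain ⟨s, hs1, hs2, hAx⟩ := h.exists_carved hd hR hσ hx hxn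
  have hAy := (hs s hs2).1 hAx
  have hn : 0 < n := by omega
  have hdiv : s / n = σ := by
    rw [Nat.div_eq_iff hn]
    rw [Nat.mul_succ] at hs2
    rw [mul_comm σ n]
    omega
  have hsQ : s < n * Q := hs2.trans_le (Nat.mul_le_mul_left n hσ)
  obtain ⟨v, j, hv, hj, hA, -⟩ := h.step s hsQ
  -- Both points lie in the ball carved at time `s`, so their distance is at most twice its radius.
  have hx' := (hA x hxn).1 hAx
  have hy' := (hA y hyn).1 hAy
  have hvn := (hv ⟨x, hxn, hx'.1⟩).1
  rw [hdiv] at hx' hy'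
  have hr := radius_le hR hσ hj.1
  have h1 := hd.triangle x hxn v hvn y hyn
  rw [hd.symm x hxn v hvn] at h1
  linarith [hx'.2.2, hy'.2.2]

/-- A point that stays marked is not separated from the points near it. -/
theorem same_of_marked (h : Carving n K Q d X R δ A B) (hd : IsDist n d) {t : ℕ} (ht : t ≤ n * Q)
    {x y : ℕ} (hx : X x) (hxn : x < n) (hy : Marked X B (n * Q) y) (hyn : y < n)
    (hδ : ∀ s < t, d x y ≤ δ (s / n)) : Same A t x y := by
  induction t with
  | zero => intro s hs; omega
  | succ t ih =>
    have ih := ih (by omega) fun s hs => hδ s (by omega)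
    refine same_succ.2 ⟨ih, ?_⟩
    obtain ⟨v, j, hv, hj, hA, hB⟩ := h.step t ht
    have hyB := hy.2 t ht
    rw [hB y hyn] at hyB
    rw [hA x hxn, hA y hyn]
    have hdt := hδ t (Nat.lt_succ_self t)
    have key : ∀ v, v < n → d v x ≤ d v y + d x y ∧ d v y ≤ d v x + d x y := by
      intro v hvn
      have h1 := hd.triangle v hvn x hxn y hyn
      have h2 := hd.triangle v hvn y hyn x hxn
      rw [hd.symm y hyn x hxn] at h2
      exact ⟨h2, h1⟩
    have hcast : ((j + 1 : ℕ) : ℝ) = j + 1 := by push_cast; ring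
    rw [hcast] at hyB
    have hsym := (Same.equivalence A t).symm ih
    constructor
    · rintro ⟨hf, hvx, hle⟩
      have hfy := free_of_same hf hy.1 ih
      have hvy := (Same.equivalence A t).trans hvx ih
      obtain ⟨hvn, -⟩ := hv ⟨x, hxn, hf⟩
      refine ⟨hfy, hvy, ?_⟩
      -- The cut runs in the middle of an annulus of width `2 * δ`. With `x` inside and `y` outside,
      -- `y` would be within `δ` of the cut and would lose its mark.
      by_contra hcon
      refine hyB ⟨hfy, hvy, ?_, ?_⟩
      · have : 0 ≤ d x y := by
          have h1 := hd.triangle x hxn y hyn x hxn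
          rw [hd.self x hxn, hd.symm y hyn x hxn] at h1
          linarith
        linarith [key v hvn]
      · have := (key v hvn).2
        linarith
    · rintro ⟨hf, hvy, hle⟩
      have hfx := free_of_same hf hx hsym
      have hvx := (Same.equivalence A t).trans hvy hsym
      obtain ⟨hvn, -⟩ := hv ⟨y, hyn, hf⟩
      refine ⟨hfx, hvx, ?_⟩
      by_contra hcon
      have h1 := (key v hvn).1
      refine hyB ⟨hf, hvy, ?_, ?_⟩
      · linarith
      · have h2 : 0 ≤ d x y := by
          have h1 := hd.triangle x hxn y hyn x hxn
          rw [hd.self x hxn, hd.symm y hyn x hxn] at h1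
          linarith
        linarith

/-! ### The potential in the course of a carving -/

open Classical in
/-- The set of the points of `X`. -/
noncomputable def pts (n : ℕ) (X : ℕ → Prop) : Finset ℕ := {x ∈ range n | X x}

theorem mem_pts {x : ℕ} : x ∈ pts n X ↔ x < n ∧ X x := by simp [pts]

open Classical in
/-- The radius of the balls that count at time `t` of round `σ`. -/
noncomputable def radAt (n : ℕ) (R : ℕ → ℝ) (A : ℕ → ℕ → Prop) (σ t x : ℕ) : ℝ :=
  if ∃ s, n * σ ≤ s ∧ s < t ∧ A s x then R (σ + 1) else R σ

theorem markCard_eq (t u : ℕ) (r : ℝ) :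
    markCard n d X A B t u r = ballCard d (pts n (Marked X B t)) (Same A t) u r := by
  classical
  rw [markCard, ballCard, pts, filter_filter]
  congr 1
  ext z
  simp only [mem_filter, and_assoc]

theorem pts_marked_subset (t : ℕ) : pts n (Marked X B t) ⊆ pts n X := by
  intro x hx
  rw [mem_pts] at hx ⊢
  exact ⟨hx.1, hx.2.1⟩

/-- If a free point is left, this is `potential_carve` with inner radius `R (σ + 1)`: the class of
the centre is free as a whole, so its points still have radius `R σ`. Otherwise nothing changes. -/
theorem potential_step (h : Carving n K Q d X R δ A B) (hd : IsDist n d) (hR : Scales K Q R δ)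
    {σ c : ℕ} (hσ : σ < Q) (hc : c < n) :
    potential d K (pts n X) (pts n (Marked X B (n * σ + c))) (Same A (n * σ + c))
      (radAt n R A σ (n * σ + c)) ≤
    potential d K (pts n X) (pts n (Marked X B (n * σ + c + 1))) (Same A (n * σ + c + 1))
      (radAt n R A σ (n * σ + c + 1)) := by
  have hdiv : (n * σ + c) / n = σ := by
    rw [Nat.mul_add_div (by omega), Nat.div_eq_of_lt (by omega), add_zero]
  have ht : n * σ + c < n * Q := by
    have := Nat.mul_le_mul_left n hσ
    rw [Nat.mul_succ] at this
    omega
  obtain ⟨v, j, hv, ⟨hj, hmin⟩, hA, hB⟩ := h.step _ ht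
  rw [hdiv] at hv hmin hA hB
  set t := n * σ + c with htdef
  have hfree : ∀ x, Free n X A t x ↔ X x ∧ ¬ ∃ s, n * σ ≤ s ∧ s < t ∧ A s x := by
    intro x
    rw [Free, hdiv]
    push Not
    exact and_congr_right fun _ => ⟨fun h s h1 h2 => h s h2 h1, fun h s h1 h2 => h s h2 h1⟩
  classical
  have hrad_succ : ∀ x, radAt n R A σ (t + 1) x =
      if A t x then R (σ + 1) else radAt n R A σ t x := by
    intro x
    by_cases hAx : A t x
    · rw [if_pos hAx, radAt, if_pos ⟨t, by omega, by omega, hAx⟩]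
    · rw [if_neg hAx, radAt, radAt]
      congr 1
      refine propext ⟨?_, ?_⟩
      · rintro ⟨s, h1, h2, h3⟩
        rcases Nat.lt_succ_iff_lt_or_eq.1 h2 with h4 | rfl
        · exact ⟨s, h1, h4, h3⟩
        · exact absurd h3 hAx
      · rintro ⟨s, h1, h2, h3⟩
        exact ⟨s, h1, by omega, h3⟩
  have hmarked : ∀ x, x ∈ pts n (Marked X B (t + 1)) ↔ x ∈ pts n (Marked X B t) ∧ ¬ B t x := by
    intro x
    rw [mem_pts, mem_pts, Marked, Marked]
    constructor
    · rintro ⟨h1, h2, h3⟩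
      exact ⟨⟨h1, h2, fun s hs => h3 s (by omega)⟩, h3 t (by omega)⟩
    · rintro ⟨⟨h1, h2, h3⟩, h4⟩
      refine ⟨h1, h2, fun s hs => ?_⟩
      rcases Nat.lt_succ_iff_lt_or_eq.1 hs with h5 | rfl
      · exact h3 s h5
      · exact h4
  by_cases hex : ∃ x < n, Free n X A t x
  · obtain ⟨hvn, hvf, hmax⟩ := hv hex
    have hclass : ∀ u ∈ pts n X, Same A t v u → Free n X A t u :=
      fun u hu hs => free_of_same hvf (mem_pts.1 hu).2 hs
    simp only [markCard_eq] at hmax hmin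
    refine potential_carve (v := v) (j := j) (R := R σ) (r0 := R (σ + 1)) (δ := δ σ) (A := A t)
      (Same.equivalence A t) (pts_marked_subset t) (mem_pts.2 ⟨hvn, hvf.1⟩) ?_ ?_ ?_ ?_
      (hR.nonneg _) (hR.delta_nonneg _) (hR.le σ hσ) hj hmin ?_ ?_ ?_ ?_ ?_
    · intro u _
      rw [radAt]
      split_ifs
      · exact hR.nonneg _
      · exact hR.nonneg _
    · exact fun u hu => hd.self u (mem_pts.1 hu).1
    · intro u hu hs
      rw [radAt, if_neg ((hfree u).1 (hclass u hu hs)).2]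
    · exact fun u hu hs => hmax u (mem_pts.1 hu).1 (hclass u hu hs)
    · intro x hx
      rw [hA x (mem_pts.1 hx).1]
      exact ⟨fun h => h.2, fun h => ⟨hclass x hx h.1, h⟩⟩
    · intro x
      rw [hmarked]
      refine and_congr_right fun hx => not_congr ?_
      have hxX := pts_marked_subset t hx
      rw [hB x (mem_pts.1 hxX).1]
      exact ⟨fun h => h.2, fun h => ⟨hclass x hxX h.1, h⟩⟩
    · exact fun x _ y _ => same_succ
    · intro x _ hx
      rw [hrad_succ, if_pos hx]
    · intro x _ hx
      rw [hrad_succ, if_neg hx]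
  · have hnA : ∀ x < n, ¬ A t x := fun x hx hAx => hex ⟨x, hx, ((hA x hx).1 hAx).1⟩
    have hnB : ∀ x < n, ¬ B t x := fun x hx hBx => hex ⟨x, hx, ((hB x hx).1 hBx).1⟩
    refine (potential_congr (pts_marked_subset t) ?_ ?_ ?_).ge
    · ext x
      rw [hmarked]
      exact ⟨fun h => h.1, fun h => ⟨h, hnB x (mem_pts.1 h).1⟩⟩
    · intro x hx y hy
      rw [same_succ]
      exact ⟨fun h => h.1, fun h => ⟨h, iff_of_false (hnA x (mem_pts.1 hx).1)
        (hnA y (mem_pts.1 hy).1)⟩⟩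
    · intro x hx
      rw [hrad_succ, if_neg (hnA x (mem_pts.1 hx).1)]

theorem potential_round (h : Carving n K Q d X R δ A B) (hd : IsDist n d) (hR : Scales K Q R δ)
    {σ c : ℕ} (hσ : σ < Q) (hc : c ≤ n) :
    potential d K (pts n X) (pts n (Marked X B (n * σ))) (Same A (n * σ)) (fun _ => R σ) ≤
    potential d K (pts n X) (pts n (Marked X B (n * σ + c))) (Same A (n * σ + c))
      (radAt n R A σ (n * σ + c)) := by
  induction c with
  | zero =>
    refine (potential_congr (pts_marked_subset _) rfl (fun _ _ _ _ => Iff.rfl) ?_).ge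
    intro x _
    rw [radAt, if_neg]
    rintro ⟨s, h1, h2, -⟩
    omega
  | succ c ih => exact (ih (by omega)).trans (h.potential_step hd hR hσ hc)

/-- Many points stay marked. -/
theorem le_card_marked (h : Carving n K Q d X R δ A B) (hd : IsDist n d) (hR : Scales K Q R δ) :
    (#(pts n X) : ℝ) * (#(pts n X) : ℝ) ^ (-(1 / K : ℝ)) ≤ #(pts n (Marked X B (n * Q))) := by
  have hself : ∀ σ, ∀ u ∈ pts n X, d u u ≤ R σ := fun σ u hu => by
    rw [hd.self u (mem_pts.1 hu).1]; exact hR.nonneg σ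
  have key : ∀ σ ≤ Q, potential d K (pts n X) (pts n (Marked X B 0)) (Same A 0) (fun _ => R 0) ≤
      potential d K (pts n X) (pts n (Marked X B (n * σ))) (Same A (n * σ)) (fun _ => R σ) := by
    intro σ
    induction σ with
    | zero => intro _; exact le_rfl
    | succ σ ih =>
      intro hσ
      refine (ih (by omega)).trans ((h.potential_round hd hR hσ le_rfl).trans ?_)
      -- At the end of a round every point has been carved, so all radii are `R (σ + 1)`, the
      -- uniform radius with which the next round begins.
      refine (potential_congr (pts_marked_subset _) rfl (fun _ _ _ _ => Iff.rfl) ?_).ge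
      intro x hx
      obtain ⟨s, h1, h2, h3⟩ := h.exists_carved hd hR hσ (mem_pts.1 hx).2 (mem_pts.1 hx).1
      rw [radAt, if_pos ⟨s, h1, h2, h3⟩]
  have h0 : pts n (Marked X B 0) = pts n X := by
    ext x
    simp [mem_pts, Marked]
  have h1 := le_potential (K := K) (d := d) (X := pts n X) (E := Same A 0) (rad := fun _ => R 0)
    (fun x => (Same.equivalence A 0).refl x) (hself 0)
  have h2 := key Q le_rfl
  rw [h0] at h2
  exact h1.trans (h2.trans (potential_le_card (pts_marked_subset _)
    (fun x => (Same.equivalence A _).refl x) (hself Q)))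

end Carving

end DistanceOracle

namespace DistanceOracle

open Finset RAM

/-! ### Families of carvings -/

/-- The carvings `0, 1, …`, where carving `i` is for the points `X i` that have not stayed marked in
any of the carvings before. -/
structure Family (n K Q : ℕ) (d : ℕ → ℕ → ℝ) (R δ : ℕ → ℝ) (X : ℕ → ℕ → Prop)
    (A B : ℕ → ℕ → ℕ → Prop) : Prop where
  carving : ∀ i < n, Carving n K Q d (X i) R δ (A i) (B i)
  mem_iff : ∀ i ≤ n, ∀ x < n, (X i x ↔ ∀ i' < i, ∃ t < n * Q, B i' t x)

/-- The number of the carving in which `x` stays marked. -/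
noncomputable def level (n Q : ℕ) (B : ℕ → ℕ → ℕ → Prop) (x : ℕ) : ℕ :=
  least n fun i => ¬ ∃ t < n * Q, B i t x

namespace Family

variable {n K Q : ℕ} {d : ℕ → ℕ → ℝ} {R δ : ℕ → ℝ} {X : ℕ → ℕ → Prop} {A B : ℕ → ℕ → ℕ → Prop}

/-- The sets `X i` are nested: a point drops out right after the first carving in which it stays
marked. -/
theorem mem_iff_le_level (h : Family n K Q d R δ X A B) {i x : ℕ} (hi : i ≤ n) (hx : x < n) :
    X i x ↔ i ≤ level n Q B x := by
  rw [h.mem_iff i hi x hx]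
  constructor
  · intro hall
    by_contra hlt
    push Not at hlt
    have hex : ∃ i < n, ¬ ∃ t < n * Q, B i t x := by
      by_contra hno
      push Not at hno
      have : level n Q B x = n := least_of_forall_not fun i hi => not_not.2 (hno i hi)
      omega
    exact (least_spec hex).2.1 (hall _ hlt)
  · intro hle i' hi'
    have := not_of_lt_least (hi'.trans_le hle)
    simpa using this

theorem marked_iff (h : Family n K Q d R δ X A B) {i x : ℕ} (hi : i < n) (hx : x < n) :
    Marked (X i) (B i) (n * Q) x ↔ level n Q B x = i := by
  rw [Marked, h.mem_iff_le_level hi.le hx]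
  constructor
  · rintro ⟨h1, h2⟩
    refine le_antisymm ?_ h1
    by_contra hlt
    push Not at hlt
    have := not_of_lt_least (P := fun i => ¬ ∃ t < n * Q, B i t x) hlt
    rw [not_not] at this
    obtain ⟨t, ht, hB⟩ := this
    exact h2 t ht hB
  · intro heq
    refine ⟨heq.ge, fun t ht hB => ?_⟩
    have hex : ∃ i < n, ¬ ∃ t < n * Q, B i t x := by
      by_contra hno
      push Not at hno
      have : level n Q B x = n := least_of_forall_not fun i hi => not_not.2 (hno i hi)
      omega
    have := (least_spec hex).2.1
    change ¬ ∃ t < n * Q, B (level n Q B x) t x at this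
    rw [heq] at this
    exact this ⟨t, ht, hB⟩

variable (hd : IsDist n d) (hR : Scales K Q R δ) (hK : 0 < K)
include hd hR hK

/-- For `a` points of which `b` stay marked, `le_card_marked` gives `a ≤ b * a ^ (1 / K)`, and `a ≤
n`. -/
theorem card_pts_le (h : Family n K Q d R δ X A B) {i : ℕ} (hi : i < n) :
    (#(Carving.pts n (X i)) : ℝ) ≤
      (n : ℝ) ^ (1 / K : ℝ) * #(Carving.pts n (Marked (X i) (B i) (n * Q))) := by
  have h1 := (h.carving i hi).le_card_marked hd hR
  set a := #(Carving.pts n (X i)) with ha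
  set b := #(Carving.pts n (Marked (X i) (B i) (n * Q)))
  have han : a ≤ n := by
    simpa using card_le_card (fun x hx => mem_range.2 (Carving.mem_pts.1 hx).1 :
      Carving.pts n (X i) ⊆ range n)
  rcases Nat.eq_zero_or_pos a with h0 | h0
  · rw [h0]; simp only [Nat.cast_zero]; positivity
  have ha0 : (0 : ℝ) < a := by exact_mod_cast h0
  have h2 : (0 : ℝ) < (a : ℝ) ^ (1 / K : ℝ) := Real.rpow_pos_of_pos ha0 _
  have h3 : (a : ℝ) ^ (1 / K : ℝ) ≤ (n : ℝ) ^ (1 / K : ℝ) :=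
    Real.rpow_le_rpow ha0.le (by exact_mod_cast han) (by positivity)
  rw [Real.rpow_neg ha0.le, ← div_eq_mul_inv, div_le_iff₀ h2] at h1
  calc (a : ℝ) ≤ b * (a : ℝ) ^ (1 / K : ℝ) := h1
    _ ≤ b * (n : ℝ) ^ (1 / K : ℝ) := mul_le_mul_of_nonneg_left h3 (Nat.cast_nonneg _)
    _ = _ := mul_comm _ _

/-- By `card_pts_le` a carving of a nonempty set keeps some point marked, and this point is not
carved again. Hence `n` carvings use up all points. -/
theorem card_pts_le_sub (h : Family n K Q d R δ X A B) {i : ℕ} (hi : i ≤ n) :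
    #(Carving.pts n (X i)) ≤ n - i := by
  induction i with
  | zero =>
    simpa using card_le_card (fun x hx => mem_range.2 (Carving.mem_pts.1 hx).1 :
      Carving.pts n (X 0) ⊆ range n)
  | succ i ih =>
    have ih := ih (by omega)
    have hsub : Carving.pts n (X (i + 1)) ⊆ Carving.pts n (X i) := by
      intro x hx
      rw [Carving.mem_pts] at hx ⊢
      refine ⟨hx.1, ?_⟩
      rw [h.mem_iff_le_level hi hx.1] at hx
      rw [h.mem_iff_le_level (by omega) hx.1]
      omega
    rcases Nat.eq_zero_or_pos #(Carving.pts n (X i)) with h0 | h0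
    · have := card_le_card hsub
      omega
    · have h1 := h.card_pts_le hd hR hK (i := i) (by omega)
      have h2 : 0 < #(Carving.pts n (Marked (X i) (B i) (n * Q))) := by
        by_contra h3
        have h4 : #(Carving.pts n (Marked (X i) (B i) (n * Q))) = 0 := by omega
        rw [h4, Nat.cast_zero, mul_zero] at h1
        have : (0 : ℝ) < #(Carving.pts n (X i)) := by exact_mod_cast h0
        linarith
      obtain ⟨y, hy⟩ := card_pos.1 h2
      have hyn := (Carving.mem_pts.1 hy).1
      rw [Carving.mem_pts, h.marked_iff (by omega) hyn] at hy
      have hlt := card_lt_card (_root_.ssubset_iff_subset_ne.2 ⟨hsub, fun heq => ?_⟩)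
      · omega
      · have hmem : y ∈ Carving.pts n (X i) := Carving.mem_pts.2
          ⟨hy.1, (h.mem_iff_le_level (by omega) hy.1).2 hy.2.ge⟩
        rw [← heq, Carving.mem_pts, h.mem_iff_le_level hi hy.1] at hmem
        omega

theorem level_lt (h : Family n K Q d R δ X A B) {x : ℕ} (hx : x < n) : level n Q B x < n := by
  have h0 := h.card_pts_le_sub hd hR hK (i := n) le_rfl
  rw [Nat.sub_self, Nat.le_zero, card_eq_zero] at h0
  by_contra hle
  have : x ∈ Carving.pts n (X n) :=
    Carving.mem_pts.2 ⟨hx, (h.mem_iff_le_level le_rfl hx).2 (by omega)⟩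
  rw [h0] at this
  exact notMem_empty _ this

/-- Double counting: the left side is the total size of the sets `X i`. Each of them is at most `n ^
(1 / K)` times the number of points that stay marked in it, and no point stays marked twice. -/
theorem sum_level_le (h : Family n K Q d R δ X A B) :
    (∑ x ∈ range n, (level n Q B x + 1 : ℕ) : ℝ) ≤ (n : ℝ) ^ (1 / K : ℝ) * n := by
  classical
  have h1 : ∀ x ∈ range n, level n Q B x + 1 = ∑ i ∈ range n, if X i x then 1 else 0 := by
    intro x hx
    have hx := mem_range.1 hx
    have hl := h.level_lt hd hR hK hx
    have : ∀ i ∈ range n, (if X i x then 1 else 0) = if i < level n Q B x + 1 then 1 else 0 := by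
      intro i hi
      have hi := mem_range.1 hi
      congr 1
      rw [h.mem_iff_le_level hi.le hx, Nat.lt_succ_iff]
    rw [sum_congr rfl this, ← sum_filter, sum_const, smul_eq_mul, mul_one]
    have : (range n).filter (fun i => i < level n Q B x + 1) = range (level n Q B x + 1) := by
      ext i; simp only [mem_filter, mem_range]; omega
    rw [this, card_range]
  have h2 : ∑ x ∈ range n, (level n Q B x + 1) = ∑ i ∈ range n, #(Carving.pts n (X i)) := by
    rw [sum_congr rfl h1, sum_comm]
    refine sum_congr rfl fun i _ => ?_
    rw [Carving.pts, card_filter]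
  have h3 : ∑ i ∈ range n, #(Carving.pts n (Marked (X i) (B i) (n * Q))) ≤ n := by
    have h4 : ∀ i ∈ range n, #(Carving.pts n (Marked (X i) (B i) (n * Q))) =
        ∑ x ∈ range n, if level n Q B x = i then 1 else 0 := by
      intro i hi
      rw [Carving.pts, card_filter]
      refine sum_congr rfl fun x hx => ?_
      simp only [h.marked_iff (mem_range.1 hi) (mem_range.1 hx)]
    rw [sum_congr rfl h4, sum_comm]
    calc ∑ x ∈ range n, ∑ i ∈ range n, (if level n Q B x = i then 1 else 0)
        ≤ ∑ x ∈ range n, 1 := sum_le_sum fun x _ => by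
          rw [sum_ite_eq]; split_ifs <;> omega
      _ = n := by simp
  calc (∑ x ∈ range n, (level n Q B x + 1 : ℕ) : ℝ)
      = ∑ i ∈ range n, (#(Carving.pts n (X i)) : ℝ) := by exact_mod_cast h2
    _ ≤ ∑ i ∈ range n, (n : ℝ) ^ (1 / K : ℝ) *
        #(Carving.pts n (Marked (X i) (B i) (n * Q))) :=
        sum_le_sum fun i hi => h.card_pts_le hd hR hK (mem_range.1 hi)
    _ = (n : ℝ) ^ (1 / K : ℝ) *
        (∑ i ∈ range n, #(Carving.pts n (Marked (X i) (B i) (n * Q))) : ℕ) := by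
        rw [← mul_sum]; push_cast; rfl
    _ ≤ _ := mul_le_mul_of_nonneg_left (by exact_mod_cast h3) (by positivity)

end Family

/-! ### Leaves in lexicographic order -/

/-- The first `W` letters of `a` are lexicographically smaller than those of `b`. -/
def LexLt (W : ℕ) (a b : ℕ → ℕ) : Prop := ∃ s < W, (∀ r < s, a r = b r) ∧ a s < b s

theorem LexLt.trans {W : ℕ} {a b c : ℕ → ℕ} (h : LexLt W a b) (h' : LexLt W b c) :
    LexLt W a c := by
  obtain ⟨s, hs, h1, h2⟩ := h
  obtain ⟨s', hs', h1', h2'⟩ := h'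
  rcases lt_trichotomy s s' with hlt | rfl | hlt
  · exact ⟨s, hs, fun r hr => (h1 r hr).trans (h1' r (hr.trans hlt)), (h1' s hlt) ▸ h2⟩
  · exact ⟨s, hs, fun r hr => (h1 r hr).trans (h1' r hr), h2.trans h2'⟩
  · exact ⟨s', hs', fun r hr => (h1 r (hr.trans hlt)).trans (h1' r hr), (h1 s' hlt) ▸ h2'⟩

theorem LexLt.irrefl {W : ℕ} {a : ℕ → ℕ} : ¬ LexLt W a a := fun ⟨_, _, _, h⟩ => lt_irrefl _ h

theorem LexLt.total {W : ℕ} {a b : ℕ → ℕ} (h : ∃ s < W, a s ≠ b s) : LexLt W a b ∨ LexLt W b a := by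
  obtain ⟨h1, h2, h3⟩ := least_spec h
  have h4 : ∀ r < least W (fun s => a s ≠ b s), a r = b r := fun r hr => not_not.1 (h3 r hr)
  rcases lt_or_gt_of_ne h2 with h5 | h5
  · exact .inl ⟨_, h1, h4, h5⟩
  · exact .inr ⟨_, h1, fun r hr => (h4 r hr).symm, h5⟩

/-- A word between two words with a common prefix has the same prefix. -/
theorem LexLt.prefix_eq {W t : ℕ} {a b c : ℕ → ℕ} (hab : LexLt W a b) (hbc : LexLt W b c)
    (ht : ∀ r < t, a r = c r) : ∀ r < t, a r = b r := by
  intro r hr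
  by_contra hne
  obtain ⟨s, hs, h1, h2⟩ := hab
  obtain ⟨s', hs', h1', h2'⟩ := hbc
  have hsr : s ≤ r := by
    by_contra hlt
    exact hne (h1 r (by omega))
  have hst := ht s (by omega)
  rcases lt_trichotomy s s' with hlt | rfl | hlt
  · have := h1' s hlt; omega
  · omega
  · have h3 := h1 s' hlt
    have h4 := ht s' (by omega)
    omega

/-- The elements `e < L` have different words `c e`. -/
structure Words (W L : ℕ) (c : ℕ → ℕ → ℕ) : Prop where
  inj : ∀ e < L, ∀ e' < L, e ≠ e' → ∃ s < W, c e s ≠ c e' s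

/-- The position of an element in the lexicographic order. -/
noncomputable def position (W L : ℕ) (c : ℕ → ℕ → ℕ) (e : ℕ) : ℕ :=
  open Classical in #{e' ∈ range L | LexLt W (c e') (c e)}

/-- The element at a position. -/
noncomputable def leafAt (W L : ℕ) (c : ℕ → ℕ → ℕ) (p : ℕ) : ℕ :=
  least L fun e => position W L c e = p

namespace Words

variable {W L : ℕ} {c : ℕ → ℕ → ℕ}

theorem position_lt (e : ℕ) (he : e < L) : position W L c e < L := by
  classical
  have h1 : ({e' ∈ range L | LexLt W (c e') (c e)} : Finset ℕ) ⊂ range L := by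
    refine (ssubset_iff_of_subset (filter_subset _ _)).2 ⟨e, mem_range.2 he, fun h => ?_⟩
    exact LexLt.irrefl (mem_filter.1 h).2
  simpa [position] using card_lt_card h1

theorem position_mono {e e' : ℕ} (he : e < L) (h : LexLt W (c e) (c e')) :
    position W L c e < position W L c e' := by
  classical
  refine card_lt_card ((ssubset_iff_of_subset fun x hx => ?_).2
    ⟨e, mem_filter.2 ⟨mem_range.2 he, h⟩, fun h' => LexLt.irrefl (mem_filter.1 h').2⟩)
  rw [mem_filter] at hx ⊢
  exact ⟨hx.1, hx.2.trans h⟩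

theorem position_lt_iff (h : Words W L c) {e e' : ℕ} (he : e < L) (he' : e' < L) :
    position W L c e < position W L c e' ↔ LexLt W (c e) (c e') := by
  refine ⟨fun hlt => ?_, position_mono he⟩
  have hne : e ≠ e' := by rintro rfl; exact lt_irrefl _ hlt
  rcases LexLt.total (h.inj e he e' he' hne) with h1 | h1
  · exact h1
  · exact absurd (position_mono he' h1) (by omega)

theorem position_inj (h : Words W L c) {e e' : ℕ} (he : e < L) (he' : e' < L)
    (heq : position W L c e = position W L c e') : e = e' := by
  by_contra hne
  rcases LexLt.total (h.inj e he e' he' hne) with h1 | h1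
  · exact absurd (position_mono he h1) (by omega)
  · exact absurd (position_mono he' h1) (by omega)

/-- `position` maps the numbers below `L` injectively into themselves, hence onto themselves. -/
theorem leafAt_spec (h : Words W L c) {p : ℕ} (hp : p < L) :
    leafAt W L c p < L ∧ position W L c (leafAt W L c p) = p := by
  classical
  have himg : (range L).image (position W L c) = range L := by
    refine eq_of_subset_of_card_le ?_ ?_
    · intro q hq
      obtain ⟨e, he, rfl⟩ := mem_image.1 hq
      exact mem_range.2 (position_lt e (mem_range.1 he))
    · rw [card_image_of_injOn]
      intro e he e' he' heq
      exact h.position_inj (mem_range.1 he) (mem_range.1 he') heq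
  have hmem : p ∈ (range L).image (position W L c) := by rw [himg]; exact mem_range.2 hp
  obtain ⟨e, he, hep⟩ := mem_image.1 hmem
  have := least_spec (m := L) (P := fun e => position W L c e = p) ⟨e, mem_range.1 he, hep⟩
  exact ⟨this.1, this.2.1⟩

theorem leafAt_position (h : Words W L c) {e : ℕ} (he : e < L) :
    leafAt W L c (position W L c e) = e := by
  have := h.leafAt_spec (position_lt (W := W) (c := c) e he)
  exact h.position_inj this.1 he this.2

end Words

/-- `g p` is the diameter of the class of the leaf at `p` when it is separated from the next leaf. -/
structure Gaps (W L : ℕ) (c : ℕ → ℕ → ℕ) (D : ℕ → ℕ → ℝ) (g : ℕ → ℝ) : Prop where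
  words : Words W L c
  gap : ∀ p, p + 1 < L → ∃ s,
    (∀ r < s, c (leafAt W L c p) r = c (leafAt W L c (p + 1)) r) ∧
    c (leafAt W L c p) s ≠ c (leafAt W L c (p + 1)) s ∧
    (∀ e < L, ∀ e' < L, (∀ r < s, c (leafAt W L c p) r = c e r) →
      (∀ r < s, c (leafAt W L c p) r = c e' r) → D e e' ≤ g p) ∧
    ∃ e < L, ∃ e' < L, (∀ r < s, c (leafAt W L c p) r = c e r) ∧
      (∀ r < s, c (leafAt W L c p) r = c e' r) ∧ g p = D e e'

namespace Gaps

variable {W L : ℕ} {c : ℕ → ℕ → ℕ} {D : ℕ → ℕ → ℝ} {g : ℕ → ℝ}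

/-- Take the `p` in between whose two neighbours part earliest. All leaves of the interval agree
before that letter, so both ends belong to the class with diameter `g p`. -/
theorem exists_le (h : Gaps W L c D g) {e e' : ℕ} (he : e < L) (he' : e' < L)
    (hlt : position W L c e < position W L c e') :
    ∃ p, position W L c e ≤ p ∧ p < position W L c e' ∧ D e e' ≤ g p := by
  classical
  set a := position W L c e with ha
  set b := position W L c e' with hb
  have hbL : b < L := Words.position_lt e' he'
  choose! s hs1 hs2 hs3 hs4 using h.gap
  obtain ⟨p, hp, hmin⟩ := exists_min_image (Ico a b) s ⟨a, mem_Ico.2 ⟨le_rfl, hlt⟩⟩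
  have hp' := mem_Ico.1 hp
  have hall : ∀ q, a ≤ q → q ≤ b → ∀ r < s p, c (leafAt W L c a) r = c (leafAt W L c q) r := by
    intro q hq
    induction q, hq using Nat.le_induction with
    | base => intros; rfl
    | succ q hq ih =>
      intro hqb r hr
      rw [ih (by omega) r hr]
      exact hs1 q (by omega) r (hr.trans_le (hmin q (mem_Ico.2 ⟨hq, by omega⟩)))
  refine ⟨p, hp'.1, hp'.2, hs3 p (by omega) e he e' he' ?_ ?_⟩
  · intro r hr
    rw [← hall p hp'.1 hp'.2.le r hr, ha, h.words.leafAt_position he]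
  · intro r hr
    rw [← hall p hp'.1 hp'.2.le r hr, hall b hlt.le le_rfl r hr, hb, h.words.leafAt_position he']

/-- All words between two words with a common prefix share it (`LexLt.prefix_eq`). So neighbours in
between part no earlier than `t`, and the class measured by `g p` lies inside the class of the
prefix. -/
theorem le_of_class (h : Gaps W L c D g) {e e' t : ℕ} {Δ : ℝ} (he : e < L) (he' : e' < L)
    (ht : ∀ r < t, c e r = c e' r)
    (hΔ : ∀ e₁ < L, ∀ e₂ < L, (∀ r < t, c e r = c e₁ r) → (∀ r < t, c e r = c e₂ r) →
      D e₁ e₂ ≤ Δ)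
    {p : ℕ} (hp : position W L c e ≤ p) (hp' : p < position W L c e') : g p ≤ Δ := by
  have hbL : position W L c e' < L := Words.position_lt e' he'
  have hbetween : ∀ q, position W L c e ≤ q → q ≤ position W L c e' →
      ∀ r < t, c e r = c (leafAt W L c q) r := by
    intro q hq hq'
    obtain ⟨h1, h2⟩ := h.words.leafAt_spec (p := q) (by omega)
    rcases eq_or_lt_of_le hq with rfl | hq
    · intro r _; rw [h.words.leafAt_position he]
    rcases eq_or_lt_of_le hq' with rfl | hq'
    · intro r hr; rw [h.words.leafAt_position he']; exact ht r hr
    refine LexLt.prefix_eq (W := W) ((h.words.position_lt_iff he h1).1 (by omega))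
      ((h.words.position_lt_iff h1 he').1 (by omega)) ht
  obtain ⟨s, hs1, hs2, hs3, e₁, he₁, e₂, he₂, hc₁, hc₂, hg⟩ := h.gap p (by omega)
  have hst : t ≤ s := by
    by_contra hlt
    push Not at hlt
    exact hs2 ((hbetween p hp hp'.le s hlt).symm.trans (hbetween (p + 1) (by omega) hp' s hlt))
  rw [hg]
  refine hΔ e₁ he₁ e₂ he₂ (fun r hr => ?_) fun r hr => ?_
  · exact (hbetween p hp hp'.le r hr).trans (hc₁ r (hr.trans_le hst))
  · exact (hbetween p hp hp'.le r hr).trans (hc₂ r (hr.trans_le hst))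

end Gaps

end DistanceOracle

namespace DistanceOracle

open Finset RAM

/-! ### Range maxima -/

/-- `v` is the largest value of `h` on the interval from `p` to `q`. -/
def IsMax (h : ℕ → ℝ) (v : ℝ) (p q : ℕ) : Prop :=
  (∃ r, p ≤ r ∧ r ≤ q ∧ v = h r) ∧ ∀ r, p ≤ r → r ≤ q → h r ≤ v

theorem IsMax.max {h : ℕ → ℝ} {v w : ℝ} {p q p' q' a b : ℕ} (hv : IsMax h v p q)
    (hw : IsMax h w p' q') (hp : a ≤ p) (hp' : a ≤ p') (hq : q ≤ b) (hq' : q' ≤ b)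
    (hcov : ∀ r, a ≤ r → r ≤ b → p ≤ r ∧ r ≤ q ∨ p' ≤ r ∧ r ≤ q') :
    IsMax h (max v w) a b := by
  obtain ⟨⟨r, hr1, hr2, hr3⟩, hv'⟩ := hv
  obtain ⟨⟨s, hs1, hs2, hs3⟩, hw'⟩ := hw
  refine ⟨?_, fun x hx hx' => ?_⟩
  · rcases max_choice v w with h1 | h1
    · exact ⟨r, by omega, by omega, h1.trans hr3⟩
    · exact ⟨s, by omega, by omega, h1.trans hs3⟩
  · rcases hcov x hx hx' with h1 | h1
    · exact (hv' x h1.1 h1.2).trans (le_max_left _ _)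
    · exact (hw' x h1.1 h1.2).trans (le_max_right _ _)

/-- The last place of the maximum. -/
theorem exists_last_max (h : ℕ → ℝ) {p q : ℕ} (hpq : p ≤ q) :
    ∃ m, p ≤ m ∧ m ≤ q ∧ (∀ r, p ≤ r → r ≤ q → h r ≤ h m) ∧ ∀ r, m < r → r ≤ q → h r < h m := by
  classical
  obtain ⟨m0, hm0, hmax0⟩ := exists_max_image (Icc p q) h ⟨p, mem_Icc.2 ⟨le_rfl, hpq⟩⟩
  obtain ⟨m, hm, hmax⟩ := exists_max_image {r ∈ Icc p q | h r = h m0} id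
    ⟨m0, mem_filter.2 ⟨hm0, rfl⟩⟩
  rw [mem_filter, mem_Icc] at hm
  refine ⟨m, hm.1.1, hm.1.2, fun r hr hr' => ?_, fun r hr hr' => ?_⟩
  · rw [hm.2]; exact hmax0 r (mem_Icc.2 ⟨hr, hr'⟩)
  · have h1 := hmax0 r (mem_Icc.2 ⟨by omega, hr'⟩)
    rw [hm.2]
    refine lt_of_le_of_ne h1 fun heq => ?_
    have := hmax r (mem_filter.2 ⟨mem_Icc.2 ⟨by omega, hr'⟩, heq⟩)
    simp only [id] at this
    omega

section bits

open Classical in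
/-- The number with the binary digits `P 0, …, P (b - 1)`. -/
noncomputable def bits (b : ℕ) (P : ℕ → Prop) : ℕ := ∑ o ∈ range b, (if P o then 1 else 0) * 2 ^ o

theorem bits_succ (b : ℕ) (P : ℕ → Prop) :
    bits (b + 1) P = 2 * bits b (fun o => P (o + 1)) + open Classical in if P 0 then 1 else 0 := by
  classical
  rw [bits, sum_range_succ', bits, mul_sum]
  simp only [pow_zero, mul_one, add_left_inj]
  exact sum_congr rfl fun o _ => by rw [pow_succ]; ring

theorem bits_lt (b : ℕ) (P : ℕ → Prop) : bits b P < 2 ^ b := by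
  induction b generalizing P with
  | zero => simp [bits]
  | succ b ih =>
    have := ih fun o => P (o + 1)
    rw [bits_succ, pow_succ]
    split_ifs <;> omega

theorem bits_div_mod (b : ℕ) (P : ℕ → Prop) (t : ℕ) :
    bits b P / 2 ^ t % 2 = 1 ↔ t < b ∧ P t := by
  induction t generalizing b P with
  | zero =>
    cases b with
    | zero => simp [bits]
    | succ b =>
      rw [bits_succ, pow_zero, Nat.div_one]
      split_ifs with h
      · simp [h]
      · simp [h]
  | succ t ih =>
    cases b with
    | zero => simp [bits]
    | succ b =>
      have h1 : bits (b + 1) P / 2 ^ (t + 1) = bits b (fun o => P (o + 1)) / 2 ^ t := by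
        rw [pow_succ', ← Nat.div_div_eq_div_mul, bits_succ]
        congr 1
        split_ifs <;> omega
      rw [h1, ih]
      simp

end bits

/-- Tables for range maxima of `h` on the numbers below `L`: blocks of length `b`, the suffix maxima
in a block, and the maxima of sequences of `2 ^ l` blocks. -/
structure RangeMax (L b B : ℕ) (h : ℕ → ℝ) (mask tz lg : ℕ → ℕ) (sp : ℕ → ℝ) : Prop where
  pos : 0 < b
  mask_eq : ∀ q < L, mask q = bits b fun o =>
    q / b * b + o ≤ q ∧ ∀ r < q + 1, q / b * b + o < r → h r < h (q / b * b + o)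
  tz_eq : ∀ m < 2 ^ b, tz m = least b fun t => m / 2 ^ t % 2 = 1
  lg_le : ∀ m, 0 < m → m * b < L → 2 ^ lg m ≤ m
  lt_lg : ∀ m, 0 < m → m * b < L → m < 2 ^ (lg m + 1)
  sp_isMax : ∀ m l β, m * b < L → l = lg m → 0 < m → β * b < L → β < B →
    IsMax h (sp (l * B + β)) (β * b) (min ((β + 2 ^ l) * b) L - 1)
  blocks : L / b < B

namespace RangeMax

variable {L b B : ℕ} {h : ℕ → ℝ} {mask tz lg : ℕ → ℕ} {sp : ℕ → ℝ}

/-- The maximum in a block. -/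
def inBlock (b : ℕ) (mask tz : ℕ → ℕ) (p q : ℕ) : ℕ := p + tz (mask q / 2 ^ (p % b))

/-- The mask of `q` marks the places of the block that are strictly larger than everything after
them up to `q`. When the digits before `p` are shifted away, the lowest remaining one is the last
place of the maximum from `p` to `q`. -/
theorem isMax_inBlock (H : RangeMax L b B h mask tz lg sp) {p q : ℕ} (hpq : p ≤ q) (hq : q < L)
    (hb : p / b = q / b) : IsMax h (h (inBlock b mask tz p q)) p q := by
  obtain ⟨m, hm1, hm2, hm3, hm4⟩ := exists_last_max h hpq
  have hp : p = q / b * b + p % b := by rw [← hb, mul_comm]; exact (Nat.div_add_mod p b).symm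
  have hqb : q < q / b * b + b := by
    have := Nat.div_add_mod q b
    have := Nat.mod_lt q H.pos
    rw [mul_comm (q / b)]
    omega
  set q0 := q / b * b with hq0
  set P : ℕ → Prop := fun o => q0 + o ≤ q ∧ ∀ r < q + 1, q0 + o < r → h r < h (q0 + o) with hP
  have hmask : mask q = bits b P := H.mask_eq q hq
  have htz : tz (mask q / 2 ^ (p % b)) = m - p := by
    rw [H.tz_eq]
    · have hiff : ∀ t, mask q / 2 ^ (p % b) / 2 ^ t % 2 = 1 ↔ p % b + t < b ∧ P (p % b + t) := by
        intro t
        rw [Nat.div_div_eq_div_mul, ← pow_add, hmask, bits_div_mod]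
      refine least_eq (by omega) ?_ ?_
      · intro t ht
        rw [hiff]
        -- A marked place between `p` and `m` would be strictly larger than the maximum `h m`.
        rintro ⟨-, h1, h2⟩
        have h3 := h2 m (by omega) (by omega)
        have h4 := hm3 (q0 + (p % b + t)) (by omega) (by omega)
        linarith
      · intro _
        rw [hiff]
        have hmq : q0 + (p % b + (m - p)) = m := by omega
        refine ⟨by omega, by omega, ?_⟩
        rw [hmq]
        exact fun r hr hr' => hm4 r hr' (by omega)
    · rw [hmask]
      exact (Nat.div_le_self _ _).trans_lt (bits_lt _ _)
  have : inBlock b mask tz p q = m := by rw [inBlock, htz]; omega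
  rw [this]
  exact ⟨⟨m, hm1, hm2, rfl⟩, hm3⟩

/-- The maximum on an interval. -/
noncomputable def value (b B : ℕ) (h : ℕ → ℝ) (mask tz lg : ℕ → ℕ) (sp : ℕ → ℝ) (p q : ℕ) : ℝ :=
  if p / b = q / b then h (inBlock b mask tz p q)
  else if p / b + 1 = q / b then
    max (h (inBlock b mask tz p (p / b * b + (b - 1)))) (h (inBlock b mask tz (q / b * b) q))
  else max (max (h (inBlock b mask tz p (p / b * b + (b - 1))))
    (max (sp (lg (q / b - (p / b + 1)) * B + (p / b + 1)))
      (sp (lg (q / b - (p / b + 1)) * B + (q / b - 2 ^ lg (q / b - (p / b + 1)))))))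
    (h (inBlock b mask tz (q / b * b) q))

/-- An interval that meets three or more blocks consists of a suffix of its first block, a prefix of
its last one and full blocks in between; two runs of `2 ^ l` blocks, which may overlap, cover the
latter. -/
theorem isMax_value (H : RangeMax L b B h mask tz lg sp) {p q : ℕ} (hpq : p ≤ q) (hq : q < L) :
    IsMax h (value b B h mask tz lg sp p q) p q := by
  have hb := H.pos
  rw [value]
  have hdm := Nat.div_add_mod p b
  have hdm' := Nat.div_add_mod q b
  have hml := Nat.mod_lt p hb
  have hml' := Nat.mod_lt q hb
  rw [mul_comm] at hdm hdm'
  have hdle : p / b ≤ q / b := Nat.div_le_div_right hpq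
  by_cases h1 : p / b = q / b
  · rw [if_pos h1]
    exact H.isMax_inBlock hpq hq h1
  rw [if_neg h1]
  have hlt : p / b + 1 ≤ q / b := by omega
  have hmul := Nat.mul_le_mul_right b hlt
  rw [Nat.add_mul, one_mul] at hmul
  have e1 : (p / b * b + (b - 1)) / b = p / b := by
    rw [mul_comm, Nat.mul_add_div hb, Nat.div_eq_of_lt (Nat.sub_lt hb one_pos), add_zero]
  have m1 := H.isMax_inBlock (p := p) (q := p / b * b + (b - 1)) (by omega) (by omega) e1.symm
  have m2 := H.isMax_inBlock (p := q / b * b) (q := q) (by omega) hq (Nat.mul_div_cancel _ hb)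
  clear e1
  have hqB : q / b < B := (Nat.div_le_div_right hq.le).trans_lt H.blocks
  generalize p / b = u at *
  generalize q / b = w at *
  by_cases h2 : u + 1 = w
  · rw [if_pos h2]
    refine m1.max m2 le_rfl (by omega) (by omega) le_rfl fun r hr hr' => ?_
    have hmul2 : w * b = u * b + b := by rw [← h2, Nat.add_mul, one_mul]
    omega
  · rw [if_neg h2]
    obtain ⟨m, hm⟩ : ∃ m, w = u + 1 + m := ⟨w - (u + 1), by omega⟩
    have hm0 : 0 < m := by omega
    have hmb : m * b ≤ w * b := Nat.mul_le_mul_right b (by omega)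
    have hmL : m * b < L := by omega
    have hsub : w - (u + 1) = m := by omega
    rw [hsub]
    have hl1 := H.lg_le m hm0 hmL
    have hl2 := H.lt_lg m hm0 hmL
    rw [pow_succ] at hl2
    have s1 := H.sp_isMax m (lg m) (u + 1) hmL rfl hm0
    have s2 := H.sp_isMax m (lg m) (w - 2 ^ lg m) hmL rfl hm0
    generalize 2 ^ lg m = l at *
    have hx : (u + 1) * b = u * b + b := by rw [Nat.add_mul, one_mul]
    have hy : (w - l) * b ≤ w * b := Nat.mul_le_mul_right b (by omega)
    have e2 : (w - l + l) * b = w * b := by congr 1; omega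
    have e3 : (u + 1 + l) * b ≤ w * b := Nat.mul_le_mul_right b (by omega)
    have e4 : (u + 1) * b ≤ (w - l) * b := Nat.mul_le_mul_right b (by omega)
    have e5 : (w - l) * b ≤ (u + 1 + l) * b := Nat.mul_le_mul_right b (by omega)
    have s1 := s1 (by omega) (by omega)
    have s2 := s2 (by omega) (by omega)
    -- Both runs end no later than the start of block `w`, which is below `L`, so the truncation at
    -- `L` has no effect.
    rw [min_eq_left (by omega)] at s1 s2
    rw [e2] at s2
    have m3 := s1.max s2 (a := (u + 1) * b) (b := w * b - 1) le_rfl e4 (by omega)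
      (by omega) (fun r hr hr' => by omega)
    have m4 := m1.max m3 (a := p) (b := w * b - 1) le_rfl (by omega) (by omega) le_rfl
      (fun r hr hr' => by omega)
    exact m4.max m2 le_rfl (by omega) (by omega) le_rfl (fun r hr hr' => by omega)

end RangeMax

end DistanceOracle

namespace DistanceOracle

open Finset RAM

/-! ### Scales -/

/-- The next scale is larger than this. -/
noncomputable def threshold (g : ℕ → ℝ) (s : ℕ) : ℝ := 6 / 5 * if s = 0 then 0 else g (s - 1)

/-- Each scale is the least value above the threshold if there is one. -/
def IsScale (m M : ℕ) (v g : ℕ → ℝ) : Prop :=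
  ∀ s < M, (∃ a < m, threshold g s < v a ∧ (∀ b < m, threshold g s < v b → v a ≤ v b) ∧
    g s = v a) ∨ (∀ a < m, v a ≤ threshold g s) ∧ g s = threshold g s

namespace IsScale

variable {m M : ℕ} {v g : ℕ → ℝ}

theorem threshold_le (h : IsScale m M v g) {s : ℕ} (hs : s < M) : threshold g s ≤ g s := by
  rcases h s hs with ⟨a, -, h1, -, h2⟩ | ⟨-, h2⟩
  · rw [h2]; exact h1.le
  · exact h2.ge

theorem nonneg (h : IsScale m M v g) {s : ℕ} (hs : s < M) : 0 ≤ g s := by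
  have h1 := h.threshold_le hs
  rw [threshold] at h1
  induction s with
  | zero => simpa using h1
  | succ s ih =>
    have h0 := ih (by omega) (h.threshold_le (by omega))
    rw [if_neg (by omega), Nat.add_sub_cancel] at h1
    linarith

theorem growth (h : IsScale m M v g) {s j : ℕ} (hs : s + j < M) : (6 / 5) ^ j * g s ≤ g (s + j) := by
  induction j with
  | zero => simp
  | succ j ih =>
    have h1 := ih (by omega)
    have h2 := h.threshold_le hs
    rw [threshold, if_neg (by omega), ← Nat.add_assoc, Nat.add_sub_cancel] at h2
    rw [pow_succ, ← Nat.add_assoc]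
    linarith

theorem mono (h : IsScale m M v g) {s t : ℕ} (hst : s ≤ t) (ht : t < M) : g s ≤ g t := by
  obtain ⟨j, rfl⟩ := Nat.exists_eq_add_of_le hst
  have h1 := h.growth ht
  have h2 := h.nonneg (s := s) (by omega)
  have h3 : (1 : ℝ) ≤ (6 / 5) ^ j := one_le_pow₀ (by norm_num)
  nlinarith

/-- All positive values are close to a scale. -/
theorem exists_scale (h : IsScale m M v g) (hM : m ≤ M) {a : ℕ} (ha : a < m) (hpos : 0 < v a) :
    ∃ s < m, g s ≤ v a ∧ v a ≤ 6 / 5 * g s := by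
  classical
  have hex : ∃ s < m, v a ≤ 6 / 5 * g s := by
    -- Pigeonhole: if all scales were too small, the first `m` of them would be strictly increasing
    -- values of `v`, hence would exhaust the indices, and one of them would equal `v a`.
    by_contra hno
    push Not at hno
    have hlt : ∀ s < m, threshold g s < v a := by
      intro s hs
      rw [threshold]
      split_ifs with h0
      · simpa using hpos
      · exact hno (s - 1) (by omega)
    have hmem : ∀ s < m, ∃ b < m, g s = v b := by
      intro s hs
      rcases h s (by omega) with ⟨b, hb, -, -, h2⟩ | ⟨h1, -⟩
      · exact ⟨b, hb, h2⟩
      · exact absurd (h1 a ha) (not_le.2 (hlt s hs))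
    have hpos' : ∀ s < m, 0 < g s := by
      intro s hs
      rcases h s (by omega) with ⟨b, hb, h1, -, h2⟩ | ⟨h1, -⟩
      · rw [h2]
        refine lt_of_le_of_lt ?_ h1
        rw [threshold]
        split_ifs with h0
        · simp
        · have := h.nonneg (s := s - 1) (by omega)
          positivity
      · exact absurd (h1 a ha) (not_le.2 (hlt s hs))
    have hstrict : ∀ s t, s < t → t < m → g s < g t := by
      intro s t hst ht
      have h1 := h.mono (s := s + 1) (t := t) (by omega) (by omega)
      have h2 := h.growth (s := s) (j := 1) (by omega)
      have h3 := hpos' s (by omega)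
      rw [pow_one] at h2
      linarith
    choose! f hf1 hf2 using hmem
    have hinj : Set.InjOn f (range m : Set ℕ) := by
      intro s hs t ht heq
      have hs : s < m := by simpa using hs
      have ht : t < m := by simpa using ht
      have h1 : g s = g t := by rw [hf2 s hs, hf2 t ht, heq]
      rcases lt_trichotomy s t with hlt | heq | hlt
      · exact absurd h1 (hstrict s t hlt ht).ne
      · exact heq
      · exact absurd h1.symm (hstrict t s hlt hs).ne
    have himg : (range m).image f = range m := by
      refine eq_of_subset_of_card_le (fun x hx => ?_) ?_
      · obtain ⟨s, hs, rfl⟩ := mem_image.1 hx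
        exact mem_range.2 (hf1 s (mem_range.1 hs))
      · rw [card_image_of_injOn hinj]
    have : a ∈ (range m).image f := by rw [himg]; exact mem_range.2 ha
    obtain ⟨s, hs, hsa⟩ := mem_image.1 this
    have h1 := hno s (mem_range.1 hs)
    have h2 := hf2 s (mem_range.1 hs)
    have h3 := hpos' s (mem_range.1 hs)
    rw [hsa] at h2
    linarith
  obtain ⟨h1, h2, h3⟩ := least_spec hex
  set s := least m fun s => v a ≤ 6 / 5 * g s
  refine ⟨s, h1, ?_, h2⟩
  -- By the minimality of `s`, the value `v a` is still a candidate for scale `s`, and this gives `g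
  -- s ≤ v a`.
  have hlt : threshold g s < v a := by
    rw [threshold]
    split_ifs with h0
    · simpa using hpos
    · exact not_le.1 (h3 (s - 1) (by omega))
  rcases h s (by omega) with ⟨b, -, -, h4, h5⟩ | ⟨h4, -⟩
  · rw [h5]; exact h4 a ha hlt
  · exact absurd (h4 a ha) (not_le.2 hlt)

end IsScale

/-- The radius of the balls in round `σ` of family `f`. -/
noncomputable def radius (k : ℝ) (g : ℕ → ℝ) (Q f σ : ℕ) : ℝ :=
  if σ < Q then (4 * k + 6 / 5) * g (f + 16 * (Q - 1 - σ)) else 0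

/-- Half the width of the boundary in round `σ` of family `f`. -/
noncomputable def width (g : ℕ → ℝ) (Q f σ : ℕ) : ℝ :=
  if σ < Q then 6 / 5 * g (f + 16 * (Q - 1 - σ)) else 0

/-- Successive rounds of a family are sixteen scales apart and `(6 / 5) ^ 16 ≥ 18`, so the next
radius is at most an eighteenth of the present one. The rings take up `12 / 5 * K` times the scale
with `K ≤ k + 1`, and `4 * k + 6 / 5` has room for both as soon as `k ≥ 1`. -/
theorem IsScale.scales {m Q f K : ℕ} {v g : ℕ → ℝ} {k : ℝ} (h : IsScale m (16 * Q) v g)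
    (hf : f < 16) (hk : 1 ≤ k) (hK : (K : ℝ) ≤ k + 1) :
    Scales K Q (radius k g Q f) (width g Q f) := by
  have hg : ∀ σ < Q, 0 ≤ g (f + 16 * (Q - 1 - σ)) := fun σ hσ => h.nonneg (by omega)
  refine ⟨fun σ => ?_, fun σ => ?_, fun σ hσ => ?_⟩
  · rw [radius]
    split_ifs with hσ
    · have := hg σ hσ
      positivity
    · exact le_rfl
  · rw [width]
    split_ifs with hσ
    · have := hg σ hσ
      positivity
    · exact le_rfl
  · rw [radius, radius, width, if_pos hσ, if_pos hσ]
    have h0 := hg σ hσ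
    split_ifs with hσ'
    · have h1 := h.growth (s := f + 16 * (Q - 1 - (σ + 1))) (j := 16) (by omega)
      have h2 : f + 16 * (Q - 1 - (σ + 1)) + 16 = f + 16 * (Q - 1 - σ) := by omega
      have h3 := hg (σ + 1) hσ'
      rw [h2] at h1
      have h4 : (18 : ℝ) ≤ (6 / 5) ^ 16 := by norm_num
      set a := g (f + 16 * (Q - 1 - (σ + 1)))
      set b := g (f + 16 * (Q - 1 - σ))
      have h5 : 18 * a ≤ b := by nlinarith
      have h6 : b * K ≤ b * (k + 1) := mul_le_mul_of_nonneg_left hK h0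
      have h7 : 0 ≤ (4 * k + 6 / 5) * (b - 18 * a) :=
        mul_nonneg (by linarith) (by linarith)
      have h8 : 0 ≤ (k - 1) * b := mul_nonneg (by linarith) h0
      nlinarith
    · have h6 := mul_le_mul_of_nonneg_left hK h0
      have h8 : 0 ≤ (k - 1) * g (f + 16 * (Q - 1 - σ)) := mul_nonneg (by linarith) h0
      nlinarith

/-- The summand `6 / 5` of the radius is there to cancel the width. -/
theorem radius_sub_width {k : ℝ} {g : ℕ → ℝ} {Q f σ : ℕ} (hσ : σ < Q) :
    2 * (radius k g Q f σ - width g Q f σ) = 8 * k * g (f + 16 * (Q - 1 - σ)) := by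
  rw [radius, width, if_pos hσ, if_pos hσ]
  ring

/-! ### The number of possible radii -/

open Classical in
/-- The least integer `≥ k`, but at most `n`. -/
noncomputable def radii (n : ℕ) (k : ℝ) : ℕ := ∑ i ∈ range n, if (i : ℝ) < k then 1 else 0

theorem radii_eq (n : ℕ) (k : ℝ) : radii n k = min n ⌈k⌉₊ := by
  classical
  rw [radii, ← card_filter]
  have : (range n).filter (fun i : ℕ => (i : ℝ) < k) = range (min n ⌈k⌉₊) := by
    ext i
    simp [Nat.lt_ceil]
  rw [this, card_range]

theorem radii_pos {n : ℕ} {k : ℝ} (hn : 1 ≤ n) (hk : 1 < k) : 0 < radii n k := by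
  rw [radii_eq]
  have : 0 < ⌈k⌉₊ := Nat.ceil_pos.2 (by linarith)
  omega

theorem radii_le {n : ℕ} {k : ℝ} (hk : 1 < k) : (radii n k : ℝ) ≤ k + 1 := by
  rw [radii_eq]
  have h1 : ((min n ⌈k⌉₊ : ℕ) : ℝ) ≤ (⌈k⌉₊ : ℝ) := by exact_mod_cast min_le_right _ _
  exact h1.trans (Nat.ceil_lt_add_one (by linarith)).le

/-- If `⌈k⌉₊ ≤ n`, the exponent is at most `1 / k`. Otherwise there are `n` radii, and `n ^ (1 / n)
≤ 2` because `n ≤ 2 ^ n`. -/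
theorem rpow_radii_le {n : ℕ} {k : ℝ} (hn : 1 ≤ n) (hk : 1 < k) :
    (n : ℝ) ^ (1 / radii n k : ℝ) ≤ 2 * (n : ℝ) ^ (1 / k) := by
  have hn' : (1 : ℝ) ≤ n := by exact_mod_cast hn
  have hk0 : 0 < k := by linarith
  have h1 : (1 : ℝ) ≤ (n : ℝ) ^ (1 / k) := Real.one_le_rpow hn' (by positivity)
  rw [radii_eq]
  rcases le_total n ⌈k⌉₊ with h | h
  · rw [min_eq_left h]
    have h2 : (n : ℝ) ^ (1 / n : ℝ) ≤ ((2 : ℝ) ^ n) ^ (1 / n : ℝ) := by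
      refine Real.rpow_le_rpow (by positivity) ?_ (by positivity)
      exact_mod_cast Nat.lt_two_pow_self.le
    rw [← Real.rpow_natCast, ← Real.rpow_mul (by norm_num), mul_one_div_cancel (by positivity),
      Real.rpow_one] at h2
    linarith
  · rw [min_eq_right h]
    have h2 : (n : ℝ) ^ (1 / (⌈k⌉₊ : ℝ)) ≤ (n : ℝ) ^ (1 / k) :=
      Real.rpow_le_rpow_of_exponent_le hn' (one_div_le_one_div_of_le hk0 (Nat.le_ceil k))
    linarith

/-! ### Consecutive numbers -/

/-- The index of the interval that contains `e`, where `base` lists the ends of the intervals. -/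
theorem least_base {base : ℕ → ℕ} {M e : ℕ} (h0 : base 0 = 0) (he : e < base M) :
    least M (fun y => e < base (y + 1)) < M ∧
    base (least M fun y => e < base (y + 1)) ≤ e ∧
    e < base (least M (fun y => e < base (y + 1)) + 1) := by
  have hM : M ≠ 0 := by rintro rfl; omega
  obtain ⟨h1, h2, h3⟩ := least_spec (m := M) (P := fun y => e < base (y + 1))
    ⟨M - 1, by omega, by rwa [Nat.sub_add_cancel (by omega)]⟩
  refine ⟨h1, ?_, h2⟩
  rcases Nat.eq_zero_or_pos (least M fun y => e < base (y + 1)) with h4 | h4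
  · rw [h4, h0]; exact Nat.zero_le e
  · have := h3 (least M (fun y => e < base (y + 1)) - 1) (by omega)
    rw [Nat.sub_add_cancel h4] at this
    omega

theorem least_base_eq {base : ℕ → ℕ} {M y e : ℕ} (hmono : Monotone base) (hy : y < M)
    (h1 : base y ≤ e) (h2 : e < base (y + 1)) : least M (fun y => e < base (y + 1)) = y := by
  refine least_eq hy.le (fun j hj => ?_) fun _ => h2
  have := hmono (show j + 1 ≤ y from hj)
  omega

end DistanceOracle

namespace DistanceOracle

open Finset RAM

/-! ### The trees of all families -/

/-- Sixteen families of carvings, each for every sixteenth scale. -/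
structure Forest (n : ℕ) (k : ℝ) (d : ℕ → ℕ → ℝ) (g : ℕ → ℝ) (X : ℕ → ℕ → ℕ → Prop)
    (A B : ℕ → ℕ → ℕ → ℕ → Prop) : Prop where
  pos : 1 ≤ n
  one_lt : 1 < k
  dist : IsDist n d
  scale : IsScale (n * n) (16 * (n * n)) (fun a => d (a / n) (a % n)) g
  family : ∀ f < 16, Family n (radii n k) (n * n) d (radius k g (n * n) f) (width g (n * n) f)
    (X f) (A f) (B f)

/-- The level of `u % n` in family `u / n`. -/
noncomputable def lev (n : ℕ) (B : ℕ → ℕ → ℕ → ℕ → Prop) (u : ℕ) : ℕ :=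
  level n (n * n) (B (u / n)) (u % n)

/-- The number of leaves before those of `u`. -/
noncomputable def base (n : ℕ) (B : ℕ → ℕ → ℕ → ℕ → Prop) (u : ℕ) : ℕ :=
  ∑ y ∈ range u, (lev n B y + 1)

/-- The number of leaves. -/
noncomputable def leaves (n : ℕ) (B : ℕ → ℕ → ℕ → ℕ → Prop) : ℕ := base n B (16 * n)

/-- The point and family of a leaf. -/
noncomputable def owner (n : ℕ) (B : ℕ → ℕ → ℕ → ℕ → Prop) (e : ℕ) : ℕ :=
  least (16 * n) fun y => e < base n B (y + 1)

open Classical in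
/-- The word of a leaf: its tree, the times when it is carved, and its point. -/
noncomputable def letter (n : ℕ) (A B : ℕ → ℕ → ℕ → ℕ → Prop) (e s : ℕ) : ℕ :=
  if s = 0 then owner n B e / n
  else if s = 1 then e - base n B (owner n B e)
  else if s = n * (n * n) + 2 then owner n B e % n
  else if A (owner n B e / n) (e - base n B (owner n B e)) (s - 2) (owner n B e % n) then 0 else 1

/-- The distance between the points of two leaves. -/
noncomputable def leafDist (n : ℕ) (B : ℕ → ℕ → ℕ → ℕ → Prop) (d : ℕ → ℕ → ℝ) (e e' : ℕ) : ℝ :=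
  d (owner n B e % n) (owner n B e' % n)

/-- The leaf of `x` in the tree of family `f` where one of `x` and `y` stays marked. -/
noncomputable def commonLeaf (n : ℕ) (B : ℕ → ℕ → ℕ → ℕ → Prop) (f x y : ℕ) : ℕ :=
  base n B (f * n + x) + min (lev n B (f * n + x)) (lev n B (f * n + y))

variable {n : ℕ} {k : ℝ} {d : ℕ → ℕ → ℝ} {g : ℕ → ℝ} {X : ℕ → ℕ → ℕ → Prop}
  {A B : ℕ → ℕ → ℕ → ℕ → Prop}

theorem base_mono : Monotone (base n B) := fun _ _ h =>
  sum_le_sum_of_subset (range_mono h)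

theorem base_succ (u : ℕ) : base n B (u + 1) = base n B u + (lev n B u + 1) := sum_range_succ _ _

theorem owner_spec {e : ℕ} (he : e < leaves n B) : owner n B e < 16 * n ∧
    base n B (owner n B e) ≤ e ∧ e ≤ base n B (owner n B e) + lev n B (owner n B e) := by
  obtain ⟨h1, h2, h3⟩ := least_base (base := base n B) (by simp [base]) he
  refine ⟨h1, h2, ?_⟩
  rw [base_succ] at h3
  exact Nat.lt_succ_iff.1 h3

theorem owner_eq {u i : ℕ} (hu : u < 16 * n) (hi : i ≤ lev n B u) :
    owner n B (base n B u + i) = u := by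
  refine least_base_eq base_mono hu (Nat.le_add_right _ _) ?_
  rw [base_succ]
  omega

theorem add_lt_leaves {u i : ℕ} (hu : u < 16 * n) (hi : i ≤ lev n B u) :
    base n B u + i < leaves n B := by
  have h1 := base_mono (n := n) (B := B) (show u + 1 ≤ 16 * n from hu)
  rw [base_succ] at h1
  rw [leaves]
  omega

/-- The letters `0`, `1` and the last one are the family, the tree and the point, and these already
determine the leaf. -/
theorem words_letter : Words (n * (n * n) + 3) (leaves n B) (letter n A B) := by
  refine ⟨fun e he e' he' hne => ?_⟩
  by_contra hno
  push Not at hno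
  have h0 := hno 0 (by omega)
  have h1 := hno 1 (by omega)
  have h2 := hno (n * (n * n) + 2) (by omega)
  simp only [letter, if_true, one_ne_zero, if_false, Nat.add_eq_zero_iff, OfNat.ofNat_ne_zero,
    and_false, show n * (n * n) + 2 ≠ 1 by omega] at h0 h1 h2
  have h3 : owner n B e = owner n B e' := by
    rw [← Nat.div_add_mod (owner n B e) n, ← Nat.div_add_mod (owner n B e') n, h0, h2]
  rw [h3] at h1
  have h4 := owner_spec he
  have h5 := owner_spec he'
  rw [h3] at h4
  omega

section decode

variable {f x y : ℕ} (hf : f < 16) (hx : x < n)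
include hf hx

theorem code_lt : f * n + x < 16 * n := by
  have := Nat.mul_le_mul_right n (show f + 1 ≤ 16 from hf)
  rw [Nat.add_mul, one_mul] at this
  omega

omit hf in
theorem code_div : (f * n + x) / n = f := by
  rw [mul_comm, Nat.mul_add_div (by omega), Nat.div_eq_of_lt hx, add_zero]

omit hf in
theorem code_mod : (f * n + x) % n = x := by
  rw [mul_comm, Nat.mul_add_mod, Nat.mod_eq_of_lt hx]

theorem commonLeaf_lt : commonLeaf n B f x y < leaves n B :=
  add_lt_leaves (code_lt hf hx) (min_le_left _ _)

theorem owner_commonLeaf : owner n B (commonLeaf n B f x y) = f * n + x :=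
  owner_eq (code_lt hf hx) (min_le_left _ _)

theorem letter_commonLeaf {r m : ℕ} (hr : r < n * (n * n))
    (hm : min (lev n B (f * n + x)) (lev n B (f * n + y)) = m) :
    letter n A B (commonLeaf n B f x y) 0 = f ∧ letter n A B (commonLeaf n B f x y) 1 = m ∧
    letter n A B (commonLeaf n B f x y) (r + 2) =
      open Classical in if A f m r x then 0 else 1 := by
  subst hm
  have h1 : commonLeaf n B f x y - base n B (f * n + x) =
      min (lev n B (f * n + x)) (lev n B (f * n + y)) := Nat.add_sub_cancel_left _ _
  refine ⟨?_, ?_, ?_⟩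
  · rw [letter, if_pos rfl, owner_commonLeaf hf hx, code_div hx]
  · rw [letter, if_neg one_ne_zero, if_pos rfl, owner_commonLeaf hf hx, h1]
  · rw [letter, if_neg (by omega), if_neg (by omega), if_neg (by omega), owner_commonLeaf hf hx,
      code_div hx, code_mod hx, h1, Nat.add_sub_cancel]

end decode

/-! ### The size of the forest and the quality of its estimates -/

namespace Forest

variable {h : ℕ → ℝ}

/-- There are sixteen families, each with at most `2 * n ^ (1 + 1 / k)` leaves by `sum_level_le` and
`rpow_radii_le`. -/
theorem leaves_le (H : Forest n k d g X A B) : (leaves n B : ℝ) ≤ 32 * (n : ℝ) ^ (1 + 1 / k) := by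
  have hn : (0 : ℝ) < n := by exact_mod_cast H.pos
  have hsum : ∀ m, base n B (m * n) = ∑ f ∈ range m, ∑ x ∈ range n, (lev n B (f * n + x) + 1) := by
    intro m
    induction m with
    | zero => simp [base]
    | succ m ih =>
      rw [sum_range_succ, ← ih, base, base, Nat.add_mul, one_mul, sum_range_add]
  have hfam : ∀ f ∈ range 16, ((∑ x ∈ range n, (lev n B (f * n + x) + 1) : ℕ) : ℝ) ≤
      2 * (n : ℝ) ^ (1 + 1 / k) := by
    intro f hf
    have hf := mem_range.1 hf
    have h1 := (H.family f hf).sum_level_le H.dist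
      (H.scale.scales hf H.one_lt.le (radii_le H.one_lt)) (radii_pos H.pos H.one_lt)
    have h2 : ∑ x ∈ range n, (lev n B (f * n + x) + 1) =
        ∑ x ∈ range n, (level n (n * n) (B f) x + 1) := by
      refine sum_congr rfl fun x hx => ?_
      rw [lev, code_div (mem_range.1 hx), code_mod (mem_range.1 hx)]
    rw [h2, Nat.cast_sum]
    refine h1.trans ?_
    rw [Real.rpow_add hn, Real.rpow_one]
    have h3 := mul_le_mul_of_nonneg_right (rpow_radii_le H.pos H.one_lt) hn.le
    linarith
  have h3 := sum_le_card_nsmul _ _ _ hfam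
  rw [leaves, hsum, Nat.cast_sum]
  refine h3.trans ?_
  rw [card_range, nsmul_eq_mul]
  push_cast
  linarith

/-- Each point has a leaf in each family. Consequently tables indexed by points, masks or exponents
fit into as many rows as there are leaves. -/
theorem le_leaves : 16 * n ≤ leaves n B := by
  rw [leaves, base]
  calc 16 * n = ∑ y ∈ range (16 * n), 1 := by simp
    _ ≤ _ := sum_le_sum fun y _ => by omega

theorem level_min_le {f x y : ℕ} (hx : x < n) (hy : y < n) :
    min (lev n B (f * n + x)) (lev n B (f * n + y)) =
      min (level n (n * n) (B f) x) (level n (n * n) (B f) y) := by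
  rw [lev, lev, code_div hx, code_mod hx, code_div hy, code_mod hy]

/-- The position of the leaf of `x` that is compared with a leaf of `y`. -/
noncomputable def place (n : ℕ) (A B : ℕ → ℕ → ℕ → ℕ → Prop) (f x y : ℕ) : ℕ :=
  position (n * (n * n) + 3) (leaves n B) (letter n A B) (commonLeaf n B f x y)

section query

variable (G : Gaps (n * (n * n) + 3) (leaves n B) (letter n A B) (leafDist n B d) h)
include G

omit G in
theorem place_lt {f x y : ℕ} (hf : f < 16) (hx : x < n) : place n A B f x y < leaves n B :=
  Words.position_lt _ (commonLeaf_lt hf hx)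

theorem place_ne {f x y : ℕ} (hf : f < 16) (hx : x < n) (hy : y < n) (hxy : x ≠ y) :
    place n A B f x y ≠ place n A B f y x := by
  intro heq
  have h1 := G.words.position_inj (commonLeaf_lt hf hx) (commonLeaf_lt hf hy) heq
  have h2 := owner_commonLeaf (B := B) (y := y) hf hx
  rw [h1, owner_commonLeaf hf hy] at h2
  omega

/-- No scale enters here: in every family the two leaves part in a class that contains both, so none
of the sixteen estimates is too small. -/
theorem dist_le (hd : IsDist n d) {f x y : ℕ} (hf : f < 16) (hx : x < n) (hy : y < n)
    (hxy : x ≠ y) {v : ℝ} (hv : IsMax h v (min (place n A B f x y) (place n A B f y x))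
      (max (place n A B f x y) (place n A B f y x) - 1)) : d x y ≤ v := by
  have hD : ∀ {x y}, x < n → y < n →
      leafDist n B d (commonLeaf n B f x y) (commonLeaf n B f y x) = d x y := by
    intro x y hx hy
    rw [leafDist, owner_commonLeaf hf hx, owner_commonLeaf hf hy, code_mod hx, code_mod hy]
  have hle := commonLeaf_lt (B := B) (y := y) hf hx
  have hle' := commonLeaf_lt (B := B) (y := x) hf hy
  rcases lt_or_gt_of_ne (place_ne G hf hx hy hxy) with hlt | hlt
  · obtain ⟨p, h1, h2, h3⟩ := G.exists_le hle hle' hlt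
    rw [hD hx hy] at h3
    change place n A B f x y ≤ p at h1
    change p < place n A B f y x at h2
    exact h3.trans (hv.2 p (by omega) (by omega))
  · obtain ⟨p, h1, h2, h3⟩ := G.exists_le hle' hle hlt
    rw [hD hy hx, hd.symm y hy x hx] at h3
    change place n A B f y x ≤ p at h1
    change p < place n A B f x y at h2
    exact h3.trans (hv.2 p (by omega) (by omega))

/-- Take the scale `s` with `g s ≤ d x y ≤ 6 / 5 * g s` and its family. In the tree of the smaller
level one of the two points stays marked, and up to the round of `s` all widths are at least `d x
y`, so the points are still together. The classes after this round have diameter at most `8 * k * g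
s`. -/
theorem exists_le_dist (H : Forest n k d g X A B) {x y : ℕ} (hx : x < n) (hy : y < n)
    (hxy : x ≠ y) (hpos : 0 < d x y) : ∃ f < 16, ∀ v,
    IsMax h v (min (place n A B f x y) (place n A B f y x))
      (max (place n A B f x y) (place n A B f y x) - 1) → v ≤ 8 * k * d x y := by
  have hn : 0 < n := by omega
  obtain ⟨s, hs, hg1, hg2⟩ := H.scale.exists_scale (a := x * n + y) (by omega)
    (by nlinarith) (by rwa [code_div hy, code_mod hy])
  rw [code_div hy, code_mod hy] at hg1 hg2
  set Q := n * n with hQ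
  -- Rounds go from large scales to small ones, and round `σ` of family `f` uses scale `f + 16 * (Q
  -- - 1 - σ)`; the choice makes this equal to `s`.
  set f := s % 16 with hfdef
  set σ := Q - 1 - s / 16 with hσdef
  have hf : f < 16 := Nat.mod_lt _ (by norm_num)
  have hσ : σ < Q := by omega
  have hsf : f + 16 * (Q - 1 - σ) = s := by omega
  have hfam := H.family f hf
  have hR := H.scale.scales (K := radii n k) hf H.one_lt.le (radii_le H.one_lt)
  set m := min (level n Q (B f) x) (level n Q (B f) y) with hm
  have hmm : min (lev n B (f * n + x)) (lev n B (f * n + y)) = m := level_min_le hx hy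
  have hmm' : min (lev n B (f * n + y)) (lev n B (f * n + x)) = m := by rw [min_comm]; exact hmm
  have hmn : m < n := (min_le_left _ _).trans_lt
    (hfam.level_lt H.dist hR (radii_pos H.pos H.one_lt) hx)
  have hc := hfam.carving m hmn
  have hXx : X f m x := (hfam.mem_iff_le_level hmn.le hx).2 (min_le_left _ _)
  have hXy : X f m y := (hfam.mem_iff_le_level hmn.le hy).2 (min_le_right _ _)
  have hT : n * (σ + 1) ≤ n * Q := Nat.mul_le_mul_left n hσ
  have hT' : n * (σ + 1) ≤ n * (n * n) := hT
  have hδ : ∀ r < n * (σ + 1), d x y ≤ width g Q f (r / n) := by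
    intro r hr
    have h1 : r / n < σ + 1 := Nat.div_lt_of_lt_mul hr
    generalize r / n = ρ at h1 ⊢
    rw [width, if_pos (by omega)]
    have h2 := H.scale.mono (s := s) (t := f + 16 * (Q - 1 - ρ)) (by omega) (by omega)
    linarith
  have hsame : Same (A f m) (n * (σ + 1)) x y := by
    rcases min_choice (level n Q (B f) x) (level n Q (B f) y) with h1 | h1
    · refine (Same.equivalence _ _).symm (hc.same_of_marked H.dist hT hXy hy
        ((hfam.marked_iff hmn hx).2 h1.symm) hx fun r hr => ?_)
      rw [H.dist.symm y hy x hx]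
      exact hδ r hr
    · exact hc.same_of_marked H.dist hT hXx hx ((hfam.marked_iff hmn hy).2 h1.symm) hy hδ
  have hle := commonLeaf_lt (B := B) (y := y) hf hx
  have hle' := commonLeaf_lt (B := B) (y := x) hf hy
  have hlx := fun r (hr : r < n * (n * n)) => letter_commonLeaf (A := A) (B := B) (y := y) hf hx hr hmm
  have hly := fun r (hr : r < n * (n * n)) => letter_commonLeaf (A := A) (B := B) (y := x) hf hy hr hmm'
  have h0 : 0 < n * (n * n) := by positivity
  -- The two additional letters are the family and the tree, which precede the record of the cuts.
  have hlet : ∀ r < n * (σ + 1) + 2, letter n A B (commonLeaf n B f x y) r =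
      letter n A B (commonLeaf n B f y x) r := by
    intro r hr
    match r with
    | 0 => rw [(hlx 0 h0).1, (hly 0 h0).1]
    | 1 => rw [(hlx 0 h0).2.1, (hly 0 h0).2.1]
    | r + 2 =>
      rw [(hlx r (by omega)).2.2, (hly r (by omega)).2.2]
      have := hsame r (by omega)
      split_ifs <;> tauto
  -- Any leaf with this prefix, whether or not its point stays marked in the tree, comes from a
  -- point of `X f m` in the class of `x`.
  have hclass : ∀ e < leaves n B,
      (∀ r < n * (σ + 1) + 2, letter n A B (commonLeaf n B f x y) r = letter n A B e r) →
      owner n B e % n < n ∧ X f m (owner n B e % n) ∧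
        Same (A f m) (n * (σ + 1)) x (owner n B e % n) := by
    intro e he hr
    obtain ⟨ho1, ho2, ho3⟩ := owner_spec he
    have e0 := hr 0 (by omega)
    have e1 := hr 1 (by omega)
    rw [(hlx 0 h0).1, letter, if_pos rfl] at e0
    rw [(hlx 0 h0).2.1, letter, if_neg one_ne_zero, if_pos rfl] at e1
    have hmod := Nat.mod_lt (owner n B e) hn
    refine ⟨hmod, (hfam.mem_iff_le_level hmn.le hmod).2 ?_, fun r hr' => ?_⟩
    · have : lev n B (owner n B e) = level n Q (B f) (owner n B e % n) := by
        rw [lev, ← e0]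
      rw [← this]
      omega
    · have e2 := hr (r + 2) (by omega)
      have hne : r + 2 ≠ n * (n * n) + 2 := by omega
      rw [(hlx r (by omega)).2.2, letter, if_neg (Nat.succ_ne_zero _), if_neg (by omega : r + 2 ≠ 1),
        if_neg hne, ← e0, ← e1, Nat.add_sub_cancel] at e2
      by_cases ha : A f m r x <;> by_cases hb : A f m r (owner n B e % n)
      · exact iff_of_true ha hb
      · rw [if_pos ha, if_neg hb] at e2; exact absurd e2 zero_ne_one
      · rw [if_neg ha, if_pos hb] at e2; exact absurd e2 one_ne_zero
      · exact iff_of_false ha hb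
  have hΔ : ∀ e₁ < leaves n B, ∀ e₂ < leaves n B,
      (∀ r < n * (σ + 1) + 2, letter n A B (commonLeaf n B f x y) r = letter n A B e₁ r) →
      (∀ r < n * (σ + 1) + 2, letter n A B (commonLeaf n B f x y) r = letter n A B e₂ r) →
      leafDist n B d e₁ e₂ ≤ 8 * k * d x y := by
    intro e₁ he₁ e₂ he₂ hr₁ hr₂
    obtain ⟨a1, a2, a3⟩ := hclass e₁ he₁ hr₁
    obtain ⟨b1, b2, b3⟩ := hclass e₂ he₂ hr₂
    have h1 := hc.dist_le_of_same H.dist hR hσ a2 a1 b1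
      ((Same.equivalence _ _).trans ((Same.equivalence _ _).symm a3) b3)
    rw [radius_sub_width hσ, hsf] at h1
    have h2 : 8 * k * g s ≤ 8 * k * d x y :=
      mul_le_mul_of_nonneg_left hg1 (by have := H.one_lt; linarith)
    exact h1.trans h2
  refine ⟨f, hf, fun v hv => ?_⟩
  obtain ⟨⟨p, hp1, hp2, rfl⟩, -⟩ := hv
  rcases lt_or_gt_of_ne (place_ne G hf hx hy hxy) with hlt | hlt
  · exact G.le_of_class hle hle' hlet hΔ (p := p)
      (show place n A B f x y ≤ p by omega) (show p < place n A B f y x by omega)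
  · refine G.le_of_class hle' hle (fun r hr => (hlet r hr).symm)
      (fun e₁ he₁ e₂ he₂ hr₁ hr₂ => hΔ e₁ he₁ e₂ he₂ (fun r hr => ?_) fun r hr => ?_) (p := p)
      (show place n A B f y x ≤ p by omega) (show p < place n A B f x y by omega)
    · rw [hlet r hr]; exact hr₁ r hr
    · rw [hlet r hr]; exact hr₂ r hr

end query

end Forest

end DistanceOracle

namespace RAM

/-! ### More derived expressions -/

/-- Implication. -/
def Ex.imp (a b : Ex .prop) : Ex .prop := (a.and b.not).not

/-- Equivalence. -/
def Ex.iff (a b : Ex .prop) : Ex .prop := (a.imp b).and (b.imp a)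

/-- Local definition of a word. -/
def Ex.letw (x : Fin 64) (e body : Ex .word) : Ex .word :=
  .sum x (e + 1) (.ind ((Ex.var x).eq e) * body)

section eval

variable (σ : State)

@[simp] theorem Ex.eval_imp (a b : Ex .prop) : (a.imp b).eval σ ↔ (a.eval σ → b.eval σ) := by
  simp [Ex.imp]

@[simp] theorem Ex.eval_iff (a b : Ex .prop) : (a.iff b).eval σ ↔ (a.eval σ ↔ b.eval σ) := by
  simp [Ex.iff, iff_iff_implies_and_implies]

/-- Only one term of the sum is nonzero. The hypothesis says that `e` does not depend on the
summation variable `x`. -/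
theorem Ex.eval_letw {x : Fin 64} {e : Ex .word} (body : Ex .word)
    (h : ∀ i, e.eval (σ.setw x i) = e.eval σ) :
    (Ex.letw x e body).eval σ = body.eval (σ.setw x (e.eval σ)) := by
  classical
  simp only [Ex.letw, Ex.eval_sum, Ex.eval_mul, Ex.eval_ind, Ex.eval_eq, Ex.eval_var,
    State.setw_wreg_same, h, Ex.eval_add, Ex.eval_ofNat]
  rw [Finset.sum_eq_single (e.eval σ)]
  · simp
  · intro b _ hb
    simp [hb]
  · intro hb
    exact absurd (Finset.mem_range.2 (Nat.lt_succ_self _)) hb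

end eval

end RAM

namespace DistanceOracle

open RAM Finset

/-! ### The table of the carvings -/

/-- The index of a time and a point of a tree in the table of the carvings. -/
def codeIndex (S f i t x : ℕ) : ℕ := ((f * S + i) * S + t) * S + x

/-- Carved points, according to the table. -/
def carved (σ : State) (f i t x : ℕ) : Prop := σ.wa 1 (codeIndex σ.cap f i t x) % 2 = 1

/-- Points near the boundary, according to the table. -/
def edge (σ : State) (f i t x : ℕ) : Prop := σ.wa 1 (codeIndex σ.cap f i t x) / 2 = 1

/-- The points of a tree, according to the table. -/
def inTree (σ : State) (f i x : ℕ) : Prop :=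
  ∀ i' < i, ∃ t < σ.wreg 0 * (σ.wreg 0 * σ.wreg 0), edge σ f i' t x

/-- The distance matrix in the memory. -/
def memDist (σ : State) (x y : ℕ) : ℝ := σ.rmem (x * σ.wreg 0 + y)

section setw

variable (σ : State) {x : ℕ} (hx : x ≠ 0) (i : ℕ)
include hx

theorem carved_setw : carved (σ.setw x i) = carved σ := by
  funext f i t y
  simp [carved, State.cap_setw _ hx, State.wa_setw _ hx]

theorem edge_setw : edge (σ.setw x i) = edge σ := by
  funext f i t y
  simp [edge, State.cap_setw _ hx, State.wa_setw _ hx]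

theorem inTree_setw : inTree (σ.setw x i) = inTree σ := by
  funext f i y
  simp [inTree, edge_setw _ hx, State.setw_wreg, hx.symm]

theorem memDist_setw : memDist (σ.setw x i) = memDist σ := by
  funext y z
  simp [memDist, hx.symm, State.setw]

end setw

namespace Build

/-- The number of points. -/
def nE : Ex .word := .var 0

/-- The number of rounds. -/
def roundsE : Ex .word := nE * nE

/-- The number of times. -/
def timesE : Ex .word := nE * roundsE

/-- The distance of two points. -/
def distE (x y : Ex .word) : Ex .real := .rread (x * nE + y)

/-- The entry of the table of the carvings. -/
def codeE (f i t x : Ex .word) : Ex .word :=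
  .rd 1 (((f * Ex.cap + i) * Ex.cap + t) * Ex.cap + x)

/-- Carved points. -/
def carvedE (f i t x : Ex .word) : Ex .prop := (codeE f i t x % 2).eq 1

/-- Points near the boundary. -/
def edgeE (f i t x : Ex .word) : Ex .prop := (codeE f i t x / 2).eq 1

/-- The points of tree `3` in family `2`. -/
def inTreeE (x : Fin 64) : Ex .prop :=
  .all 62 (.var 3) (.exs 63 timesE (edgeE (.var 2) (.var 62) (.var 63) (.var x)))

/-- The free points at time `4`. -/
def freeE (x : Fin 64) : Ex .prop :=
  (inTreeE x).and (.all 60 (.var 4) ((Ex.wle (nE * (.var 4 / nE)) (.var 60)).imp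
    (carvedE (.var 2) (.var 3) (.var 60) (.var x)).not))

/-- Points that are not separated before time `4`. -/
def sameE (x y : Fin 64) : Ex .prop :=
  .all 60 (.var 4) ((carvedE (.var 2) (.var 3) (.var 60) (.var x)).iff
    (carvedE (.var 2) (.var 3) (.var 60) (.var y)))

/-- The points that are marked at time `4`. -/
def markedE (x : Fin 64) : Ex .prop :=
  (inTreeE x).and (.all 60 (.var 4) (edgeE (.var 2) (.var 3) (.var 60) (.var x)).not)

/-- The scale of a round of family `2`. -/
def scaleE (s : Ex .word) : Ex .real := .rrd 0 (.var 2 + 16 * (roundsE - 1 - s))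

/-- The radius of a round. -/
def radiusE (s : Ex .word) : Ex .real :=
  .rite (s.lt roundsE) ((4 * .rvar 0 + 6 / 5) * scaleE s) 0

/-- Half the width of the boundary in a round. -/
def widthE (s : Ex .word) : Ex .real := .rite (s.lt roundsE) (6 / 5 * scaleE s) 0

/-- The `a`-th radius at time `4`. -/
def ringE (a : Ex .word) : Ex .real :=
  radiusE (.var 4 / nE + 1) + 2 * widthE (.var 4 / nE) * .cast a

/-- The number of marked points of the class of `u` in the `a`-th ball. -/
def countE (u : Fin 64) (a : Ex .word) : Ex .word :=
  .sum 50 nE (.ind (((markedE 50).and (sameE u 50)).and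
    (Ex.rle (distE (.var u) (.var 50)) (ringE a))))

/-- The number of radii. -/
def radiiE : Ex .word := .sum 44 nE (.ind (Ex.rlt (.cast (.var 44)) (.rvar 0)))

/-- The centre. -/
def centreE : Ex .word :=
  .least 40 nE ((freeE 40).and (.all 41 nE ((freeE 41).imp (.wle (countE 41 0) (countE 40 0)))))

/-- The number of the ball around the centre `6`. -/
def ballE : Ex .word :=
  .least 42 radiiE (.all 43 radiiE (.wle (countE 6 (.var 42 + 1) * countE 6 (.var 43))
    (countE 6 (.var 43 + 1) * countE 6 (.var 42))))

/-- The point `5` is carved. -/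
def carveE : Ex .prop :=
  (freeE 5).and ((sameE 6 5).and
    (.rle (distE (.var 6) (.var 5)) (ringE (.var 7) + widthE (.var 4 / nE))))

/-- The point `5` is near the boundary. -/
def edgeNowE : Ex .prop :=
  (freeE 5).and ((sameE 6 5).and ((Ex.rlt (ringE (.var 7)) (distE (.var 6) (.var 5))).and
    (.rle (distE (.var 6) (.var 5)) (ringE (.var 7 + 1)))))

/-- The table of the carvings. -/
def codeTable : Ex .word :=
  .letw 2 (.var 1 / Ex.cap.pow 3) <| .letw 3 (.var 1 / Ex.cap.pow 2 % Ex.cap) <|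
  .letw 4 (.var 1 / Ex.cap % Ex.cap) <| .letw 5 (.var 1 % Ex.cap) <|
  .letw 6 centreE <| .letw 7 ballE <| .ind carveE + 2 * .ind edgeNowE

section eval

variable (σ : State)

@[simp] theorem eval_nE : nE.eval σ = σ.wreg 0 := rfl

@[simp] theorem eval_roundsE : roundsE.eval σ = (σ.wreg 0 * σ.wreg 0 : ℕ) := rfl

@[simp] theorem eval_timesE : timesE.eval σ = (σ.wreg 0 * (σ.wreg 0 * σ.wreg 0) : ℕ) := rfl

@[simp] theorem eval_distE (x y : Ex .word) :
    (distE x y).eval σ = memDist σ (x.eval σ) (y.eval σ) := rfl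

@[simp] theorem eval_codeE (f i t x : Ex .word) : (codeE f i t x).eval σ =
    σ.wa 1 (codeIndex σ.cap (f.eval σ) (i.eval σ) (t.eval σ) (x.eval σ)) := by
  simp [codeE, codeIndex]

@[simp] theorem eval_carvedE (f i t x : Ex .word) : (carvedE f i t x).eval σ ↔
    carved σ (f.eval σ) (i.eval σ) (t.eval σ) (x.eval σ) := by
  simp [carvedE, carved]

@[simp] theorem eval_edgeE (f i t x : Ex .word) : (edgeE f i t x).eval σ ↔
    edge σ (f.eval σ) (i.eval σ) (t.eval σ) (x.eval σ) := by
  simp [edgeE, edge]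

theorem eval_inTreeE {x : Fin 64} (hx : (x : ℕ) < 60) :
    (inTreeE x).eval σ ↔ inTree σ (σ.wreg 2) (σ.wreg 3) (σ.wreg x) := by
  have h1 : (x : ℕ) ≠ 62 := by omega
  have h2 : (x : ℕ) ≠ 63 := by omega
  simp [inTreeE, inTree, State.setw_wreg, edge_setw, h1, h2]

theorem eval_freeE {x : Fin 64} (hx : (x : ℕ) < 60) : (freeE x).eval σ ↔
    Free (σ.wreg 0) (inTree σ (σ.wreg 2) (σ.wreg 3)) (carved σ (σ.wreg 2) (σ.wreg 3)) (σ.wreg 4)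
      (σ.wreg x) := by
  have h1 : (x : ℕ) ≠ 60 := by omega
  simp [freeE, Free, eval_inTreeE σ hx, State.setw_wreg, carved_setw, h1]

theorem eval_sameE {x y : Fin 64} (hx : (x : ℕ) < 60) (hy : (y : ℕ) < 60) : (sameE x y).eval σ ↔
    Same (carved σ (σ.wreg 2) (σ.wreg 3)) (σ.wreg 4) (σ.wreg x) (σ.wreg y) := by
  have h1 : (x : ℕ) ≠ 60 := by omega
  have h2 : (y : ℕ) ≠ 60 := by omega
  simp [sameE, Same, State.setw_wreg, carved_setw, h1, h2]

theorem eval_markedE {x : Fin 64} (hx : (x : ℕ) < 60) : (markedE x).eval σ ↔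
    Marked (inTree σ (σ.wreg 2) (σ.wreg 3)) (edge σ (σ.wreg 2) (σ.wreg 3)) (σ.wreg 4)
      (σ.wreg x) := by
  have h1 : (x : ℕ) ≠ 60 := by omega
  simp [markedE, Marked, eval_inTreeE σ hx, State.setw_wreg, edge_setw, h1]

@[simp] theorem eval_radiusE (s : Ex .word) : (radiusE s).eval σ =
    radius (σ.rreg 0) (σ.ra 0) (σ.wreg 0 * σ.wreg 0) (σ.wreg 2) (s.eval σ) := by
  simp [radiusE, scaleE, radius]

@[simp] theorem eval_widthE (s : Ex .word) : (widthE s).eval σ =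
    width (σ.ra 0) (σ.wreg 0 * σ.wreg 0) (σ.wreg 2) (s.eval σ) := by
  simp [widthE, scaleE, width]

/-- The `a`-th radius at time `t` of family `f`. -/
noncomputable def ring (σ : State) (f t a : ℕ) : ℝ :=
  radius (σ.rreg 0) (σ.ra 0) (σ.wreg 0 * σ.wreg 0) f (t / σ.wreg 0 + 1) +
    2 * width (σ.ra 0) (σ.wreg 0 * σ.wreg 0) f (t / σ.wreg 0) * a

@[simp] theorem eval_ringE (a : Ex .word) :
    (ringE a).eval σ = ring σ (σ.wreg 2) (σ.wreg 4) (a.eval σ) := by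
  simp [ringE, ring]

theorem ra_setw {x : ℕ} (hx : x ≠ 0) (i k : ℕ) : (σ.setw x i).ra k = σ.ra k :=
  funext fun _ => State.ra_setw _ hx _ _ _

theorem wa_setw {x : ℕ} (hx : x ≠ 0) (i k : ℕ) : (σ.setw x i).wa k = σ.wa k :=
  funext fun _ => State.wa_setw _ hx _ _ _

theorem ring_setw {x : ℕ} (hx : x ≠ 0) (i : ℕ) : ring (σ.setw x i) = ring σ := by
  funext f t a
  simp [ring, State.setw_wreg, hx.symm, ra_setw _ hx]

theorem eval_countE {u : Fin 64} (hu : (u : ℕ) < 50) {a : Ex .word}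
    (ha : ∀ i, a.eval (σ.setw 50 i) = a.eval σ) : (countE u a).eval σ =
    markCard (σ.wreg 0) (memDist σ) (inTree σ (σ.wreg 2) (σ.wreg 3))
      (carved σ (σ.wreg 2) (σ.wreg 3)) (edge σ (σ.wreg 2) (σ.wreg 3)) (σ.wreg 4) (σ.wreg u)
      (ring σ (σ.wreg 2) (σ.wreg 4) (a.eval σ)) := by
  classical
  have h1 : (u : ℕ) ≠ 50 := by omega
  rw [markCard, card_filter]
  simp only [countE, Ex.eval_sum]
  refine sum_congr rfl fun z _ => ?_
  simp [eval_markedE, eval_sameE _ (show (u : ℕ) < 60 by omega), State.setw_wreg, h1,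
    inTree_setw, edge_setw, carved_setw, memDist_setw, ring_setw, ha]

@[simp] theorem eval_radiiE : radiiE.eval σ = radii (σ.wreg 0) (σ.rreg 0) := by
  simp [radiiE, radii]

end eval

end Build

end DistanceOracle

namespace DistanceOracle

open RAM Finset

/-! ### Choice of the centre and of the radius -/

section choice

variable (n K : ℕ) (d : ℕ → ℕ → ℝ) (X : ℕ → Prop) (A B : ℕ → ℕ → Prop) (t : ℕ)

/-- A free point whose ball has the largest number of marked points. -/
noncomputable def centre (r : ℝ) : ℕ := least n fun v => Free n X A t v ∧
  ∀ u < n, Free n X A t u → markCard n d X A B t u r ≤ markCard n d X A B t v r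

/-- The ball that grows by the smallest factor. -/
noncomputable def ball (v : ℕ) (r : ℕ → ℝ) : ℕ := least K fun j => ∀ i < K,
  markCard n d X A B t v (r (j + 1)) * markCard n d X A B t v (r i) ≤
    markCard n d X A B t v (r (i + 1)) * markCard n d X A B t v (r j)

variable {n K d X A B t}

theorem centre_spec {r : ℝ} (h : ∃ x < n, Free n X A t x) :
    centre n d X A B t r < n ∧ Free n X A t (centre n d X A B t r) ∧ ∀ u < n, Free n X A t u →
      markCard n d X A B t u r ≤ markCard n d X A B t (centre n d X A B t r) r := by
  classical
  obtain ⟨x, hx, hf⟩ := h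
  obtain ⟨v, hv, hmax⟩ := exists_max_image {u ∈ range n | Free n X A t u}
    (fun u => markCard n d X A B t u r) ⟨x, mem_filter.2 ⟨mem_range.2 hx, hf⟩⟩
  rw [mem_filter, mem_range] at hv
  have := least_spec (m := n) (P := fun v => Free n X A t v ∧ ∀ u < n, Free n X A t u →
    markCard n d X A B t u r ≤ markCard n d X A B t v r)
    ⟨v, hv.1, hv.2, fun u hu hf => hmax u (mem_filter.2 ⟨mem_range.2 hu, hf⟩)⟩
  exact ⟨this.1, this.2.1⟩

/-- Minimize the quotient over the `i` with `m i ≠ 0`. In the product form, indices with `m i = 0`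
impose no condition, and if all of them vanish every `j` will do. -/
theorem exists_min_ratio {m : ℕ → ℕ} (hK : 0 < K) :
    ∃ j < K, ∀ i < K, m (j + 1) * m i ≤ m (i + 1) * m j := by
  classical
  by_cases h0 : ∃ i < K, 0 < m i
  · obtain ⟨i, hi, hi0⟩ := h0
    obtain ⟨j, hj, hmin⟩ := exists_min_image {i ∈ range K | 0 < m i}
      (fun i => (m (i + 1) : ℝ) / m i) ⟨i, mem_filter.2 ⟨mem_range.2 hi, hi0⟩⟩
    rw [mem_filter, mem_range] at hj
    refine ⟨j, hj.1, fun i hi => ?_⟩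
    rcases Nat.eq_zero_or_pos (m i) with h | h
    · rw [h, mul_zero]; exact Nat.zero_le _
    · have h1 := hmin i (mem_filter.2 ⟨mem_range.2 hi, h⟩)
      rw [div_le_div_iff₀ (by exact_mod_cast hj.2) (by exact_mod_cast h)] at h1
      exact_mod_cast h1
  · push Not at h0
    refine ⟨0, hK, fun i hi => ?_⟩
    rw [Nat.le_zero.1 (h0 i hi), mul_zero]
    exact Nat.zero_le _

theorem ball_spec {v : ℕ} {r : ℕ → ℝ} (hK : 0 < K) :
    ball n K d X A B t v r < K ∧ ∀ i < K,
    markCard n d X A B t v (r (ball n K d X A B t v r + 1)) * markCard n d X A B t v (r i) ≤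
    markCard n d X A B t v (r (i + 1)) * markCard n d X A B t v (r (ball n K d X A B t v r)) := by
  have := least_spec (exists_min_ratio (m := fun i => markCard n d X A B t v (r i)) hK)
  exact ⟨this.1, this.2.1⟩

end choice

/-! ### Congruence -/

section congr

variable {n K t : ℕ} {d d' : ℕ → ℕ → ℝ} {X X' : ℕ → Prop} {A A' B B' : ℕ → ℕ → Prop}
  (hd : ∀ x < n, ∀ y < n, d x y = d' x y) (hX : ∀ x < n, (X x ↔ X' x))
  (hA : ∀ s < t, ∀ x < n, (A s x ↔ A' s x)) (hB : ∀ s < t, ∀ x < n, (B s x ↔ B' s x))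

-- An entry of the table of the carvings is computed while the table is only partly filled. The
-- decisions at time `t` depend only on earlier times, on points below `n` and, through `X`, on
-- earlier trees, so they come out as they would with the final table.
include hX hA in
theorem free_congr {x : ℕ} (hx : x < n) : Free n X A t x ↔ Free n X' A' t x :=
  and_congr (hX x hx) (forall₂_congr fun s hs => imp_congr_right fun _ => not_congr (hA s hs x hx))

include hA in
theorem same_congr {x y : ℕ} (hx : x < n) (hy : y < n) : Same A t x y ↔ Same A' t x y :=
  forall₂_congr fun s hs => by rw [hA s hs x hx, hA s hs y hy]

include hX hB in
theorem marked_congr {x : ℕ} (hx : x < n) : Marked X B t x ↔ Marked X' B' t x :=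
  and_congr (hX x hx) (forall₂_congr fun s hs => not_congr (hB s hs x hx))

include hd hX hA hB

theorem markCard_congr {u : ℕ} (hu : u < n) (r : ℝ) :
    markCard n d X A B t u r = markCard n d' X' A' B' t u r := by
  classical
  rw [markCard, markCard]
  congr 1
  refine filter_congr fun z hz => ?_
  have hz := mem_range.1 hz
  rw [marked_congr hX hB hz, same_congr hA hu hz, hd u hu z hz]

theorem centre_congr (r : ℝ) : centre n d X A B t r = centre n d' X' A' B' t r := by
  refine least_congr fun v hv => ?_
  rw [free_congr hX hA hv]
  refine and_congr_right fun _ => forall₂_congr fun u hu => ?_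
  rw [free_congr hX hA hu, markCard_congr hd hX hA hB hu, markCard_congr hd hX hA hB hv]

theorem ball_congr {v : ℕ} (hv : v < n) (r : ℕ → ℝ) :
    ball n K d X A B t v r = ball n K d' X' A' B' t v r := by
  simp only [ball, markCard_congr hd hX hA hB hv]

end congr

namespace Build

section eval

variable (σ : State)

theorem eval_centreE : centreE.eval σ = centre (σ.wreg 0) (memDist σ)
    (inTree σ (σ.wreg 2) (σ.wreg 3)) (carved σ (σ.wreg 2) (σ.wreg 3))
    (edge σ (σ.wreg 2) (σ.wreg 3)) (σ.wreg 4) (ring σ (σ.wreg 2) (σ.wreg 4) 0) := by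
  simp [centreE, centre, eval_freeE, eval_countE _ _ (a := 0) fun _ => rfl, State.setw_wreg, inTree_setw, edge_setw,
    carved_setw, memDist_setw, ring_setw]

theorem eval_ballE : ballE.eval σ = ball (σ.wreg 0) (radii (σ.wreg 0) (σ.rreg 0)) (memDist σ)
    (inTree σ (σ.wreg 2) (σ.wreg 3)) (carved σ (σ.wreg 2) (σ.wreg 3))
    (edge σ (σ.wreg 2) (σ.wreg 3)) (σ.wreg 4) (σ.wreg 6) (ring σ (σ.wreg 2) (σ.wreg 4)) := by
  simp [ballE, ball, eval_countE, State.setw_wreg, inTree_setw, edge_setw,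
    carved_setw, memDist_setw, ring_setw]

theorem eval_carveE : carveE.eval σ ↔
    Free (σ.wreg 0) (inTree σ (σ.wreg 2) (σ.wreg 3)) (carved σ (σ.wreg 2) (σ.wreg 3)) (σ.wreg 4)
      (σ.wreg 5) ∧ Same (carved σ (σ.wreg 2) (σ.wreg 3)) (σ.wreg 4) (σ.wreg 6) (σ.wreg 5) ∧
    memDist σ (σ.wreg 6) (σ.wreg 5) ≤ ring σ (σ.wreg 2) (σ.wreg 4) (σ.wreg 7) +
      width (σ.ra 0) (σ.wreg 0 * σ.wreg 0) (σ.wreg 2) (σ.wreg 4 / σ.wreg 0) := by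
  simp [carveE, eval_freeE, eval_sameE]

theorem eval_edgeNowE : edgeNowE.eval σ ↔
    Free (σ.wreg 0) (inTree σ (σ.wreg 2) (σ.wreg 3)) (carved σ (σ.wreg 2) (σ.wreg 3)) (σ.wreg 4)
      (σ.wreg 5) ∧ Same (carved σ (σ.wreg 2) (σ.wreg 3)) (σ.wreg 4) (σ.wreg 6) (σ.wreg 5) ∧
    ring σ (σ.wreg 2) (σ.wreg 4) (σ.wreg 7) < memDist σ (σ.wreg 6) (σ.wreg 5) ∧
    memDist σ (σ.wreg 6) (σ.wreg 5) ≤ ring σ (σ.wreg 2) (σ.wreg 4) (σ.wreg 7 + 1) := by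
  simp [edgeNowE, eval_freeE, eval_sameE]

/-- The centre at time `t`. -/
noncomputable def centreAt (σ : State) (f i t : ℕ) : ℕ :=
  centre (σ.wreg 0) (memDist σ) (inTree σ f i) (carved σ f i) (edge σ f i) t (ring σ f t 0)

/-- The number of the ball at time `t`. -/
noncomputable def ballAt (σ : State) (f i t : ℕ) : ℕ :=
  ball (σ.wreg 0) (radii (σ.wreg 0) (σ.rreg 0)) (memDist σ) (inTree σ f i) (carved σ f i)
    (edge σ f i) t (centreAt σ f i t) (ring σ f t)

/-- The point `x` is carved at time `t`. -/
def Carve (σ : State) (f i t x : ℕ) : Prop :=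
  Free (σ.wreg 0) (inTree σ f i) (carved σ f i) t x ∧ Same (carved σ f i) t (centreAt σ f i t) x ∧
    memDist σ (centreAt σ f i t) x ≤ ring σ f t (ballAt σ f i t) +
      width (σ.ra 0) (σ.wreg 0 * σ.wreg 0) f (t / σ.wreg 0)

/-- The point `x` is near the boundary at time `t`. -/
def Border (σ : State) (f i t x : ℕ) : Prop :=
  Free (σ.wreg 0) (inTree σ f i) (carved σ f i) t x ∧ Same (carved σ f i) t (centreAt σ f i t) x ∧
    ring σ f t (ballAt σ f i t) < memDist σ (centreAt σ f i t) x ∧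
    memDist σ (centreAt σ f i t) x ≤ ring σ f t (ballAt σ f i t + 1)

-- Register `1` is read in base `cap` as family, tree, time and point. The low bit of an entry
-- records the carving and the next bit the boundary.
open Classical in
theorem eval_codeTable {f i t x : ℕ} (hf : σ.wreg 1 / σ.cap ^ 3 = f)
    (hi : σ.wreg 1 / σ.cap ^ 2 % σ.cap = i) (ht : σ.wreg 1 / σ.cap % σ.cap = t)
    (hx : σ.wreg 1 % σ.cap = x) : codeTable.eval σ =
      (if Carve σ f i t x then 1 else 0) + if Border σ f i t x then 2 else 0 := by
  rw [codeTable, Ex.eval_letw, Ex.eval_letw, Ex.eval_letw, Ex.eval_letw, Ex.eval_letw,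
    Ex.eval_letw]
  · generalize hφ : State.setw _ _ _ = φ
    have h1 : carveE.eval φ ↔ Carve σ f i t x := by
      rw [← hφ]
      simp [eval_centreE, eval_ballE, eval_carveE, State.cap_setw, State.setw_wreg, inTree_setw,
        edge_setw, carved_setw, memDist_setw, ring_setw, ra_setw, hf, hi, ht, hx, Carve, centreAt,
        ballAt]
    have h2 : edgeNowE.eval φ ↔ Border σ f i t x := by
      rw [← hφ]
      simp [eval_centreE, eval_ballE, eval_edgeNowE, State.cap_setw, State.setw_wreg, inTree_setw,
        edge_setw, carved_setw, memDist_setw, ring_setw, hf, hi, ht, hx, Border, centreAt,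
        ballAt]
    simp [h1, h2]
  · intro i
    simp [eval_ballE, State.setw_wreg, inTree_setw, edge_setw, carved_setw, memDist_setw,
      ring_setw]
  · intro i
    simp [eval_centreE, State.setw_wreg, inTree_setw, edge_setw, carved_setw, memDist_setw,
      ring_setw]
  all_goals
    intro i
    simp [State.cap_setw, State.setw_wreg]

end eval

end Build

end DistanceOracle

/-! ### Reading entries from the state in which all tables are complete -/

namespace RAM

namespace Before

variable {k u : ℕ} {τ ψ : State} (h : Before k u τ ψ)
include h

theorem wreg_zero : ψ.wreg 0 = τ.wreg 0 := by rw [h.wreg]; rfl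
theorem wreg_one : ψ.wreg 1 = u := by rw [h.wreg]; rfl
theorem rreg_eq : ψ.rreg = τ.rreg := h.rreg
theorem cap_eq : ψ.cap = τ.cap := by rw [SameBut.cap h, State.cap_setw _ one_ne_zero]

theorem rmem_eq {a : ℕ} (ha : a < τ.cap) : ψ.rmem a = τ.rmem a :=
  h.rflat a (by rwa [State.cap_setw _ one_ne_zero])

theorem wa_eq {k' : ℕ} (hk : k' < k) : ψ.wa k' = τ.wa k' :=
  funext fun u' => (h.wa k' u' (.inl hk)).trans (State.wa_setw _ one_ne_zero _ _ _)

theorem ra_eq {k' : ℕ} (hk : k' < k) : ψ.ra k' = τ.ra k' :=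
  funext fun u' => (h.ra k' u' (.inl hk)).trans (State.ra_setw _ one_ne_zero _ _ _)

theorem wa_lt {u' : ℕ} (hu : u' < u) : ψ.wa k u' = τ.wa k u' :=
  (h.wa k u' (.inr ⟨rfl, hu⟩)).trans (State.wa_setw _ one_ne_zero _ _ _)

theorem ra_lt {u' : ℕ} (hu : u' < u) : ψ.ra k u' = τ.ra k u' :=
  (h.ra k u' (.inr ⟨rfl, hu⟩)).trans (State.ra_setw _ one_ne_zero _ _ _)

end Before

/-- Table `k` of words contains the values of an expression. -/
def State.HasWords (τ : State) (k : ℕ) (e : Ex .word) : Prop :=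
  ∀ u < τ.cap ^ 4, ∃ ψ, Before k u τ ψ ∧ τ.wa k u = (e.eval ψ : ℕ) % τ.cap

/-- Table `k` of reals contains the values of an expression. -/
def State.HasReals (τ : State) (k : ℕ) (e : Ex .real) : Prop :=
  ∀ u < τ.cap ^ 4, ∃ ψ, Before k u τ ψ ∧ τ.ra k u = e.eval ψ

theorem State.cap_eq (σ : State) : σ.cap = (σ.wreg 0 + 1) ^ 12 := by rw [State.cap]

theorem State.pow_le_cap (σ : State) {k : ℕ} (hk : k ≤ 12) : (σ.wreg 0 + 1) ^ k ≤ σ.cap := by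
  rw [State.cap_eq]
  exact Nat.pow_le_pow_right (Nat.succ_pos _) hk

theorem State.wreg_lt_cap (σ : State) : σ.wreg 0 < σ.cap := by
  have := σ.pow_le_cap (k := 1) (by norm_num)
  rw [pow_one] at this
  omega

theorem State.square_lt_cap (σ : State) : σ.wreg 0 * σ.wreg 0 < σ.cap := by
  have := σ.pow_le_cap (k := 2) (by norm_num)
  nlinarith

theorem State.cube_lt_cap (σ : State) : σ.wreg 0 * (σ.wreg 0 * σ.wreg 0) < σ.cap := by
  have h := σ.pow_le_cap (k := 3) (by norm_num)
  refine lt_of_lt_of_le ?_ h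
  rw [show σ.wreg 0 * (σ.wreg 0 * σ.wreg 0) = σ.wreg 0 ^ 3 by ring]
  exact Nat.pow_lt_pow_left (Nat.lt_succ_self _) (by norm_num)

/-- Ten of the twelve factors of the capacity are at least `2` and give `1024`; the other two
remain. -/
theorem State.le_cap (σ : State) (hn : 1 ≤ σ.wreg 0) :
    1024 * ((σ.wreg 0 + 1) * (σ.wreg 0 + 1)) ≤ σ.cap := by
  rw [State.cap_eq]
  calc 1024 * ((σ.wreg 0 + 1) * (σ.wreg 0 + 1)) = 2 ^ 10 * (σ.wreg 0 + 1) ^ 2 := by ring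
    _ ≤ (σ.wreg 0 + 1) ^ 10 * (σ.wreg 0 + 1) ^ 2 :=
        Nat.mul_le_mul_right _ (Nat.pow_le_pow_left (by omega) _)
    _ = _ := by ring

end RAM

/-! ### Packing family, tree, time and point into one index -/

namespace DistanceOracle

open RAM Finset

section codeIndex

variable {S f i t x : ℕ}

theorem codeIndex_lt (hf : f < S) (hi : i < S) (ht : t < S) (hx : x < S) :
    codeIndex S f i t x < S ^ 4 := by
  have step : ∀ {a b m : ℕ}, a < m → b < S → a * S + b < m * S := by
    intro a b m ha hb
    have := Nat.mul_le_mul_right S (show a + 1 ≤ m from ha)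
    rw [Nat.add_mul, one_mul] at this
    omega
  have := step (step (step hf hi) ht) hx
  rw [codeIndex, show S ^ 4 = S * S * S * S by ring]
  exact this

theorem codeIndex_mod (hx : x < S) : codeIndex S f i t x % S = x := by
  rw [codeIndex, mul_comm, Nat.mul_add_mod, Nat.mod_eq_of_lt hx]

theorem codeIndex_div (hx : x < S) : codeIndex S f i t x / S = (f * S + i) * S + t := by
  rw [codeIndex, mul_comm, Nat.mul_add_div (by omega), Nat.div_eq_of_lt hx, add_zero, mul_comm]

theorem codeIndex_time (ht : t < S) (hx : x < S) : codeIndex S f i t x / S % S = t := by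
  rw [codeIndex_div hx, mul_comm, Nat.mul_add_mod, Nat.mod_eq_of_lt ht]

theorem codeIndex_div_sq (ht : t < S) (hx : x < S) : codeIndex S f i t x / S ^ 2 = f * S + i := by
  rw [pow_two, ← Nat.div_div_eq_div_mul, codeIndex_div hx, mul_comm, Nat.mul_add_div (by omega),
    Nat.div_eq_of_lt ht, add_zero, mul_comm]

theorem codeIndex_tree (hi : i < S) (ht : t < S) (hx : x < S) :
    codeIndex S f i t x / S ^ 2 % S = i := by
  rw [codeIndex_div_sq ht hx, mul_comm, Nat.mul_add_mod, Nat.mod_eq_of_lt hi]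

theorem codeIndex_family (hi : i < S) (ht : t < S) (hx : x < S) :
    codeIndex S f i t x / S ^ 3 = f := by
  rw [pow_succ, ← Nat.div_div_eq_div_mul, codeIndex_div_sq ht hx, mul_comm,
    Nat.mul_add_div (by omega), Nat.div_eq_of_lt hi, add_zero]

/-- The time is more significant than the point in the index, so the entries that a decision
consults precede it in the table whatever their points are. -/
theorem codeIndex_lt_time {s y : ℕ} (hs : s < t) (hy : y < S) :
    codeIndex S f i s y < codeIndex S f i t x := by
  have := Nat.mul_le_mul_right S (show (f * S + i) * S + s + 1 ≤ (f * S + i) * S + t by omega)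
  rw [Nat.add_mul _ 1, one_mul] at this
  rw [codeIndex, codeIndex]
  omega

theorem codeIndex_lt_tree {i' s y : ℕ} (hi : i' < i) (hs : s < S) (hy : y < S) :
    codeIndex S f i' s y < codeIndex S f i t x := by
  have h1 := Nat.mul_le_mul_right S (show f * S + i' + 1 ≤ f * S + i by omega)
  rw [Nat.add_mul _ 1, one_mul] at h1
  have h2 := Nat.mul_le_mul_right S
    (show (f * S + i') * S + s + 1 ≤ (f * S + i) * S + t by omega)
  rw [Nat.add_mul _ 1, one_mul] at h2
  rw [codeIndex, codeIndex]
  omega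

end codeIndex

namespace Build

/-- The points carved at time `t`, with the final tables. -/
theorem carved_iff {τ : State} (h : τ.HasWords 1 codeTable) {f i t x : ℕ} (hn : 1 ≤ τ.wreg 0)
    (hf : f < 16) (hi : i < τ.wreg 0) (ht : t < τ.wreg 0 * (τ.wreg 0 * τ.wreg 0))
    (hx : x < τ.wreg 0) :
    (carved τ f i t x ↔ Carve τ f i t x) ∧ (edge τ f i t x ↔ Border τ f i t x) := by
  have hS := τ.wreg_lt_cap
  have hS3 := τ.cube_lt_cap
  have hS2 := τ.square_lt_cap
  have hS' := τ.le_cap hn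
  have h16 : 16 < τ.cap := by nlinarith
  obtain ⟨ψ, hb, hw⟩ := h (codeIndex τ.cap f i t x)
    (codeIndex_lt (by omega) (by omega) (by omega) (by omega))
  have e0 := hb.wreg_zero
  have e1 := hb.wreg_one
  have ec := hb.cap_eq
  rw [eval_codeTable ψ (f := f) (i := i) (t := t) (x := x)
    (by rw [e1, ec, codeIndex_family] <;> omega) (by rw [e1, ec, codeIndex_tree] <;> omega)
    (by rw [e1, ec, codeIndex_time] <;> omega) (by rw [e1, ec, codeIndex_mod]; omega)] at hw
  have hd : ∀ a < τ.wreg 0, ∀ b < τ.wreg 0, memDist ψ a b = memDist τ a b := by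
    intro a ha b hb'
    rw [memDist, memDist, e0]
    refine hb.rmem_eq ?_
    have := Nat.mul_le_mul_right (τ.wreg 0) (show a + 1 ≤ τ.wreg 0 from ha)
    rw [Nat.add_mul, one_mul] at this
    omega
  have hA : ∀ s < t, ∀ y < τ.wreg 0, (carved ψ f i s y ↔ carved τ f i s y) := by
    intro s hs y hy
    rw [carved, carved, ec, hb.wa_lt (codeIndex_lt_time hs (by omega))]
  have hB : ∀ s < t, ∀ y < τ.wreg 0, (edge ψ f i s y ↔ edge τ f i s y) := by
    intro s hs y hy
    rw [edge, edge, ec, hb.wa_lt (codeIndex_lt_time hs (by omega))]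
  have hX : ∀ y < τ.wreg 0, (inTree ψ f i y ↔ inTree τ f i y) := by
    intro y hy
    rw [inTree, inTree, e0]
    refine forall₂_congr fun i' hi' => exists_congr fun s => and_congr_right fun hs => ?_
    rw [edge, edge, ec, hb.wa_lt (codeIndex_lt_tree hi' (by omega) (by omega))]
  have hr : ring ψ f t = ring τ f t := by
    funext a
    rw [ring, ring, e0, hb.rreg_eq, hb.ra_eq one_pos]
  have hcen : centreAt ψ f i t = centreAt τ f i t := by
    rw [centreAt, centreAt, e0, hr, centre_congr hd hX hA hB]
  have hfree : Free (τ.wreg 0) (inTree ψ f i) (carved ψ f i) t x ↔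
      Free (τ.wreg 0) (inTree τ f i) (carved τ f i) t x := free_congr hX hA hx
  have hboth : (Carve ψ f i t x ↔ Carve τ f i t x) ∧ (Border ψ f i t x ↔ Border τ f i t x) := by
    rw [Carve, Carve, Border, Border, e0, hfree]
    -- For a free `x` the centre is a genuine point below `n`, to which the congruence lemmas apply.
    -- If `x` is not free, both sides are false whatever the centre is.
    by_cases hF : Free (τ.wreg 0) (inTree τ f i) (carved τ f i) t x
    · have hv : centreAt τ f i t < τ.wreg 0 := (centre_spec ⟨x, hx, hF⟩).1
      have hball : ballAt ψ f i t = ballAt τ f i t := by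
        rw [ballAt, ballAt, e0, hb.rreg_eq, hr, hcen, ball_congr hd hX hA hB hv]
      rw [hcen, hball, hr, hd _ hv _ hx, same_congr hA hv hx, hb.ra_eq one_pos]
      exact ⟨Iff.rfl, Iff.rfl⟩
    · simp [hF]
  have hmod : (3 : ℕ) < τ.cap := by omega
  constructor
  · rw [carved, hw, ← hboth.1]
    split_ifs with h1 h2 h2 <;>
      simp [Nat.mod_eq_of_lt, hmod, h1, show 1 < τ.cap by omega, show 2 < τ.cap by omega]
  · rw [edge, hw, ← hboth.2]
    split_ifs with h1 h2 h2 <;>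
      simp [Nat.mod_eq_of_lt, hmod, h2, show 1 < τ.cap by omega, show 2 < τ.cap by omega]

/-- Centre and ball were selected as least witnesses of just what a carving demands, and `inTree` is
by definition the condition on the points of a tree. -/
theorem family_of_table {τ : State} (h : τ.HasWords 1 codeTable) {f : ℕ} (hn : 1 ≤ τ.wreg 0)
    (hf : f < 16) (hk : 1 < τ.rreg 0) :
    Family (τ.wreg 0) (radii (τ.wreg 0) (τ.rreg 0)) (τ.wreg 0 * τ.wreg 0) (memDist τ)
      (radius (τ.rreg 0) (τ.ra 0) (τ.wreg 0 * τ.wreg 0) f)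
      (width (τ.ra 0) (τ.wreg 0 * τ.wreg 0) f) (inTree τ f) (carved τ f) (edge τ f) := by
  refine ⟨fun i hi => ⟨fun t ht => ⟨centreAt τ f i t, ballAt τ f i t, fun hex => ?_, ?_, ?_, ?_⟩⟩,
    fun i _ x _ => Iff.rfl⟩
  · have := centre_spec (d := memDist τ) (B := edge τ f i) (r := ring τ f t 0) hex
    simpa [ring, centreAt] using this
  · exact ball_spec (radii_pos hn hk)
  · exact fun x hx => (carved_iff h hn hf hi ht hx).1
  · exact fun x hx => (carved_iff h hn hf hi ht hx).2

end Build

end DistanceOracle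

namespace DistanceOracle

open RAM Finset

namespace Build

/-! ### The other tables -/

/-- The scale below which no distance counts. -/
def thresholdE : Ex .real := 6 / 5 * .rite ((Ex.var 1).eq 0) 0 (.rrd 0 (.var 1 - 1))

/-- The index of the next distance. -/
def nextE : Ex .word :=
  .least 40 (nE * nE) ((Ex.rlt thresholdE (.rread (.var 40))).and
    (.all 41 (nE * nE) ((Ex.rlt thresholdE (.rread (.var 41))).imp
      (.rle (.rread (.var 40)) (.rread (.var 41))))))

/-- The table of the scales. -/
def scaleTable : Ex .real := .rite (nextE.lt (nE * nE)) (.rread nextE) thresholdE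

/-- The table of the levels. -/
def levelTable : Ex .word :=
  .least 40 nE (Ex.exs 41 timesE (edgeE (.var 1 / nE) (.var 40) (.var 41) (.var 1 % nE))).not

/-- The table of the numbers of leaves before a point. -/
def baseTable : Ex .word := .sum 40 (.var 1) (.rd 2 (.var 40) + 1)

/-- The number of leaves. -/
def leavesE : Ex .word := .rd 3 (16 * nE)

/-- The table of the points of the leaves. -/
def ownerTable : Ex .word := .least 40 (16 * nE) ((Ex.var 1).lt (.rd 3 (.var 40 + 1)))

/-- The letters of a leaf. -/
def letterE (e s : Ex .word) : Ex .word :=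
  .ite (s.eq 0) (.rd 4 e / nE) <| .ite (s.eq 1) (e - .rd 3 (.rd 4 e)) <|
    .ite (s.eq (timesE + 2)) (.rd 4 e % nE) <|
    .ite (carvedE (.rd 4 e / nE) (e - .rd 3 (.rd 4 e)) (s - 2) (.rd 4 e % nE)) 0 1

/-- The table of the positions of the leaves. -/
def positionTable : Ex .word :=
  .sum 40 leavesE (.ind (.exs 41 (timesE + 3)
    ((Ex.all 42 (.var 41) ((letterE (.var 40) (.var 42)).eq (letterE (.var 1) (.var 42)))).and
      ((letterE (.var 40) (.var 41)).lt (letterE (.var 1) (.var 41))))))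

/-- The table of the leaves at the positions. -/
def leafTable : Ex .word := .least 40 leavesE ((Ex.rd 5 (.var 40)).eq (.var 1))

/-- The first letter where the leaves `2` and `3` differ. -/
def splitE : Ex .word :=
  .least 40 (timesE + 3) ((letterE (.var 2) (.var 40)).eq (letterE (.var 3) (.var 40))).not

/-- The leaf `e` agrees with leaf `2` in the first letters, whose number is `4`. -/
def classE (e : Ex .word) : Ex .prop :=
  .all 43 (.var 4) ((letterE (.var 2) (.var 43)).eq (letterE e (.var 43)))

/-- The pairs of leaves in the class. -/
def pairE (x : Fin 64) : Ex .prop := (classE (.var x / leavesE)).and (classE (.var x % leavesE))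

/-- The address of the distance of a pair of leaves. -/
def pairAddrE (x : Fin 64) : Ex .word :=
  .rd 4 (.var x / leavesE) % nE * nE + .rd 4 (.var x % leavesE) % nE

/-- The farthest pair of leaves of the class. -/
def farthestE : Ex .word :=
  .least 41 (leavesE * leavesE) ((pairE 41).and
    (.all 42 (leavesE * leavesE) ((pairE 42).imp
      (.rle (.rread (pairAddrE 42)) (.rread (pairAddrE 41))))))

/-- The table of the diameters. -/
def gapTable : Ex .real :=
  .rread <| .letw 2 (.rd 6 (.var 1)) <| .letw 3 (.rd 6 (.var 1 + 1)) <| .letw 4 splitE <|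
    .letw 5 farthestE <| pairAddrE 5

/-- The table of the powers of two. -/
def powTable : Ex .word := .ite ((Ex.var 1).eq 0) 1 (2 * .rd 8 (.var 1 - 1))

/-- A table whose entries are all equal to the length of the blocks. -/
def lengthTable : Ex .word := .least 40 (nE + 1) (nE.lt (.rd 8 (.var 40)))

/-- The length of the blocks. -/
def lengthE : Ex .word := .rd 9 0

/-- The number of blocks. -/
def blocksE : Ex .word := leavesE / lengthE + 1

/-- The table of the suffix maxima. -/
def maskTable : Ex .word :=
  .sum 40 lengthE (.ind ((Ex.wle (.var 1 / lengthE * lengthE + .var 40) (.var 1)).and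
    (.all 41 (.var 1 + 1) (((.var 1 / lengthE * lengthE + .var 40 : Ex .word).lt (.var 41)).imp
      (.rlt (.rrd 7 (.var 41)) (.rrd 7 (.var 1 / lengthE * lengthE + .var 40)))))) *
    .rd 8 (.var 40))

/-- The table of the lowest digits. -/
def lowTable : Ex .word := .least 40 lengthE (.eq (.var 1 / .rd 8 (.var 40) % 2) 1)

/-- The number of lengths of sequences of blocks. -/
def logsE : Ex .word := 2 * lengthE + 6

/-- The table of the logarithms. -/
def logTable : Ex .word := .sum 40 logsE (.ind (.wle (.rd 8 (.var 40 + 1)) (.var 1)))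

/-- The position `x` belongs to the sequence of blocks with index `1`. -/
def inBlocksE (x : Fin 64) : Ex .prop :=
  (Ex.wle (.var 1 % blocksE * lengthE) (.var x)).and
    ((Ex.var x).lt ((.var 1 % blocksE + .rd 8 (.var 1 / blocksE)) * lengthE))

/-- The table of the maxima of sequences of blocks. -/
def sparseTable : Ex .real :=
  .rrd 7 (.least 40 leavesE ((inBlocksE 40).and (.all 41 leavesE ((inBlocksE 41).imp
    (.rle (.rrd 7 (.var 41)) (.rrd 7 (.var 40)))))))

/-- All tables. -/
def tables : List Table :=
  [.real scaleTable, .word codeTable, .word levelTable, .word baseTable, .word ownerTable,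
    .word positionTable, .word leafTable, .real gapTable, .word powTable, .word lengthTable,
    .word maskTable, .word lowTable, .word logTable, .real sparseTable]

/-- The state in which all tables have been computed. -/
structure Filled (τ : State) : Prop where
  pos : 1 ≤ τ.wreg 0
  one_lt : 1 < τ.rreg 0
  scale_table : τ.HasReals 0 scaleTable
  code_table : τ.HasWords 1 codeTable
  level_table : τ.HasWords 2 levelTable
  base_table : τ.HasWords 3 baseTable
  owner_table : τ.HasWords 4 ownerTable
  position_table : τ.HasWords 5 positionTable
  leaf_table : τ.HasWords 6 leafTable
  gap_table : τ.HasReals 7 gapTable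
  pow_table : τ.HasWords 8 powTable
  length_table : τ.HasWords 9 lengthTable
  mask_table : τ.HasWords 10 maskTable
  low_table : τ.HasWords 11 lowTable
  log_table : τ.HasWords 12 logTable
  sparse_table : τ.HasReals 13 sparseTable

theorem filled_run {σ : State} (hn : 1 ≤ σ.wreg 0) (hk : 1 < σ.rreg 0) :
    Filled (Table.run 0 tables σ) := by
  have hs := Table.sameBut_run 0 tables σ
  have hw : ∀ j e, tables[j]? = some (.word e) → (Table.run 0 tables σ).HasWords j e := by
    intro j e hj u hu
    have := Table.run_word (k := 0) hj (u := u) (σ := σ) (by rwa [hs.cap] at hu)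
    rwa [Nat.zero_add, ← hs.cap] at this
  have hr : ∀ j e, tables[j]? = some (.real e) → (Table.run 0 tables σ).HasReals j e := by
    intro j e hj u hu
    have := Table.run_real (k := 0) hj (u := u) (σ := σ) (by rwa [hs.cap] at hu)
    rwa [Nat.zero_add] at this
  exact ⟨by rwa [hs.wreg], by rwa [hs.rreg], hr _ _ rfl, hw _ _ rfl, hw _ _ rfl, hw _ _ rfl,
    hw _ _ rfl, hw _ _ rfl, hw _ _ rfl, hr _ _ rfl, hw _ _ rfl, hw _ _ rfl, hw _ _ rfl,
    hw _ _ rfl, hw _ _ rfl, hr _ _ rfl⟩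

end Build

section before

variable {k u : ℕ} {τ ψ : State} (h : Before k u τ ψ) (hk : 1 < k)
include h hk

theorem edge_before : edge ψ = edge τ := by
  funext f i t x
  rw [edge, edge, h.cap_eq, h.wa_eq hk]

theorem carved_before : carved ψ = carved τ := by
  funext f i t x
  rw [carved, carved, h.cap_eq, h.wa_eq hk]

end before

namespace Build

open Classical in
/-- The letters of a leaf, according to the tables. -/
noncomputable def tableLetter (σ : State) (e s : ℕ) : ℕ :=
  if s = 0 then σ.wa 4 e / σ.wreg 0
  else if s = 1 then e - σ.wa 3 (σ.wa 4 e)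
  else if s = σ.wreg 0 * (σ.wreg 0 * σ.wreg 0) + 2 then σ.wa 4 e % σ.wreg 0
  else if carved σ (σ.wa 4 e / σ.wreg 0) (e - σ.wa 3 (σ.wa 4 e)) (s - 2) (σ.wa 4 e % σ.wreg 0)
    then 0 else 1

@[simp] theorem eval_letterE (σ : State) (e s : Ex .word) :
    (letterE e s).eval σ = tableLetter σ (e.eval σ) (s.eval σ) := by
  simp only [letterE, tableLetter, Ex.eval_ite]
  classical
  exact if_congr (by simp) (by simp) (if_congr (by simp) (by simp)
    (if_congr (by simp) (by simp) (if_congr (by simp) (by simp) (by simp))))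

theorem tableLetter_setw (σ : State) {x : ℕ} (hx : x ≠ 0) (i : ℕ) :
    tableLetter (σ.setw x i) = tableLetter σ := by
  funext e s
  have h0 : (σ.setw x i).wreg 0 = σ.wreg 0 := State.setw_wreg_ne _ _ hx.symm
  rw [tableLetter, tableLetter, h0, wa_setw _ hx, wa_setw _ hx, carved_setw _ hx]

theorem tableLetter_before {k u : ℕ} {τ ψ : State} (h : Before k u τ ψ) (hk : 4 < k) :
    tableLetter ψ = tableLetter τ := by
  funext e s
  rw [tableLetter, tableLetter, h.wreg_zero, h.wa_eq hk, h.wa_eq (by omega : 3 < k),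
    carved_before h (by omega)]

@[simp] theorem eval_leavesE (σ : State) : leavesE.eval σ = σ.wa 3 (16 * σ.wreg 0) := by
  simp [leavesE]

@[simp] theorem eval_lengthE (σ : State) : lengthE.eval σ = σ.wa 9 0 := by
  simp [lengthE]

@[simp] theorem eval_blocksE (σ : State) :
    blocksE.eval σ = (σ.wa 3 (16 * σ.wreg 0) / σ.wa 9 0 + 1 : ℕ) := by
  simp [blocksE]

@[simp] theorem eval_logsE (σ : State) : logsE.eval σ = (2 * σ.wa 9 0 + 6 : ℕ) := by
  simp [logsE]

namespace Filled

variable {τ : State} (T : Filled τ)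
include T

theorem isScale : IsScale (τ.wreg 0 * τ.wreg 0) (16 * (τ.wreg 0 * τ.wreg 0))
    (fun a => memDist τ (a / τ.wreg 0) (a % τ.wreg 0)) (τ.ra 0) := by
  classical
  intro s hs
  have hcap := τ.le_cap T.pos
  have hs' : s < τ.cap ^ 4 := by
    have : τ.cap ^ 1 ≤ τ.cap ^ 4 := Nat.pow_le_pow_right τ.cap_pos (by norm_num)
    nlinarith
  obtain ⟨ψ, hb, hw⟩ := T.scale_table s hs'
  -- The index of a pair of points is also the address of their distance in the matrix.
  have hv : ∀ a, memDist τ (a / τ.wreg 0) (a % τ.wreg 0) = τ.rmem a := fun a => by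
    rw [memDist, Nat.div_add_mod']
  simp only [hv]
  have hr : ∀ a < τ.wreg 0 * τ.wreg 0, ψ.rmem a = τ.rmem a := fun a ha =>
    hb.rmem_eq (ha.trans τ.square_lt_cap)
  have hth : ∀ φ : State, φ.wreg 1 = s → φ.ra 0 = ψ.ra 0 →
      thresholdE.eval φ = threshold (τ.ra 0) s := by
    intro φ h1 h2
    rcases Nat.eq_zero_or_pos s with h0 | h0
    · simp [thresholdE, threshold, h1, h0]
    · simp [thresholdE, threshold, h1, h0.ne', h2, hb.ra_lt (Nat.sub_lt h0 one_pos)]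
  set θ := threshold (τ.ra 0) s with hθ
  have hnext : nextE.eval ψ = least (τ.wreg 0 * τ.wreg 0) fun a => θ < τ.rmem a ∧
      ∀ b < τ.wreg 0 * τ.wreg 0, θ < τ.rmem b → τ.rmem a ≤ τ.rmem b := by
    simp only [nextE, Ex.eval_least, Ex.eval_mul, eval_nE, hb.wreg_zero]
    refine least_congr fun a ha => ?_
    simp only [Ex.eval_and, Ex.eval_rlt, Ex.eval_all, Ex.eval_imp, Ex.eval_rread, Ex.eval_var,
      Ex.eval_rle, Ex.eval_mul, eval_nE, State.setw_rmem]
    have h40 : thresholdE.eval (ψ.setw 40 a) = θ :=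
      hth _ (by simp [State.setw_wreg, hb.wreg_one]) (ra_setw _ (by norm_num) _ _)
    have h41 : ∀ b, thresholdE.eval ((ψ.setw 40 a).setw 41 b) = θ := fun b =>
      hth _ (by simp [State.setw_wreg, hb.wreg_one])
        (by rw [ra_setw _ (by norm_num), ra_setw _ (by norm_num)])
    refine and_congr ?_ (forall_congr' fun b => ?_)
    · rw [show ((40 : Fin 64) : ℕ) = 40 from rfl, h40, State.setw_wreg_same, hr a ha]
    · have h0 : (ψ.setw 40 a).wreg 0 = τ.wreg 0 := by simp [State.setw_wreg, hb.wreg_zero]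
      simp only [show ((40 : Fin 64) : ℕ) = 40 from rfl, show ((41 : Fin 64) : ℕ) = 41 from rfl,
        h0, h41, State.setw_wreg_same]
      refine forall_congr' fun hbn => ?_
      rw [hr b hbn, State.setw_wreg_ne _ _ (by norm_num : (40 : ℕ) ≠ 41), State.setw_wreg_same,
        hr a ha]
  have hval : τ.ra 0 s = if least (τ.wreg 0 * τ.wreg 0) (fun a => θ < τ.rmem a ∧
      ∀ b < τ.wreg 0 * τ.wreg 0, θ < τ.rmem b → τ.rmem a ≤ τ.rmem b) < τ.wreg 0 * τ.wreg 0
      then ψ.rmem (nextE.eval ψ) else θ := by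
    rw [hw, scaleTable, Ex.eval_rite]
    exact if_congr (by simp [hnext, hb.wreg_zero]) rfl (hth ψ hb.wreg_one rfl)
  rw [hnext] at hval
  -- If no distance exceeds the threshold, the search returns the default `n * n` and the entry is
  -- the threshold itself.
  by_cases hex : ∃ a < τ.wreg 0 * τ.wreg 0, θ < τ.rmem a
  · obtain ⟨a, ha, hmin⟩ := exists_min_image
      ((range (τ.wreg 0 * τ.wreg 0)).filter fun a => θ < τ.rmem a) τ.rmem
      (hex.imp fun a ha => mem_filter.2 ⟨mem_range.2 ha.1, ha.2⟩)
    rw [mem_filter, mem_range] at ha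
    obtain ⟨h1, h2, -⟩ := least_spec (m := τ.wreg 0 * τ.wreg 0) (P := fun a => θ < τ.rmem a ∧
      ∀ b < τ.wreg 0 * τ.wreg 0, θ < τ.rmem b → τ.rmem a ≤ τ.rmem b)
      ⟨a, ha.1, ha.2, fun b hb hb' => hmin b (mem_filter.2 ⟨mem_range.2 hb, hb'⟩)⟩
    rw [if_pos h1, hr _ h1] at hval
    exact .inl ⟨_, h1, h2.1, h2.2, hval⟩
  · push Not at hex
    rw [least_of_forall_not fun a ha h => absurd h.1 (not_lt.2 (hex a ha)), if_neg (lt_irrefl _)]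
      at hval
    exact .inr ⟨hex, hval⟩

theorem level_eq {u : ℕ} (hu : u < τ.cap ^ 4) : τ.wa 2 u = lev (τ.wreg 0) (edge τ) u := by
  obtain ⟨ψ, hb, hw⟩ := T.level_table u hu
  have h1 : levelTable.eval ψ = lev (τ.wreg 0) (edge τ) u := by
    simp [levelTable, lev, DistanceOracle.level, State.setw_wreg, edge_setw,
      edge_before hb (by norm_num), hb.wreg_zero, hb.wreg_one]
  rw [hw, h1, Nat.mod_eq_of_lt]
  exact (least_le _ _).trans_lt τ.wreg_lt_cap

end Filled

end Build

end DistanceOracle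

namespace RAM

theorem State.lt_cap_pow (σ : State) {u : ℕ} (h : u < σ.cap) : u < σ.cap ^ 4 :=
  h.trans_le (Nat.le_self_pow (by norm_num) _)

end RAM

/-! ### The tables of the leaves and of their order -/

namespace DistanceOracle

open RAM Finset

theorem lev_le (n : ℕ) (B : ℕ → ℕ → ℕ → ℕ → Prop) (u : ℕ) : lev n B u ≤ n := least_le _ _

theorem base_le (n : ℕ) (B : ℕ → ℕ → ℕ → ℕ → Prop) (u : ℕ) : base n B u ≤ u * (n + 1) := by
  have := sum_le_card_nsmul (range u) (fun y => lev n B y + 1) (n + 1)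
    fun y _ => Nat.succ_le_succ (lev_le n B y)
  simpa [base] using this

theorem leaves_le_square (n : ℕ) (B : ℕ → ℕ → ℕ → ℕ → Prop) :
    leaves n B ≤ 16 * ((n + 1) * (n + 1)) := by
  refine (base_le n B _).trans ?_
  rw [mul_assoc]
  exact Nat.mul_le_mul_left _ (Nat.mul_le_mul_right _ (Nat.le_succ n))

namespace Build.Filled

variable {τ : State} (T : Filled τ)
include T

theorem add_lt_cap {u : ℕ} (hu : u ≤ 512 * ((τ.wreg 0 + 1) * (τ.wreg 0 + 1))) : u + 2 < τ.cap := by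
  have h1 := τ.le_cap T.pos
  have h2 : 1 ≤ (τ.wreg 0 + 1) * (τ.wreg 0 + 1) := by nlinarith
  omega

theorem leaves_lt_cap : leaves (τ.wreg 0) (edge τ) + 2 < τ.cap :=
  T.add_lt_cap ((leaves_le_square _ _).trans (Nat.mul_le_mul_right _ (by norm_num)))

theorem codes_lt_cap : 16 * τ.wreg 0 + 2 < τ.cap := by
  refine T.add_lt_cap ?_
  nlinarith

theorem base_eq {u : ℕ} (hu : u ≤ 16 * τ.wreg 0) :
    τ.wa 3 u = base (τ.wreg 0) (edge τ) u := by
  have hlt := T.codes_lt_cap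
  have hL := T.leaves_lt_cap
  obtain ⟨ψ, hb, hw⟩ := T.base_table u (τ.lt_cap_pow (by omega))
  have h1 : baseTable.eval ψ = base (τ.wreg 0) (edge τ) u := by
    simp only [baseTable, base, Ex.eval_sum, Ex.eval_var]
    refine sum_congr (by simp [hb.wreg_one]) fun i hi => ?_
    have hi : i < u := by simpa using hi
    simp [wa_setw, hb.wa_eq (show 2 < 3 by norm_num), T.level_eq (τ.lt_cap_pow (show i < τ.cap by omega))]
  have h2 := base_mono (n := τ.wreg 0) (B := edge τ) hu
  rw [leaves] at hL
  rw [hw, h1, Nat.mod_eq_of_lt (by omega)]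

theorem leaves_eq : τ.wa 3 (16 * τ.wreg 0) = leaves (τ.wreg 0) (edge τ) := T.base_eq le_rfl

theorem owner_eq {e : ℕ} (he : e < τ.cap) : τ.wa 4 e = owner (τ.wreg 0) (edge τ) e := by
  have hlt := T.codes_lt_cap
  obtain ⟨ψ, hb, hw⟩ := T.owner_table e (τ.lt_cap_pow he)
  have h1 : ownerTable.eval ψ = owner (τ.wreg 0) (edge τ) e := by
    simp only [ownerTable, owner, Ex.eval_least, Ex.eval_mul, Ex.eval_ofNat, eval_nE, hb.wreg_zero]
    refine least_congr fun y hy => ?_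
    simp [State.setw_wreg, hb.wreg_one, wa_setw, hb.wa_eq (show 3 < 4 by norm_num),
      T.base_eq (show y + 1 ≤ 16 * τ.wreg 0 from hy)]
  have h2 : owner (τ.wreg 0) (edge τ) e ≤ 16 * τ.wreg 0 := least_le _ _
  rw [hw, h1, Nat.mod_eq_of_lt (by omega)]

theorem letter_eq {e : ℕ} (he : e < leaves (τ.wreg 0) (edge τ)) :
    tableLetter τ e = letter (τ.wreg 0) (carved τ) (edge τ) e := by
  funext s
  have hL := T.leaves_lt_cap
  rw [tableLetter, letter, T.owner_eq (by omega), T.base_eq (owner_spec he).1.le]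

theorem position_eq {e : ℕ} (he : e < leaves (τ.wreg 0) (edge τ)) :
    τ.wa 5 e = position (τ.wreg 0 * (τ.wreg 0 * τ.wreg 0) + 3) (leaves (τ.wreg 0) (edge τ))
      (letter (τ.wreg 0) (carved τ) (edge τ)) e := by
  classical
  have hL := T.leaves_lt_cap
  obtain ⟨ψ, hb, hw⟩ := T.position_table e (τ.lt_cap_pow (by omega))
  have h1 : positionTable.eval ψ = position (τ.wreg 0 * (τ.wreg 0 * τ.wreg 0) + 3)
      (leaves (τ.wreg 0) (edge τ)) (letter (τ.wreg 0) (carved τ) (edge τ)) e := by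
    rw [position, card_filter]
    simp only [positionTable, Ex.eval_sum, eval_leavesE, hb.wreg_zero,
      hb.wa_eq (show 3 < 5 by norm_num), T.leaves_eq]
    refine sum_congr rfl fun i hi => ?_
    have hi := mem_range.1 hi
    rw [Ex.eval_ind]
    refine if_congr ?_ rfl rfl
    simp [LexLt, tableLetter_setw, tableLetter_before hb, State.setw_wreg, hb.wreg_one,
      hb.wreg_zero, T.letter_eq he, T.letter_eq hi]
  rw [hw, h1, Nat.mod_eq_of_lt]
  have := Words.position_lt (W := τ.wreg 0 * (τ.wreg 0 * τ.wreg 0) + 3)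
    (c := letter (τ.wreg 0) (carved τ) (edge τ)) e he
  omega

theorem leaf_eq {p : ℕ} (hp : p < leaves (τ.wreg 0) (edge τ)) :
    τ.wa 6 p = leafAt (τ.wreg 0 * (τ.wreg 0 * τ.wreg 0) + 3) (leaves (τ.wreg 0) (edge τ))
      (letter (τ.wreg 0) (carved τ) (edge τ)) p := by
  have hL := T.leaves_lt_cap
  obtain ⟨ψ, hb, hw⟩ := T.leaf_table p (τ.lt_cap_pow (by omega))
  have h1 : leafTable.eval ψ = leafAt (τ.wreg 0 * (τ.wreg 0 * τ.wreg 0) + 3)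
      (leaves (τ.wreg 0) (edge τ)) (letter (τ.wreg 0) (carved τ) (edge τ)) p := by
    simp only [leafTable, leafAt, Ex.eval_least, eval_leavesE, hb.wreg_zero,
      hb.wa_eq (show 3 < 6 by norm_num), T.leaves_eq]
    refine least_congr fun e he => ?_
    simp [State.setw_wreg, hb.wreg_one, wa_setw, hb.wa_eq (show 5 < 6 by norm_num),
      T.position_eq he]
  rw [hw, h1, Nat.mod_eq_of_lt]
  exact (least_le _ _).trans_lt (by omega)

end Build.Filled

end DistanceOracle

/-! ### The table of the diameters -/

namespace DistanceOracle

open RAM Finset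

namespace Build

section eval

variable (σ : State)

theorem eval_splitE : splitE.eval σ = least (σ.wreg 0 * (σ.wreg 0 * σ.wreg 0) + 3)
    fun s => tableLetter σ (σ.wreg 2) s ≠ tableLetter σ (σ.wreg 3) s := by
  simp [splitE, tableLetter_setw, State.setw_wreg]

theorem eval_classE {e : Ex .word} (he : ∀ i, e.eval (σ.setw 43 i) = e.eval σ) :
    (classE e).eval σ ↔
      ∀ r < σ.wreg 4, tableLetter σ (σ.wreg 2) r = tableLetter σ (e.eval σ) r := by
  simp [classE, tableLetter_setw, State.setw_wreg, he]

theorem eval_pairE {x : Fin 64} (hx : x ≠ 43) : (pairE x).eval σ ↔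
    (∀ r < σ.wreg 4, tableLetter σ (σ.wreg 2) r =
      tableLetter σ (σ.wreg x / σ.wa 3 (16 * σ.wreg 0)) r) ∧
    ∀ r < σ.wreg 4, tableLetter σ (σ.wreg 2) r =
      tableLetter σ (σ.wreg x % σ.wa 3 (16 * σ.wreg 0)) r := by
  have hx' : (x : ℕ) ≠ 43 := fun h => hx (Fin.ext h)
  rw [pairE, Ex.eval_and, eval_classE, eval_classE]
  · simp
  all_goals intro i; simp [State.setw_wreg, wa_setw, hx']

theorem eval_pairAddrE (x : Fin 64) : (pairAddrE x).eval σ =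
    (σ.wa 4 (σ.wreg x / σ.wa 3 (16 * σ.wreg 0)) % σ.wreg 0 * σ.wreg 0 +
      σ.wa 4 (σ.wreg x % σ.wa 3 (16 * σ.wreg 0)) % σ.wreg 0 : ℕ) := by
  simp [pairAddrE]

/-- The leaves of a pair belong to the class of leaf `2`. -/
def inClass (σ : State) (x : ℕ) : Prop :=
  (∀ r < σ.wreg 4, tableLetter σ (σ.wreg 2) r = tableLetter σ (x / σ.wa 3 (16 * σ.wreg 0)) r) ∧
  ∀ r < σ.wreg 4, tableLetter σ (σ.wreg 2) r = tableLetter σ (x % σ.wa 3 (16 * σ.wreg 0)) r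

/-- The distance of the points of a pair of leaves. -/
noncomputable def pairDist (σ : State) (x : ℕ) : ℝ :=
  σ.rmem (σ.wa 4 (x / σ.wa 3 (16 * σ.wreg 0)) % σ.wreg 0 * σ.wreg 0 +
      σ.wa 4 (x % σ.wa 3 (16 * σ.wreg 0)) % σ.wreg 0)

theorem eval_farthestE : farthestE.eval σ =
    least (σ.wa 3 (16 * σ.wreg 0) * σ.wa 3 (16 * σ.wreg 0)) fun x => inClass σ x ∧
      ∀ y < σ.wa 3 (16 * σ.wreg 0) * σ.wa 3 (16 * σ.wreg 0), inClass σ y →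
        pairDist σ y ≤ pairDist σ x := by
  simp [farthestE, inClass, pairDist, eval_pairE, eval_pairAddrE, tableLetter_setw, wa_setw,
    State.setw_wreg]

end eval

theorem Filled.isGaps {τ : State} (T : Filled τ) :
    Gaps (τ.wreg 0 * (τ.wreg 0 * τ.wreg 0) + 3) (leaves (τ.wreg 0) (edge τ))
      (letter (τ.wreg 0) (carved τ) (edge τ)) (leafDist (τ.wreg 0) (edge τ) (memDist τ))
      (τ.ra 7) := by
  refine ⟨words_letter, fun p hp => ?_⟩
  have hL := T.leaves_lt_cap
  have hlp := T.leaf_eq (p := p) (by omega)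
  have hlp' := T.leaf_eq hp
  have hW := words_letter (n := τ.wreg 0) (A := carved τ) (B := edge τ)
  have ha := hW.leafAt_spec (p := p) (by omega)
  have hb := hW.leafAt_spec hp
  set n := τ.wreg 0 with hn
  set L := leaves n (edge τ) with hLdef
  set c := letter n (carved τ) (edge τ) with hc
  set a := leafAt (n * (n * n) + 3) L c p
  set b := leafAt (n * (n * n) + 3) L c (p + 1)
  obtain ⟨hs1, hs2, hs3⟩ := least_spec (hW.inj a ha.1 b hb.1 fun h => by
    have h1 := ha.2; rw [h, hb.2] at h1; omega)
  set s := least (n * (n * n) + 3) fun s => c a s ≠ c b s with hs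
  set P : ℕ → Prop := fun x => (∀ r < s, c a r = c (x / L) r) ∧ ∀ r < s, c a r = c (x % L) r
    with hP
  set D := leafDist n (edge τ) (memDist τ) with hD
  have hL0 : 0 < L := by omega
  have hdiv : ∀ x < L * L, x / L < L := fun x hx => Nat.div_lt_of_lt_mul hx
  have hmod : ∀ x, x % L < L := fun x => Nat.mod_lt _ hL0
  obtain ⟨ψ, hψ, hw⟩ := T.gap_table p (τ.lt_cap_pow (by omega))
  have w0 := hψ.wreg_zero
  have w1 := hψ.wreg_one
  have a3 := hψ.wa_eq (show 3 < 7 by norm_num)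
  have a4 := hψ.wa_eq (show 4 < 7 by norm_num)
  have a6 := hψ.wa_eq (show 6 < 7 by norm_num)
  have aL := tableLetter_before hψ (by norm_num)
  -- The pair of leaves `e` and `e'` has the code `e * L + e'`. The pair of `a` with itself shows
  -- that the maximum is over a nonempty set.
  have hex : ∃ x < L * L, P x ∧ ∀ y < L * L, P y → D (y / L) (y % L) ≤ D (x / L) (x % L) := by
    classical
    obtain ⟨x, hx, hmax⟩ := exists_max_image ((range (L * L)).filter P)
      (fun x => D (x / L) (x % L)) ⟨a * L + a, mem_filter.2 ⟨mem_range.2 (by nlinarith [ha.1]), by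
        have h1 : (a * L + a) / L = a := by
          rw [mul_comm, Nat.mul_add_div hL0, Nat.div_eq_of_lt ha.1, add_zero]
        have h2 : (a * L + a) % L = a := by rw [mul_comm, Nat.mul_add_mod, Nat.mod_eq_of_lt ha.1]
        simp only [hP, h1, h2]
        exact ⟨fun _ _ => trivial, fun _ _ => trivial⟩⟩⟩
    rw [mem_filter, mem_range] at hx
    exact ⟨x, hx.1, hx.2, fun y hy hy' => hmax y (mem_filter.2 ⟨mem_range.2 hy, hy'⟩)⟩
  obtain ⟨h1, h2, -⟩ := least_spec hex
  have hval : τ.ra 7 p = D (least (L * L) (fun x => P x ∧ ∀ y < L * L, P y →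
      D (y / L) (y % L) ≤ D (x / L) (x % L)) / L) (least (L * L) (fun x => P x ∧ ∀ y < L * L, P y →
      D (y / L) (y % L) ≤ D (x / L) (x % L)) % L) := by
    have e2 : (Ex.rd 6 (.var 1)).eval ψ = a := by
      simpa [w1, a6] using hlp
    have e3 : (Ex.rd 6 (.var 1 + 1)).eval (ψ.setw 2 a) = b := by
      simpa [w1, a6, wa_setw, State.setw_wreg] using hlp'
    rw [hw, gapTable, Ex.eval_rread]
    refine (congrArg ψ.rmem (Ex.eval_letw _ _ fun i => ?_)).trans ?_
    · simp [wa_setw, State.setw_wreg]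
    rw [e2, show ((2 : Fin 64) : ℕ) = 2 from rfl]
    refine (congrArg ψ.rmem (Ex.eval_letw _ _ fun i => ?_)).trans ?_
    · simp [wa_setw, State.setw_wreg]
    rw [e3, show ((3 : Fin 64) : ℕ) = 3 from rfl]
    set φ := (ψ.setw 2 a).setw 3 b with hφ
    have e4 : splitE.eval φ = s := by
      rw [eval_splitE, hs]
      refine (congrArg₂ least (by simp [hφ, State.setw_wreg, w0, hn]) (funext fun r => ?_))
      simp [hφ, State.setw_wreg, tableLetter_setw, aL, T.letter_eq ha.1, T.letter_eq hb.1, hc, hn]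
    refine (congrArg ψ.rmem (Ex.eval_letw _ _ fun i => ?_)).trans ?_
    · simp [eval_splitE, tableLetter_setw, State.setw_wreg]
    rw [e4, show ((4 : Fin 64) : ℕ) = 4 from rfl]
    refine (congrArg ψ.rmem (Ex.eval_letw _ _ fun i => ?_)).trans ?_
    · simp [eval_farthestE, inClass, pairDist, tableLetter_setw, wa_setw, State.setw_wreg]
    -- In `χ` the registers `2`, `3` and `4` hold the two neighbouring leaves and the length of
    -- their common prefix.
    set χ := φ.setw 4 s with hχ
    have c0 : χ.wreg 0 = n := by simp [hχ, hφ, State.setw_wreg, w0, hn]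
    have c3 : χ.wa 3 (16 * χ.wreg 0) = L := by
      rw [c0]; simp [hχ, hφ, wa_setw, a3, hn, T.leaves_eq, hLdef]
    have hcls : ∀ x < L * L, (inClass χ x ↔ P x) := by
      intro x hx
      have c2 : χ.wreg 2 = a := by simp [hχ, hφ, State.setw_wreg]
      have c4 : χ.wreg 4 = s := by simp [hχ]
      have ct : tableLetter χ = tableLetter τ := by simp [hχ, hφ, tableLetter_setw, aL]
      rw [inClass, c3, c2, c4, ct, T.letter_eq ha.1, T.letter_eq (hdiv x hx), T.letter_eq (hmod x)]
    have hdist : ∀ x < L * L, pairDist χ x = D (x / L) (x % L) := by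
      intro x hx
      have c4 : χ.wa 4 = τ.wa 4 := by simp [hχ, hφ, wa_setw, a4]
      have h1 := hdiv x hx
      have h2 := hmod x
      have h3 := owner_spec (n := n) (B := edge τ) h1
      have hn0 : 0 < n := T.pos
      have h4 := Nat.mod_lt (owner n (edge τ) (x / L)) hn0
      have h5 := Nat.mod_lt (owner n (edge τ) (x % L)) hn0
      have h6 := τ.square_lt_cap
      rw [pairDist, c3, c0, c4, T.owner_eq (by omega), T.owner_eq (by omega), hD, leafDist, memDist]
      refine hψ.rmem_eq (lt_of_lt_of_le ?_ h6.le)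
      rw [← hn]
      nlinarith
    have hfar : farthestE.eval χ = least (L * L) (fun x => P x ∧ ∀ y < L * L, P y →
        D (y / L) (y % L) ≤ D (x / L) (x % L)) := by
      rw [eval_farthestE, c3]
      refine least_congr fun x hx => and_congr (hcls x hx) (forall₂_congr fun y hy => ?_)
      rw [hcls y hy, hdist x hx, hdist y hy]
    rw [hfar, ← hdist _ h1, show ((5 : Fin 64) : ℕ) = 5 from rfl, eval_pairAddrE, pairDist]
    simp [wa_setw, State.setw_wreg]
    rfl
  refine ⟨s, fun r hr => not_not.1 (hs3 r hr), hs2, ?_, _, hdiv _ h1, _, hmod _, h2.1.1, h2.1.2,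
    hval⟩
  intro e he e' he' hr hr'
  rw [hval]
  have e1 : (e * L + e') / L = e := by
    rw [mul_comm, Nat.mul_add_div hL0, Nat.div_eq_of_lt he', add_zero]
  have e2 : (e * L + e') % L = e' := by rw [mul_comm, Nat.mul_add_mod, Nat.mod_eq_of_lt he']
  have := h2.2 (e * L + e') (by nlinarith) (by simp only [hP, e1, e2]; exact ⟨hr, hr'⟩)
  rwa [e1, e2] at this

end Build

end DistanceOracle

/-! ### The tables for range maxima -/

namespace DistanceOracle

open RAM Finset

theorem ite_iff {α : Type*} {P Q : Prop} {i : Decidable P} {j : Decidable Q} (h : P ↔ Q) (a b : α) :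
    @ite α P i a b = @ite α Q j a b :=
  if_congr h rfl rfl

/-- The length of the blocks. -/
def blockLength (n : ℕ) : ℕ := Nat.log 2 n + 1

theorem lt_two_pow_blockLength (n : ℕ) : n < 2 ^ blockLength n :=
  Nat.lt_pow_succ_log_self (by norm_num) n

theorem two_pow_blockLength_le {n : ℕ} (hn : 1 ≤ n) : 2 ^ blockLength n ≤ 2 * n := by
  rw [blockLength, pow_succ, mul_comm]
  exact Nat.mul_le_mul_left _ (Nat.pow_log_le_self 2 (by omega))

theorem blockLength_le {n : ℕ} (hn : 1 ≤ n) : blockLength n ≤ n := by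
  have h1 := Nat.pow_log_le_self 2 (show n ≠ 0 by omega)
  have h2 : Nat.log 2 n < 2 ^ Nat.log 2 n := Nat.lt_two_pow_self
  rw [blockLength]
  omega

namespace Build.Filled

variable {τ : State} (T : Filled τ)
include T

theorem pow_mod_eq {u : ℕ} (hu : u < τ.cap) : τ.wa 8 u = 2 ^ u % τ.cap := by
  induction u with
  | zero =>
    obtain ⟨ψ, hb, hw⟩ := T.pow_table 0 (τ.lt_cap_pow hu)
    rw [hw, powTable, Ex.eval_ite, if_pos (by simp [hb.wreg_one])]
    simp
  | succ u ih =>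
    obtain ⟨ψ, hb, hw⟩ := T.pow_table (u + 1) (τ.lt_cap_pow hu)
    rw [hw, powTable, Ex.eval_ite, if_neg (by simp [hb.wreg_one])]
    simp only [Ex.eval_mul, Ex.eval_ofNat, Ex.eval_rd, Ex.eval_sub, Ex.eval_var]
    rw [show ((1 : Fin 64) : ℕ) = 1 from rfl, hb.wreg_one, Nat.add_sub_cancel, hb.wa_lt (Nat.lt_succ_self u), ih (by omega), pow_succ, Nat.mul_mod,
      Nat.mod_mod, ← Nat.mul_mod, mul_comm]

/-- For these exponents `2 ^ u ≤ 256 * n ^ 2`, which is below the capacity, so the reduction of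
stored words does no harm. -/
theorem pow_eq {u : ℕ} (hu : u ≤ 2 * blockLength (τ.wreg 0) + 6) : τ.wa 8 u = 2 ^ u := by
  have h1 : 2 ^ u ≤ 256 * (τ.wreg 0 * τ.wreg 0) := by
    have h2 := two_pow_blockLength_le T.pos
    calc 2 ^ u ≤ 2 ^ (2 * blockLength (τ.wreg 0) + 6) := Nat.pow_le_pow_right (by norm_num) hu
      _ = 64 * (2 ^ blockLength (τ.wreg 0) * 2 ^ blockLength (τ.wreg 0)) := by
          rw [pow_add, two_mul, pow_add]; ring
      _ ≤ 64 * ((2 * τ.wreg 0) * (2 * τ.wreg 0)) :=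
          Nat.mul_le_mul_left _ (Nat.mul_le_mul h2 h2)
      _ = _ := by ring
  have h3 := τ.le_cap T.pos
  have h4 : 2 ^ u < τ.cap := by nlinarith
  rw [T.pow_mod_eq (Nat.lt_two_pow_self.trans h4), Nat.mod_eq_of_lt h4]

theorem blockLength_lt_cap : blockLength (τ.wreg 0) + 2 < τ.cap := by
  have h1 := blockLength_le T.pos
  have h2 := T.codes_lt_cap
  have h3 := T.pos
  omega

theorem length_eq {u : ℕ} (hu : u < τ.cap) : τ.wa 9 u = blockLength (τ.wreg 0) := by
  obtain ⟨ψ, hb, hw⟩ := T.length_table u (τ.lt_cap_pow hu)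
  have hlt := T.blockLength_lt_cap
  have h1 : lengthTable.eval ψ = blockLength (τ.wreg 0) := by
    simp only [lengthTable, Ex.eval_least, Ex.eval_add, eval_nE, Ex.eval_ofNat, hb.wreg_zero]
    have h0 := blockLength_le T.pos
    refine least_eq (Nat.le_succ_of_le h0) (fun j hj => ?_) fun _ => ?_
    · have h2 : 2 ^ j ≤ τ.wreg 0 := by
        rw [blockLength] at hj
        exact (Nat.pow_le_pow_right (by norm_num) (by omega)).trans
          (Nat.pow_log_le_self 2 (by have := T.pos; omega))
      simp [State.setw_wreg, wa_setw, hb.wreg_zero, hb.wa_eq (show 8 < 9 by norm_num),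
        T.pow_eq (u := j) (by omega), h2]
    · simp [State.setw_wreg, wa_setw, hb.wreg_zero, hb.wa_eq (show 8 < 9 by norm_num),
        T.pow_eq (u := blockLength (τ.wreg 0)) (by omega), lt_two_pow_blockLength]
  rw [hw, h1, Nat.mod_eq_of_lt (by omega)]

theorem mask_eq {q : ℕ} (hq : q < leaves (τ.wreg 0) (edge τ)) :
    τ.wa 10 q = bits (blockLength (τ.wreg 0)) fun o =>
      q / blockLength (τ.wreg 0) * blockLength (τ.wreg 0) + o ≤ q ∧
      ∀ r < q + 1, q / blockLength (τ.wreg 0) * blockLength (τ.wreg 0) + o < r →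
        τ.ra 7 r < τ.ra 7 (q / blockLength (τ.wreg 0) * blockLength (τ.wreg 0) + o) := by
  have hL := T.leaves_lt_cap
  obtain ⟨ψ, hb, hw⟩ := T.mask_table q (τ.lt_cap_pow (by omega))
  have h9 : τ.wa 9 0 = blockLength (τ.wreg 0) := T.length_eq (by omega)
  rw [hw]
  have h1 : maskTable.eval ψ = bits (blockLength (τ.wreg 0)) fun o =>
      q / blockLength (τ.wreg 0) * blockLength (τ.wreg 0) + o ≤ q ∧
      ∀ r < q + 1, q / blockLength (τ.wreg 0) * blockLength (τ.wreg 0) + o < r →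
        τ.ra 7 r < τ.ra 7 (q / blockLength (τ.wreg 0) * blockLength (τ.wreg 0) + o) := by
    classical
    simp only [maskTable, bits, Ex.eval_sum, eval_lengthE, hb.wa_eq (show 9 < 10 by norm_num), h9]
    refine sum_congr rfl fun o ho => ?_
    have ho := mem_range.1 ho
    rw [Ex.eval_mul, Ex.eval_ind]
    refine congrArg₂ (· * ·) (ite_iff ?_ _ _) ?_
    · simp [State.setw_wreg, wa_setw, ra_setw, hb.wreg_one, hb.wa_eq (show 9 < 10 by norm_num), h9,
        hb.ra_eq (show 7 < 10 by norm_num)]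
    · simp [wa_setw, hb.wa_eq (show 8 < 10 by norm_num), T.pow_eq (u := o) (by omega)]
  rw [h1, Nat.mod_eq_of_lt]
  refine (bits_lt _ _).trans_le ((two_pow_blockLength_le T.pos).trans ?_)
  have := T.codes_lt_cap
  omega

theorem low_eq {m : ℕ} (hm : m < 2 ^ blockLength (τ.wreg 0)) :
    τ.wa 11 m = least (blockLength (τ.wreg 0)) fun t => m / 2 ^ t % 2 = 1 := by
  have hcap := T.codes_lt_cap
  have hle := two_pow_blockLength_le T.pos
  have hlt := T.blockLength_lt_cap
  obtain ⟨ψ, hb, hw⟩ := T.low_table m (τ.lt_cap_pow (by omega))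
  have h9 : τ.wa 9 0 = blockLength (τ.wreg 0) := T.length_eq (by omega)
  have h1 : lowTable.eval ψ = least (blockLength (τ.wreg 0)) fun t => m / 2 ^ t % 2 = 1 := by
    simp only [lowTable, Ex.eval_least, eval_lengthE, hb.wa_eq (show 9 < 11 by norm_num), h9]
    refine least_congr fun t ht => ?_
    simp [State.setw_wreg, wa_setw, hb.wreg_one, hb.wa_eq (show 8 < 11 by norm_num),
      T.pow_eq (u := t) (by omega)]
  rw [hw, h1, Nat.mod_eq_of_lt]
  exact (least_le _ _).trans_lt (by omega)

-- There are at most `16 * (n + 1) ^ 2` leaves and `n + 1 ≤ 2 ^ b` for the block length `b`, so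
-- logarithms stay below the `2 * b + 6` lengths that are tabulated.
omit T in
theorem log_lt {m : ℕ} (hm : m ≤ leaves (τ.wreg 0) (edge τ)) :
    Nat.log 2 m < 2 * blockLength (τ.wreg 0) + 6 := by
  have h1 := leaves_le_square (τ.wreg 0) (edge τ)
  have h2 : τ.wreg 0 + 1 ≤ 2 ^ blockLength (τ.wreg 0) := lt_two_pow_blockLength _
  refine Nat.log_lt_of_lt_pow' (by omega) (hm.trans_lt (h1.trans_lt ?_))
  calc 16 * ((τ.wreg 0 + 1) * (τ.wreg 0 + 1))
      ≤ 16 * (2 ^ blockLength (τ.wreg 0) * 2 ^ blockLength (τ.wreg 0)) :=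
        Nat.mul_le_mul_left _ (Nat.mul_le_mul h2 h2)
    _ < 64 * (2 ^ blockLength (τ.wreg 0) * 2 ^ blockLength (τ.wreg 0)) := by
        have : 0 < 2 ^ blockLength (τ.wreg 0) * 2 ^ blockLength (τ.wreg 0) := by positivity
        omega
    _ = _ := by rw [pow_add, two_mul, pow_add]; ring

/-- The table counts the `i` with `2 ^ (i + 1) ≤ m`, which are the numbers below the logarithm. -/
theorem log_eq {m : ℕ} (hm0 : 0 < m) (hm : m ≤ leaves (τ.wreg 0) (edge τ)) :
    τ.wa 12 m = Nat.log 2 m := by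
  classical
  have hL := T.leaves_lt_cap
  have hlog := log_lt hm
  obtain ⟨ψ, hb, hw⟩ := T.log_table m (τ.lt_cap_pow (by omega))
  have h9 : τ.wa 9 0 = blockLength (τ.wreg 0) := T.length_eq (by omega)
  have h1 : logTable.eval ψ = Nat.log 2 m := by
    simp only [logTable, Ex.eval_sum, eval_logsE, hb.wa_eq (show 9 < 12 by norm_num), h9]
    have h2 : ∀ i ∈ range (2 * blockLength (τ.wreg 0) + 6),
        ((Ex.ind (.wle (.rd 8 (.var 40 + 1)) (.var 1))).eval (ψ.setw (40 : Fin 64) i) : ℕ) =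
          if i < Nat.log 2 m then 1 else 0 := by
      intro i hi
      have hi := mem_range.1 hi
      rw [Ex.eval_ind]
      refine if_congr ?_ rfl rfl
      simp only [Ex.eval_wle, Ex.eval_rd, Ex.eval_add, Ex.eval_var, Ex.eval_ofNat,
        State.setw_wreg_same]
      rw [show ((1 : Fin 64) : ℕ) = 1 from rfl, wa_setw _ (by decide), hb.wa_eq (show 8 < 12 by norm_num),
        State.setw_wreg_ne _ _ (by decide), hb.wreg_one, T.pow_eq (by omega), Nat.lt_iff_add_one_le]
      exact (Nat.le_log_iff_pow_le (by norm_num) (by omega)).symm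
    rw [sum_congr rfl h2, ← sum_filter, sum_const, smul_eq_mul, mul_one]
    have : (range (2 * blockLength (τ.wreg 0) + 6)).filter (fun i => i < Nat.log 2 m) =
        range (Nat.log 2 m) := by
      ext i; simp only [mem_filter, mem_range]; omega
    rw [this, card_range]
  rw [hw, h1, Nat.mod_eq_of_lt]
  exact ((Nat.log_lt_self 2 hm0.ne')).trans (by omega)

theorem sparse_isMax {l β : ℕ} (hl : l < 2 * blockLength (τ.wreg 0) + 6)
    (hβ : β * blockLength (τ.wreg 0) < leaves (τ.wreg 0) (edge τ))
    (hβ' : β < leaves (τ.wreg 0) (edge τ) / blockLength (τ.wreg 0) + 1) :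
    IsMax (τ.ra 7)
      (τ.ra 13 (l * (leaves (τ.wreg 0) (edge τ) / blockLength (τ.wreg 0) + 1) + β))
      (β * blockLength (τ.wreg 0))
      (min ((β + 2 ^ l) * blockLength (τ.wreg 0)) (leaves (τ.wreg 0) (edge τ)) - 1) := by
  classical
  have hL := T.leaves_lt_cap
  have hbl := T.blockLength_lt_cap
  have hlog := T.pow_eq (u := l) (by omega)
  have hL' := T.leaves_eq
  have h9 : τ.wa 9 0 = blockLength (τ.wreg 0) := T.length_eq (by omega)
  have hb0 : 0 < blockLength (τ.wreg 0) := Nat.succ_pos _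
  set b := blockLength (τ.wreg 0)
  set L := leaves (τ.wreg 0) (edge τ)
  have hBL : L / b ≤ L := Nat.div_le_self _ _
  set B := L / b + 1 with hB
  have hu : l * B + β < τ.cap ^ 4 := by
    have hcap := T.codes_lt_cap
    have hble : b ≤ τ.wreg 0 := blockLength_le T.pos
    have h1 : l + 1 ≤ τ.cap := by have := T.pos; omega
    have h2 := Nat.mul_le_mul h1 (show B ≤ τ.cap by omega)
    have h3 : τ.cap ^ 2 ≤ τ.cap ^ 4 := Nat.pow_le_pow_right τ.cap_pos (by norm_num)
    nlinarith
  obtain ⟨ψ, hb, hw⟩ := T.sparse_table _ hu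
  have hdiv : (l * B + β) / B = l := by
    rw [mul_comm, Nat.mul_add_div (by omega), Nat.div_eq_of_lt hβ', add_zero]
  have hmod : (l * B + β) % B = β := by rw [mul_comm, Nat.mul_add_mod, Nat.mod_eq_of_lt hβ']
  set P : ℕ → Prop := fun x => β * b ≤ x ∧ x < (β + 2 ^ l) * b with hP
  have hval : τ.ra 13 (l * B + β) =
      τ.ra 7 (least L fun x => P x ∧ ∀ y < L, P y → τ.ra 7 y ≤ τ.ra 7 x) := by
    rw [hw, sparseTable, Ex.eval_rrd, hb.ra_eq (show 7 < 13 by norm_num)]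
    simp only [Ex.eval_least, eval_leavesE, hb.wreg_zero, hb.wa_eq (show 3 < 13 by norm_num), hL']
    refine congrArg _ (least_congr fun x hx => ?_)
    simp [inBlocksE, State.setw_wreg, wa_setw, ra_setw, hb.wreg_one, hb.wreg_zero, hdiv, hmod, hP,
      hb.wa_eq (show 3 < 13 by norm_num), hb.wa_eq (show 8 < 13 by norm_num),
      hb.wa_eq (show 9 < 13 by norm_num), hb.ra_eq (show 7 < 13 by norm_num), hL', h9, hlog, ← hB]
  have hex : ∃ x < L, P x ∧ ∀ y < L, P y → τ.ra 7 y ≤ τ.ra 7 x := by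
    obtain ⟨x, hx, hmax⟩ := exists_max_image ((range L).filter P) (τ.ra 7)
      ⟨β * b, mem_filter.2 ⟨mem_range.2 hβ, le_rfl, by
        have : 0 < 2 ^ l := by positivity
        exact Nat.mul_lt_mul_of_pos_right (by omega) hb0⟩⟩
    rw [mem_filter, mem_range] at hx
    exact ⟨x, hx.1, hx.2, fun y hy hy' => hmax y (mem_filter.2 ⟨mem_range.2 hy, hy'⟩)⟩
  obtain ⟨h1, h2, -⟩ := least_spec hex
  refine ⟨⟨_, h2.1.1, ?_, hval⟩, fun r hr hr' => ?_⟩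
  · have := h2.1.2
    omega
  · rw [hval]
    exact h2.2 r (by omega) ⟨hr, by omega⟩

theorem rangeMax : RangeMax (leaves (τ.wreg 0) (edge τ)) (blockLength (τ.wreg 0))
    (leaves (τ.wreg 0) (edge τ) / blockLength (τ.wreg 0) + 1) (τ.ra 7) (τ.wa 10) (τ.wa 11)
    (τ.wa 12) (τ.ra 13) where
  pos := Nat.succ_pos _
  mask_eq q hq := T.mask_eq hq
  tz_eq m hm := T.low_eq hm
  lg_le m hm hmb := by
    have := Nat.le_mul_of_pos_right m (show 0 < blockLength (τ.wreg 0) from Nat.succ_pos _)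
    rw [T.log_eq hm (by omega)]
    exact Nat.pow_log_le_self 2 hm.ne'
  lt_lg m hm hmb := by
    have := Nat.le_mul_of_pos_right m (show 0 < blockLength (τ.wreg 0) from Nat.succ_pos _)
    rw [T.log_eq hm (by omega)]
    exact Nat.lt_pow_succ_log_self (by norm_num) m
  sp_isMax m l β hmb hl hm hβ hβ' := by
    have := Nat.le_mul_of_pos_right m (show 0 < blockLength (τ.wreg 0) from Nat.succ_pos _)
    subst hl
    refine T.sparse_isMax ?_ hβ hβ'
    rw [T.log_eq hm (by omega)]
    exact log_lt (by omega)
  blocks := Nat.lt_succ_self _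

end Build.Filled

end DistanceOracle

namespace RAM

/-! ### Expressions without sums -/

/-- The expression contains no sum. -/
def Ex.Flat : {s : Sort3} → Ex s → Prop
  | _, .const _ => True
  | _, .var _ => True
  | _, .op _ a b => a.Flat ∧ b.Flat
  | _, .read a => a.Flat
  | _, .sum _ _ _ => False
  | _, .ind b => b.Flat
  | _, .rvar _ => True
  | _, .cast a => a.Flat
  | _, .rop _ a b => a.Flat ∧ b.Flat
  | _, .rread a => a.Flat
  | _, .wle a b => a.Flat ∧ b.Flat
  | _, .rle a b => a.Flat ∧ b.Flat
  | _, .not a => a.Flat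
  | _, .and a b => a.Flat ∧ b.Flat

/-- Only the rounds of a sum make the cost depend on the size of the words. This is the source of
the constant query time. -/
theorem Ex.Flat.cost_eq {s : Sort3} {e : Ex s} (h : e.Flat) (V W : ℕ) : e.cost V = e.cost W := by
  induction e <;> simp_all [Ex.Flat, Ex.cost]

/-- The minimum of two words. -/
def Ex.min (a b : Ex .word) : Ex .word := .ite (.wle a b) a b

/-- The maximum of two words. -/
def Ex.max (a b : Ex .word) : Ex .word := .ite (.wle a b) b a

/-- The minimum of two reals. -/
def Ex.rmin (a b : Ex .real) : Ex .real := .rite (.rle a b) a b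

/-- The maximum of two reals. -/
def Ex.rmax (a b : Ex .real) : Ex .real := .rite (.rle a b) b a

section eval

variable (σ : State)

@[simp] theorem Ex.eval_min (a b : Ex .word) :
    (Ex.min a b).eval σ = @Min.min ℕ _ (a.eval σ) (b.eval σ) := by
  rw [Ex.min, Ex.eval_ite, min_def]
  exact DistanceOracle.ite_iff (by simp) _ _

@[simp] theorem Ex.eval_max (a b : Ex .word) :
    (Ex.max a b).eval σ = @Max.max ℕ _ (a.eval σ) (b.eval σ) := by
  rw [Ex.max, Ex.eval_ite, max_def]
  exact DistanceOracle.ite_iff (by simp) _ _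

@[simp] theorem Ex.eval_rmin (a b : Ex .real) :
    (Ex.rmin a b).eval σ = @Min.min ℝ _ (a.eval σ) (b.eval σ) := by
  rw [Ex.rmin, Ex.eval_rite, min_def]
  exact DistanceOracle.ite_iff (by simp) _ _

@[simp] theorem Ex.eval_rmax (a b : Ex .real) :
    (Ex.rmax a b).eval σ = @Max.max ℝ _ (a.eval σ) (b.eval σ) := by
  rw [Ex.rmax, Ex.eval_rite, max_def]
  exact DistanceOracle.ite_iff (by simp) _ _

end eval

end RAM

namespace DistanceOracle

open RAM Finset

theorem Build.Filled.forest {τ : State} (T : Build.Filled τ)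
    (hd : IsDist (τ.wreg 0) (memDist τ)) : Forest (τ.wreg 0) (τ.rreg 0) (memDist τ) (τ.ra 0)
      (inTree τ) (carved τ) (edge τ) :=
  ⟨T.pos, T.one_lt, hd, T.isScale, fun _ hf => Build.family_of_table T.code_table T.pos hf T.one_lt⟩

namespace Query

/-! ### The query -/

/-- The word number `s` of entry `u` of the data structure. -/
def entryE (s : ℕ) (u : Ex .word) : Ex .word := .read (8 * u + .const s)

/-- The number of points. -/
def nE : Ex .word := entryE 0 0

/-- The length of the blocks. -/
def lengthE : Ex .word := entryE 0 1

/-- The number of blocks. -/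
def blocksE : Ex .word := entryE 0 2

/-- The level of a point in a family. -/
def levE (u : Ex .word) : Ex .word := entryE 1 (u + 1) - entryE 1 u - 1

/-- The position of a leaf of `x` in family `f`. -/
def placeE (f : ℕ) (x y : Ex .word) : Ex .word :=
  entryE 2 (entryE 1 (.const f * nE + x) +
    .min (levE (.const f * nE + x)) (levE (.const f * nE + y)))

/-- The diameter at a position. -/
def gapE (p : Ex .word) : Ex .real := .rread (2 * p)

/-- The maximum of a sequence of blocks. -/
def sparseE (u : Ex .word) : Ex .real := .rread (2 * u + 1)

/-- The maximum in a block. -/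
def inBlockE (p q : Ex .word) : Ex .real :=
  gapE (p + entryE 4 (entryE 3 q / entryE 5 (p % lengthE)))

/-- The maximum on an interval. -/
def valueE (p q : Ex .word) : Ex .real :=
  let u := p / lengthE
  let w := q / lengthE
  let l := entryE 6 (w - (u + 1))
  let left := inBlockE p (u * lengthE + (lengthE - 1))
  let right := inBlockE (w * lengthE) q
  .rite (u.eq w) (inBlockE p q) <| .rite ((u + 1).eq w) (.rmax left right) <|
    .rmax (.rmax left (.rmax (sparseE (l * blocksE + (u + 1)))
      (sparseE (l * blocksE + (w - entryE 5 l))))) right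

/-- The distance of the points `0` and `1` in family `f`. -/
def estimateE (f : ℕ) : Ex .real :=
  valueE (.min (placeE f (.var 0) (.var 1)) (placeE f (.var 1) (.var 0)))
    (.max (placeE f (.var 0) (.var 1)) (placeE f (.var 1) (.var 0)) - 1)

/-- The least distance in the families `0, …, f`. -/
def leastE : ℕ → Ex .real
  | 0 => estimateE 0
  | f + 1 => .rmin (estimateE (f + 1)) (leastE f)

/-- The answer to a query. -/
def answerE : Ex .real := .rite ((Ex.var 0).eq (.var 1)) 0 (leastE 15)

section flat

variable {a b : Ex .word} (ha : a.Flat) (hb : b.Flat)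
include ha

theorem flat_entryE (s : ℕ) : (entryE s a).Flat := ⟨⟨trivial, ha⟩, trivial⟩

theorem flat_levE : (levE a).Flat :=
  ⟨⟨flat_entryE (show (a + 1 : Ex .word).Flat from ⟨ha, trivial⟩) 1, flat_entryE ha 1⟩, trivial⟩

include hb

theorem flat_min : (Ex.min a b).Flat := ⟨⟨⟨ha, hb⟩, ha⟩, ⟨ha, hb⟩, hb⟩

theorem flat_max : (Ex.max a b).Flat := ⟨⟨⟨ha, hb⟩, hb⟩, ⟨ha, hb⟩, ha⟩

theorem flat_placeE (f : ℕ) : (placeE f a b).Flat := by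
  have hn : nE.Flat := flat_entryE (a := 0) trivial 0
  have h1 : ∀ c : Ex .word, c.Flat → (.const f * nE + c : Ex .word).Flat := fun c hc =>
    ⟨⟨trivial, hn⟩, hc⟩
  refine flat_entryE ?_ 2
  exact ⟨flat_entryE (h1 _ ha) 1, flat_min (flat_levE (h1 _ ha)) (flat_levE (h1 _ hb))⟩

theorem flat_inBlockE : (inBlockE a b).Flat := by
  have hn : lengthE.Flat := flat_entryE (a := 0) trivial 1
  have h1 : (a % lengthE).Flat := ⟨ha, hn⟩
  have h2 : (entryE 3 b / entryE 5 (a % lengthE)).Flat := ⟨flat_entryE hb 3, flat_entryE h1 5⟩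
  exact ⟨trivial, ha, flat_entryE h2 4⟩

omit ha hb in
theorem flat_rite {c : Ex .prop} {x y : Ex .real} (hc : c.Flat) (hx : x.Flat) (hy : y.Flat) :
    (Ex.rite c x y).Flat := ⟨⟨hc, hx⟩, hc, hy⟩

omit ha hb in
theorem flat_rmax {x y : Ex .real} (hx : x.Flat) (hy : y.Flat) : (Ex.rmax x y).Flat :=
  flat_rite ⟨hx, hy⟩ hy hx

theorem flat_valueE : (valueE a b).Flat := by
  have hn : lengthE.Flat := flat_entryE (a := 0) trivial 1
  have hB : blocksE.Flat := flat_entryE (a := 0) trivial 2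
  have hu : (a / lengthE).Flat := ⟨ha, hn⟩
  have hw : (b / lengthE).Flat := ⟨hb, hn⟩
  have hm : (b / lengthE - (a / lengthE + 1)).Flat := ⟨hw, hu, trivial⟩
  have hl := flat_entryE hm 6
  have h1 : (inBlockE a (a / lengthE * lengthE + (lengthE - 1))).Flat :=
    flat_inBlockE ha ⟨⟨hu, hn⟩, hn, trivial⟩
  have h2 : (inBlockE (b / lengthE * lengthE) b).Flat := flat_inBlockE ⟨hw, hn⟩ hb
  refine flat_rite ⟨⟨hu, hw⟩, hw, hu⟩ (flat_inBlockE ha hb) (flat_rite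
    ⟨⟨⟨hu, trivial⟩, hw⟩, hw, hu, trivial⟩ (flat_rmax h1 h2) (flat_rmax (flat_rmax h1
      (flat_rmax ⟨⟨trivial, ⟨hl, hB⟩, hu, trivial⟩, trivial⟩
        ⟨⟨trivial, ⟨hl, hB⟩, hw, flat_entryE hl 5⟩, trivial⟩)) h2))

end flat

theorem flat_answerE : answerE.Flat := by
  have h : ∀ f, (estimateE f).Flat := fun f =>
    have h1 := flat_placeE (a := .var 0) (b := .var 1) trivial trivial f
    have h2 := flat_placeE (a := .var 1) (b := .var 0) trivial trivial f
    flat_valueE (flat_min h1 h2) ⟨flat_max h1 h2, trivial⟩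
  have h' : ∀ f, (leastE f).Flat := by
    intro f
    induction f with
    | zero => exact h 0
    | succ f ih => exact flat_rite ⟨h (f + 1), ih⟩ (h (f + 1)) ih
  exact flat_rite ⟨⟨trivial, trivial⟩, trivial, trivial⟩ trivial (h' 15)

@[simp] theorem eval_entryE (σ : State) (s : ℕ) (u : Ex .word) :
    (entryE s u).eval σ = σ.wmem (8 * u.eval σ + s) := by
  simp [entryE]

/-- The memory holds the data structure made of the tables. -/
structure Stored (τ σ : State) : Prop where
  points : σ.wmem 0 = τ.wreg 0
  length : σ.wmem 8 = blockLength (τ.wreg 0)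
  blocks : σ.wmem 16 = leaves (τ.wreg 0) (edge τ) / blockLength (τ.wreg 0) + 1
  base : ∀ u ≤ leaves (τ.wreg 0) (edge τ), σ.wmem (8 * u + 1) = τ.wa 3 u
  position : ∀ u ≤ leaves (τ.wreg 0) (edge τ), σ.wmem (8 * u + 2) = τ.wa 5 u
  mask : ∀ u ≤ leaves (τ.wreg 0) (edge τ), σ.wmem (8 * u + 3) = τ.wa 10 u
  low : ∀ u ≤ leaves (τ.wreg 0) (edge τ), σ.wmem (8 * u + 4) = τ.wa 11 u
  pow : ∀ u ≤ leaves (τ.wreg 0) (edge τ), σ.wmem (8 * u + 5) = τ.wa 8 u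
  log : ∀ u ≤ leaves (τ.wreg 0) (edge τ), σ.wmem (8 * u + 6) = τ.wa 12 u
  gap : ∀ p < leaves (τ.wreg 0) (edge τ) + (2 * blockLength (τ.wreg 0) + 6) *
    (leaves (τ.wreg 0) (edge τ) / blockLength (τ.wreg 0) + 1), σ.rmem (2 * p) = τ.ra 7 p
  sparse : ∀ p < leaves (τ.wreg 0) (edge τ) + (2 * blockLength (τ.wreg 0) + 6) *
    (leaves (τ.wreg 0) (edge τ) / blockLength (τ.wreg 0) + 1), σ.rmem (2 * p + 1) = τ.ra 13 p

namespace Stored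

variable {τ σ : State} (S : Stored τ σ) (T : Build.Filled τ)
include S

theorem eval_nE : nE.eval σ = τ.wreg 0 := by rw [nE, eval_entryE]; exact S.points

theorem eval_lengthE : lengthE.eval σ = blockLength (τ.wreg 0) := by
  rw [lengthE, eval_entryE]; exact S.length

theorem eval_blocksE :
    blocksE.eval σ = (leaves (τ.wreg 0) (edge τ) / blockLength (τ.wreg 0) + 1 : ℕ) := by
  rw [blocksE, eval_entryE]; exact S.blocks

include T

/-- Levels are not stored: the leaves of `u` form an interval of `lev + 1` numbers, and its two ends
are known. -/
theorem eval_levE {u : ℕ} {e : Ex .word} (he : e.eval σ = u) (hu : u < 16 * τ.wreg 0) :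
    (levE e).eval σ = lev (τ.wreg 0) (edge τ) u := by
  have h1 : 16 * τ.wreg 0 ≤ leaves (τ.wreg 0) (edge τ) := Forest.le_leaves
  have h2 := base_succ (n := τ.wreg 0) (B := edge τ) u
  simp only [levE, Ex.eval_sub, eval_entryE, Ex.eval_add, he, Ex.eval_ofNat]
  rw [S.base _ (by omega), S.base _ (by omega), T.base_eq (by omega), T.base_eq (by omega)]
  change DistanceOracle.base _ _ (u + 1) - DistanceOracle.base _ _ u - 1 = lev _ _ u
  omega

theorem eval_placeE {f x y : ℕ} {a b : Ex .word} (ha : a.eval σ = x) (hb : b.eval σ = y)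
    (hf : f < 16) (hx : x < τ.wreg 0) (hy : y < τ.wreg 0) :
    (placeE f a b).eval σ = Forest.place (τ.wreg 0) (carved τ) (edge τ) f x y := by
  have h1 : 16 * τ.wreg 0 ≤ leaves (τ.wreg 0) (edge τ) := Forest.le_leaves
  have hcx := code_lt hf hx
  have hcy := code_lt hf hy
  have hcl := commonLeaf_lt (B := edge τ) (y := y) hf hx
  have e1 : (.const f * nE + a : Ex .word).eval σ = (f * τ.wreg 0 + x : ℕ) := by
    simp [S.eval_nE, ha]
  have e2 : (.const f * nE + b : Ex .word).eval σ = (f * τ.wreg 0 + y : ℕ) := by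
    simp [S.eval_nE, hb]
  rw [placeE, eval_entryE, Ex.eval_add, eval_entryE, Ex.eval_min, S.eval_levE T e1 hcx,
    S.eval_levE T e2 hcy, e1, S.base _ (by omega), T.base_eq (by omega)]
  change σ.wmem (8 * commonLeaf (τ.wreg 0) (edge τ) f x y + 2) = _
  rw [S.position _ hcl.le, T.position_eq hcl]
  rfl

theorem eval_inBlockE {p q : ℕ} {a b : Ex .word} (ha : a.eval σ = p) (hb : b.eval σ = q)
    (hp : p < leaves (τ.wreg 0) (edge τ)) (hq : q < leaves (τ.wreg 0) (edge τ)) :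
    (inBlockE a b).eval σ = τ.ra 7
      (RangeMax.inBlock (blockLength (τ.wreg 0)) (τ.wa 10) (τ.wa 11) p q) := by
  have hb0 : 0 < blockLength (τ.wreg 0) := Nat.succ_pos _
  have h1 : 16 * τ.wreg 0 ≤ leaves (τ.wreg 0) (edge τ) := Forest.le_leaves
  have h2 := blockLength_le T.pos
  have h3 := two_pow_blockLength_le T.pos
  have hm := Nat.mod_lt p hb0
  have h4 : τ.wa 10 q / 2 ^ (p % blockLength (τ.wreg 0)) < 2 ^ blockLength (τ.wreg 0) := by
    rw [T.mask_eq hq]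
    exact (Nat.div_le_self _ _).trans_lt (bits_lt _ _)
  simp only [inBlockE, gapE, Ex.eval_rread, Ex.eval_mul, Ex.eval_add, eval_entryE, Ex.eval_div,
    Ex.eval_mod, Ex.eval_ofNat, ha, hb, S.eval_lengthE]
  -- Shifted masks are below `2 ^ b ≤ 2 * n` and exponents below `b ≤ n`, so all rows in question
  -- exist by `Forest.le_leaves`.
  rw [S.mask q hq.le, S.pow _ (by omega), T.pow_eq (by omega), S.low _ (by omega), RangeMax.inBlock]
  -- The bound used for the place is `p + b`, which may lie beyond the last leaf; the block of reals
  -- continues far enough to cover it.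
  refine S.gap _ ?_
  have h5 : τ.wa 11 (τ.wa 10 q / 2 ^ (p % blockLength (τ.wreg 0))) ≤ blockLength (τ.wreg 0) := by
    rw [T.low_eq h4]
    exact least_le _ _
  nlinarith [Nat.zero_le (leaves (τ.wreg 0) (edge τ) / blockLength (τ.wreg 0))]

theorem eval_valueE {p q : ℕ} {a b : Ex .word} (ha : a.eval σ = p) (hb : b.eval σ = q)
    (hpq : p ≤ q) (hq : q < leaves (τ.wreg 0) (edge τ)) :
    (valueE a b).eval σ = RangeMax.value (blockLength (τ.wreg 0))
      (leaves (τ.wreg 0) (edge τ) / blockLength (τ.wreg 0) + 1) (τ.ra 7) (τ.wa 10) (τ.wa 11)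
      (τ.wa 12) (τ.ra 13) p q := by
  have hb0 : 0 < blockLength (τ.wreg 0) := Nat.succ_pos _
  have hn := S.eval_lengthE
  have hB := S.eval_blocksE
  have hu : (a / lengthE).eval σ = (p / blockLength (τ.wreg 0) : ℕ) := by simp [ha, hn]
  have hw : (b / lengthE).eval σ = (q / blockLength (τ.wreg 0) : ℕ) := by simp [hb, hn]
  have hdm := Nat.div_add_mod p (blockLength (τ.wreg 0))
  have hdm' := Nat.div_add_mod q (blockLength (τ.wreg 0))
  have hml := Nat.mod_lt p hb0
  have hdle : p / blockLength (τ.wreg 0) ≤ q / blockLength (τ.wreg 0) := Nat.div_le_div_right hpq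
  have hqB : q / blockLength (τ.wreg 0) <
    leaves (τ.wreg 0) (edge τ) / blockLength (τ.wreg 0) + 1 :=
    Nat.lt_succ_of_le (Nat.div_le_div_right hq.le)
  have hqq := Nat.div_le_self q (blockLength (τ.wreg 0))
  rw [mul_comm] at hdm hdm'
  rw [valueE, RangeMax.value, Ex.eval_rite]
  by_cases h1 : p / blockLength (τ.wreg 0) = q / blockLength (τ.wreg 0)
  · rw [if_pos h1, if_pos (by rw [Ex.eval_eq, hu, hw, h1])]
    exact S.eval_inBlockE T ha hb (by omega) hq
  rw [if_neg h1, if_neg (by rw [Ex.eval_eq, hu, hw]; exact h1), Ex.eval_rite]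
  have hlt : p / blockLength (τ.wreg 0) + 1 ≤ q / blockLength (τ.wreg 0) := by omega
  have hmul := Nat.mul_le_mul_right (blockLength (τ.wreg 0)) hlt
  rw [Nat.add_mul, one_mul] at hmul
  have hleft := S.eval_inBlockE T (b := a / lengthE * lengthE + (lengthE - 1)) ha
    (q := p / blockLength (τ.wreg 0) * blockLength (τ.wreg 0) + (blockLength (τ.wreg 0) - 1))
    (by simp [hu, hn]) (by omega) (by omega)
  have hright := S.eval_inBlockE T (a := b / lengthE * lengthE)
    (p := q / blockLength (τ.wreg 0) * blockLength (τ.wreg 0)) (by simp [hw, hn]) hb (by omega) hq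
  by_cases h2 : p / blockLength (τ.wreg 0) + 1 = q / blockLength (τ.wreg 0)
  · rw [if_pos h2, if_pos (by rw [Ex.eval_eq, Ex.eval_add, hu, hw, ← h2]; rfl), Ex.eval_rmax,
      hleft, hright]
  have hmle : q / blockLength (τ.wreg 0) - (p / blockLength (τ.wreg 0) + 1) ≤
      leaves (τ.wreg 0) (edge τ) := (Nat.sub_le _ _).trans (hqq.trans hq.le)
  have hm0 : 0 < q / blockLength (τ.wreg 0) - (p / blockLength (τ.wreg 0) + 1) :=
    Nat.sub_pos_of_lt (lt_of_le_of_ne hlt h2)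
  have hlog : (entryE 6 (b / lengthE - (a / lengthE + 1))).eval σ =
      τ.wa 12 (q / blockLength (τ.wreg 0) - (p / blockLength (τ.wreg 0) + 1)) := by
    rw [eval_entryE, Ex.eval_sub, Ex.eval_add, hu, hw]
    exact S.log _ hmle
  have hloglt : τ.wa 12 (q / blockLength (τ.wreg 0) - (p / blockLength (τ.wreg 0) + 1)) <
      2 * blockLength (τ.wreg 0) + 6 := by
    rw [T.log_eq hm0 hmle]
    exact Build.Filled.log_lt hmle
  have hble := blockLength_le T.pos
  have h16 : 16 * τ.wreg 0 ≤ leaves (τ.wreg 0) (edge τ) := Forest.le_leaves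
  have hpos := T.pos
  have hpow : (entryE 5 (entryE 6 (b / lengthE - (a / lengthE + 1)))).eval σ =
      (2 ^ τ.wa 12 (q / blockLength (τ.wreg 0) - (p / blockLength (τ.wreg 0) + 1)) : ℕ) := by
    rw [eval_entryE, hlog, ← T.pow_eq hloglt.le]
    exact S.pow _ (by omega)
  have hsp : ∀ (c : Ex .word) (β : ℕ), c.eval σ = β →
      β < leaves (τ.wreg 0) (edge τ) / blockLength (τ.wreg 0) + 1 →
      (sparseE (entryE 6 (b / lengthE - (a / lengthE + 1)) * blocksE + c)).eval σ =
      τ.ra 13 (τ.wa 12 (q / blockLength (τ.wreg 0) - (p / blockLength (τ.wreg 0) + 1)) *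
        (leaves (τ.wreg 0) (edge τ) / blockLength (τ.wreg 0) + 1) + β) := by
    intro c β hc hβ
    rw [← S.sparse]
    · simp only [sparseE, Ex.eval_rread, Ex.eval_add, Ex.eval_mul, hc, hlog, hB, Ex.eval_ofNat]
    · have := Nat.mul_le_mul_right (leaves (τ.wreg 0) (edge τ) / blockLength (τ.wreg 0) + 1)
        (show τ.wa 12 (q / blockLength (τ.wreg 0) - (p / blockLength (τ.wreg 0) + 1)) + 1 ≤ _ from
          hloglt)
      rw [Nat.add_mul _ 1, one_mul] at this
      omega
  rw [if_neg h2, if_neg (by rw [Ex.eval_eq, Ex.eval_add, hu, hw]; exact h2), Ex.eval_rmax,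
    Ex.eval_rmax, Ex.eval_rmax, hleft, hright, hsp _ _ (show _ = p / blockLength (τ.wreg 0) + 1 by simp [hu]) (hlt.trans_lt hqB),
    hsp _ _ (by rw [Ex.eval_sub, hw, hpow]) ((Nat.sub_le _ _).trans_lt hqB)]

/-- The answers have the right order of magnitude. -/
theorem eval_answerE {x y : ℕ} (hx : σ.wreg 0 = x) (hy : σ.wreg 1 = y) (hxn : x < τ.wreg 0)
    (hyn : y < τ.wreg 0) (hd : IsDist (τ.wreg 0) (memDist τ))
    (hpos : x ≠ y → 0 < memDist τ x y) :
    memDist τ x y ≤ answerE.eval σ ∧ answerE.eval σ ≤ 8 * τ.rreg 0 * memDist τ x y := by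
  have ex : (Ex.var 0).eval σ = x := hx
  have ey : (Ex.var 1).eval σ = y := hy
  rw [answerE, Ex.eval_rite]
  by_cases hxy : x = y
  · rw [if_pos (by rw [Ex.eval_eq, ex, ey, hxy]), ← hxy, hd.self x hxn]
    simp
  rw [if_neg (by rw [Ex.eval_eq, ex, ey]; exact hxy)]
  have G := T.isGaps
  have hmax : ∀ f < 16, IsMax (τ.ra 7) ((estimateE f).eval σ)
      (min (Forest.place (τ.wreg 0) (carved τ) (edge τ) f x y)
        (Forest.place (τ.wreg 0) (carved τ) (edge τ) f y x))
      (max (Forest.place (τ.wreg 0) (carved τ) (edge τ) f x y)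
        (Forest.place (τ.wreg 0) (carved τ) (edge τ) f y x) - 1) := by
    intro f hf
    have h1 := S.eval_placeE T ex ey hf hxn hyn
    have h2 := S.eval_placeE T ey ex hf hyn hxn
    have h3 := Forest.place_ne G hf hxn hyn hxy
    have h4 := Forest.place_lt (A := carved τ) (B := edge τ) (y := y) hf hxn
    have h5 := Forest.place_lt (A := carved τ) (B := edge τ) (y := x) hf hyn
    have h7 := S.eval_valueE T
      (a := .min (placeE f (.var 0) (.var 1)) (placeE f (.var 1) (.var 0)))
      (b := .max (placeE f (.var 0) (.var 1)) (placeE f (.var 1) (.var 0)) - 1)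
      (p := min (Forest.place (τ.wreg 0) (carved τ) (edge τ) f x y)
        (Forest.place (τ.wreg 0) (carved τ) (edge τ) f y x))
      (q := max (Forest.place (τ.wreg 0) (carved τ) (edge τ) f x y)
        (Forest.place (τ.wreg 0) (carved τ) (edge τ) f y x) - 1)
      (by rw [Ex.eval_min, h1, h2]) (by simp [h1, h2]) (by omega) (by omega)
    have h6 := T.rangeMax.isMax_value
      (p := min (Forest.place (τ.wreg 0) (carved τ) (edge τ) f x y)
        (Forest.place (τ.wreg 0) (carved τ) (edge τ) f y x))
      (q := max (Forest.place (τ.wreg 0) (carved τ) (edge τ) f x y)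
        (Forest.place (τ.wreg 0) (carved τ) (edge τ) f y x) - 1) (by omega) (by omega)
    rw [estimateE, h7]
    exact h6
  have hleast : ∀ f, (∀ v, (∀ f' ≤ f, v ≤ (estimateE f').eval σ) → v ≤ (leastE f).eval σ) ∧
      ∀ f' ≤ f, (leastE f).eval σ ≤ (estimateE f').eval σ := by
    intro f
    induction f with
    | zero =>
      refine ⟨fun v h => h 0 le_rfl, fun f' hf => ?_⟩
      rw [Nat.le_zero.1 hf]
      exact le_rfl
    | succ f ih =>
      simp only [leastE, Ex.eval_rmin]
      refine ⟨fun v h => le_min (h _ le_rfl) (ih.1 v fun f' hf => h f' (by omega)),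
        fun f' hf => ?_⟩
      rcases Nat.lt_or_ge f f' with h1 | h1
      · rw [show f' = f + 1 by omega]
        exact min_le_left _ _
      · exact (min_le_right _ _).trans (ih.2 f' h1)
  -- No estimate is below the distance and one of them is within the factor `8 * k`; the minimum
  -- inherits both.
  constructor
  · exact (hleast 15).1 _ fun f hf => Forest.dist_le G hd (by omega) hxn hyn hxy (hmax f (by omega))
  · obtain ⟨f, hf, h⟩ := Forest.exists_le_dist G (T.forest hd) hxn hyn hxy (hpos hxy)
    exact ((hleast 15).2 f (by omega)).trans (h _ (hmax f hf))

end Stored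

end Query

end DistanceOracle

namespace RAM

/-! ### Blocks of memory -/

/-- The states have the same registers and the same tables. -/
structure SameTables (σ τ : State) : Prop where
  wreg : τ.wreg = σ.wreg
  rreg : τ.rreg = σ.rreg
  wa : τ.wa = σ.wa
  ra : τ.ra = σ.ra

theorem SameTables.refl (σ : State) : SameTables σ σ := ⟨rfl, rfl, rfl, rfl⟩

theorem SameTables.trans {σ τ υ : State} (h : SameTables σ τ) (h' : SameTables τ υ) :
    SameTables σ υ :=
  ⟨h'.wreg.trans h.wreg, h'.rreg.trans h.rreg, h'.wa.trans h.wa, h'.ra.trans h.ra⟩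

/-- A block of words is written to the beginning of the memory. -/
theorem Cmd.eval_iter_store {σ : State} {m e : Ex .word} {M : ℕ} {v : ℕ → ℕ} (hm : m.eval σ = M)
    (hM : M ≤ σ.cap) (he : ∀ φ, SameTables σ φ → ∀ a < M, e.eval (φ.setw 1 a) = v a)
    (hv : ∀ a < M, v a < σ.cap) :
    SameTables σ ((Cmd.iter 1 m (.store (.var 1) e)).eval σ) ∧
    ((Cmd.iter 1 m (.store (.var 1) e)).eval σ).rmem = σ.rmem ∧
    ∀ a < M, ((Cmd.iter 1 m (.store (.var 1) e)).eval σ).wmem a = v a := by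
  rw [Cmd.eval_iter, hm]
  suffices H : ∀ i ≤ M, SameTables σ ((Cmd.store (.var 1) e).round 1 σ i) ∧
      ((Cmd.store (.var 1) e).round 1 σ i).rmem = σ.rmem ∧
      ∀ a < i, ((Cmd.store (.var 1) e).round 1 σ i).wmem a = v a from H M le_rfl
  intro i
  induction i with
  | zero => exact fun _ => ⟨.refl σ, rfl, fun a ha => absurd ha (Nat.not_lt_zero a)⟩
  | succ i ih =>
    intro hi
    obtain ⟨h1, h2, h3⟩ := ih (by omega)
    have hw : ((Cmd.store (.var 1) e).round 1 σ (i + 1)).wreg = σ.wreg := Cmd.round_wreg _ _ _ _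
    generalize hR : (Cmd.store (.var 1) e).round 1 σ i = R at h1 h2 h3
    generalize hR' : (Cmd.store (.var 1) e).round 1 σ (i + 1) = R' at hw
    have hc' := State.cap_congr h1.wreg
    have hc := (State.cap_congr hw).trans hc'.symm
    rw [Cmd.round_succ, hR] at hR'
    have hrr : R'.rreg = R.rreg := by rw [← hR']; rfl
    have hother : R'.rmem = R.rmem := by rw [← hR']; rfl
    have hmem : R'.wmem = Function.update R.wmem i (v i) := by
      have e1 : (Ex.var 1).eval (R.setw ((1 : Fin 64) : ℕ) i) = i := by simp
      have e2 : (e % Ex.cap).eval (R.setw ((1 : Fin 64) : ℕ) i) = v i := by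
        have := he _ h1 i (by omega)
        rw [Ex.eval_mod, Ex.eval_cap, State.cap_setw _ (by decide), hc',
          show ((1 : Fin 64) : ℕ) = 1 from rfl, this]
        exact Nat.mod_eq_of_lt (hv i (by omega))
      rw [← hR']
      simp only [Cmd.eval, State.setw_wmem, e1, e2]
    refine ⟨h1.trans ⟨hw.trans h1.wreg.symm, hrr, ?_, ?_⟩, hother.trans h2, fun a ha => ?_⟩
    · funext k u
      -- Tables begin at the capacity, whereas the block is written below it.
      rw [State.wa, State.wa, hc, hmem, Function.update_of_ne]
      omega
    · funext k u
      rw [State.ra, State.ra, hc, hother]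
    · rcases Nat.lt_succ_iff_lt_or_eq.1 ha with h4 | rfl
      · rw [hmem, Function.update_of_ne h4.ne, h3 a h4]
      · rw [hmem, Function.update_self]

/-- A block of reals is written to the beginning of the memory. -/
theorem Cmd.eval_iter_rstore {σ : State} {m : Ex .word} {e : Ex .real} {M : ℕ} {v : ℕ → ℝ}
    (hm : m.eval σ = M)
    (hM : M ≤ σ.cap) (he : ∀ φ, SameTables σ φ → ∀ a < M, e.eval (φ.setw 1 a) = v a) :
    SameTables σ ((Cmd.iter 1 m (.rstore (.var 1) e)).eval σ) ∧
    ((Cmd.iter 1 m (.rstore (.var 1) e)).eval σ).wmem = σ.wmem ∧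
    ∀ a < M, ((Cmd.iter 1 m (.rstore (.var 1) e)).eval σ).rmem a = v a := by
  rw [Cmd.eval_iter, hm]
  suffices H : ∀ i ≤ M, SameTables σ ((Cmd.rstore (.var 1) e).round 1 σ i) ∧
      ((Cmd.rstore (.var 1) e).round 1 σ i).wmem = σ.wmem ∧
      ∀ a < i, ((Cmd.rstore (.var 1) e).round 1 σ i).rmem a = v a from H M le_rfl
  intro i
  induction i with
  | zero => exact fun _ => ⟨.refl σ, rfl, fun a ha => absurd ha (Nat.not_lt_zero a)⟩
  | succ i ih =>
    intro hi
    obtain ⟨h1, h2, h3⟩ := ih (by omega)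
    have hw : ((Cmd.rstore (.var 1) e).round 1 σ (i + 1)).wreg = σ.wreg := Cmd.round_wreg _ _ _ _
    generalize hR : (Cmd.rstore (.var 1) e).round 1 σ i = R at h1 h2 h3
    generalize hR' : (Cmd.rstore (.var 1) e).round 1 σ (i + 1) = R' at hw
    have hc' := State.cap_congr h1.wreg
    have hc := (State.cap_congr hw).trans hc'.symm
    rw [Cmd.round_succ, hR] at hR'
    have hrr : R'.rreg = R.rreg := by rw [← hR']; rfl
    have hother : R'.wmem = R.wmem := by rw [← hR']; rfl
    have hmem : R'.rmem = Function.update R.rmem i (v i) := by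
      have e1 : (Ex.var 1).eval (R.setw ((1 : Fin 64) : ℕ) i) = i := by simp
      have e2 : e.eval (R.setw ((1 : Fin 64) : ℕ) i) = v i := by
        have := he _ h1 i (by omega)
        rwa [show ((1 : Fin 64) : ℕ) = 1 from rfl]
      rw [← hR']
      simp only [Cmd.eval, State.setw_rmem, e1, e2]
    refine ⟨h1.trans ⟨hw.trans h1.wreg.symm, hrr, ?_, ?_⟩, hother.trans h2, fun a ha => ?_⟩
    · funext k u
      rw [State.wa, State.wa, hc, hother]
    · funext k u
      rw [State.ra, State.ra, hc, hmem, Function.update_of_ne]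
      omega
    · rcases Nat.lt_succ_iff_lt_or_eq.1 ha with h4 | rfl
      · rw [hmem, Function.update_of_ne h4.ne, h3 a h4]
      · rw [hmem, Function.update_self]

end RAM

namespace DistanceOracle

open RAM Finset

namespace Build

/-! ### The data structure -/

/-- The number `s` of the word at address `1` in its entry. -/
def partE (s : ℕ) : Ex .prop := (Ex.var 1 % 8).eq (.const s)

/-- The word of the data structure at address `1`. -/
def wordE : Ex .word :=
  .ite (partE 1) (.rd 3 (.var 1 / 8)) <| .ite (partE 2) (.rd 5 (.var 1 / 8)) <|
  .ite (partE 3) (.rd 10 (.var 1 / 8)) <| .ite (partE 4) (.rd 11 (.var 1 / 8)) <|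
  .ite (partE 5) (.rd 8 (.var 1 / 8)) <| .ite (partE 6) (.rd 12 (.var 1 / 8)) <|
  .ite ((Ex.var 1).eq 0) nE <| .ite ((Ex.var 1).eq 8) lengthE <|
  .ite ((Ex.var 1).eq 16) blocksE 0

/-- The real of the data structure at address `1`. -/
def realE : Ex .real :=
  .rite ((Ex.var 1 % 2).eq 0) (.rrd 7 (.var 1 / 2)) (.rrd 13 (.var 1 / 2))

/-- The number of words. -/
def wordsE : Ex .word := 8 * (leavesE + 1)

/-- The number of reals. -/
def realsE : Ex .word := 2 * (leavesE + logsE * blocksE)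

/-- The computation of the data structure. -/
def command : Cmd :=
  Table.cmds 0 tables (.seq (.iter 1 wordsE (.store (.var 1) wordE))
    (.iter 1 realsE (.rstore (.var 1) realE)))

theorem command_ok : command.Ok :=
  Table.cmds_ok 0 tables ⟨⟨by decide, trivial⟩, by decide, trivial⟩

/-- The word of the data structure at an address. -/
noncomputable def wordAt (τ : State) (a : ℕ) : ℕ :=
  if a % 8 = 1 then τ.wa 3 (a / 8) else if a % 8 = 2 then τ.wa 5 (a / 8)
  else if a % 8 = 3 then τ.wa 10 (a / 8) else if a % 8 = 4 then τ.wa 11 (a / 8)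
  else if a % 8 = 5 then τ.wa 8 (a / 8) else if a % 8 = 6 then τ.wa 12 (a / 8)
  else if a = 0 then τ.wreg 0 else if a = 8 then τ.wa 9 0
  else if a = 16 then τ.wa 3 (16 * τ.wreg 0) / τ.wa 9 0 + 1 else 0

/-- The real of the data structure at an address. -/
noncomputable def realAt (τ : State) (a : ℕ) : ℝ :=
  if a % 2 = 0 then τ.ra 7 (a / 2) else τ.ra 13 (a / 2)

theorem eval_wordE {τ φ : State} (h : SameTables τ φ) (a : ℕ) :
    wordE.eval (φ.setw 1 a) = wordAt τ a := by
  have h0 : (φ.setw 1 a).wreg 0 = τ.wreg 0 := by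
    rw [State.setw_wreg_ne _ _ (by decide), h.wreg]
  have hw : ∀ k, (φ.setw 1 a).wa k = τ.wa k := fun k => by
    rw [wa_setw _ one_ne_zero, h.wa]
  simp only [wordE, wordAt, Ex.eval_ite]
  classical
  exact if_congr (by simp [partE]) (by simp [hw]) <|
    if_congr (by simp [partE]) (by simp [hw]) <|
    if_congr (by simp [partE]) (by simp [hw]) <|
    if_congr (by simp [partE]) (by simp [hw]) <|
    if_congr (by simp [partE]) (by simp [hw]) <|
    if_congr (by simp [partE]) (by simp [hw]) <|
    if_congr (by simp) (by simp [h0]) <|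
    if_congr (by simp) (by simp [hw]) <|
    if_congr (by simp) (by simp [hw, h0]) (by simp)

theorem eval_realE {τ φ : State} (h : SameTables τ φ) (a : ℕ) :
    realE.eval (φ.setw 1 a) = realAt τ a := by
  have hr : ∀ k, (φ.setw 1 a).ra k = τ.ra k := fun k => by
    rw [ra_setw _ one_ne_zero, h.ra]
  simp only [realE, realAt, Ex.eval_rite]
  classical
  exact if_congr (by simp) (by simp [hr]) (by simp [hr])

/-- The number of words of the data structure. -/
noncomputable def wordCount (τ : State) : ℕ := 8 * (leaves (τ.wreg 0) (edge τ) + 1)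

/-- The number of reals of the data structure. -/
noncomputable def realCount (τ : State) : ℕ :=
  2 * (leaves (τ.wreg 0) (edge τ) + (2 * blockLength (τ.wreg 0) + 6) *
    (leaves (τ.wreg 0) (edge τ) / blockLength (τ.wreg 0) + 1))

namespace Filled

variable {τ : State} (T : Filled τ)
include T

/-- For `L` leaves and block length `b`, the sparse table has at most `8 * b * (L / b + 1) ≤ 8 * L +
8 * b` entries, and `b ≤ n ≤ L / 16`. -/
theorem realCount_le : realCount τ ≤ 20 * leaves (τ.wreg 0) (edge τ) := by
  have h1 := blockLength_le T.pos
  have h2 : 16 * τ.wreg 0 ≤ leaves (τ.wreg 0) (edge τ) := Forest.le_leaves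
  have h3 := Nat.div_mul_le_self (leaves (τ.wreg 0) (edge τ)) (blockLength (τ.wreg 0))
  have h4 : 1 ≤ blockLength (τ.wreg 0) := Nat.succ_pos _
  rw [realCount]
  generalize leaves (τ.wreg 0) (edge τ) / blockLength (τ.wreg 0) = m at *
  have h5 : (2 * blockLength (τ.wreg 0) + 6) * (m + 1) ≤ 8 * blockLength (τ.wreg 0) * (m + 1) :=
    Nat.mul_le_mul_right _ (by omega)
  have h6 : 8 * blockLength (τ.wreg 0) * (m + 1) =
      8 * (m * blockLength (τ.wreg 0)) + 8 * blockLength (τ.wreg 0) := by ring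
  omega

theorem counts_le_cap : wordCount τ ≤ τ.cap ∧ realCount τ ≤ τ.cap := by
  have h1 := T.realCount_le
  have h2 := leaves_le_square (τ.wreg 0) (edge τ)
  have h3 := τ.le_cap T.pos
  have h4 : 1 ≤ (τ.wreg 0 + 1) * (τ.wreg 0 + 1) := by nlinarith
  rw [wordCount]
  omega

theorem eval_counts {φ : State} (h : SameTables τ φ) :
    wordsE.eval φ = wordCount τ ∧ realsE.eval φ = realCount τ := by
  have hL := T.leaves_lt_cap
  have h9 : τ.wa 9 0 = blockLength (τ.wreg 0) := T.length_eq (by omega)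
  constructor
  · simp [wordsE, wordCount, h.wreg, h.wa, T.leaves_eq]
  · simp [realsE, realCount, h.wreg, h.wa, T.leaves_eq, h9]

theorem wordAt_lt (a : ℕ) (ha : a < wordCount τ) : wordAt τ a < τ.cap := by
  have hL := T.leaves_lt_cap
  have hb := T.blockLength_lt_cap
  have h9 : τ.wa 9 0 = blockLength (τ.wreg 0) := T.length_eq (by omega)
  have h8 : a / 8 < τ.cap ^ 4 := τ.lt_cap_pow (by rw [wordCount] at ha; omega)
  have hlt : ∀ {k e}, τ.HasWords k e → τ.wa k (a / 8) < τ.cap := by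
    intro k e h
    obtain ⟨ψ, -, hw⟩ := h _ h8
    rw [hw]
    exact Nat.mod_lt _ τ.cap_pos
  have hd := Nat.div_le_self (leaves (τ.wreg 0) (edge τ)) (blockLength (τ.wreg 0))
  rw [wordAt, T.leaves_eq, h9]
  split_ifs
  · exact hlt T.base_table
  · exact hlt T.position_table
  · exact hlt T.mask_table
  · exact hlt T.low_table
  · exact hlt T.pow_table
  · exact hlt T.log_table
  · exact τ.wreg_lt_cap
  · omega
  · omega
  · exact τ.cap_pos

/-- A memory that begins with the data structure. -/
theorem stored {σ : State} (hw : ∀ a < wordCount τ, σ.wmem a = wordAt τ a)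
    (hr : ∀ a < realCount τ, σ.rmem a = realAt τ a) : Query.Stored τ σ := by
  have hL := T.leaves_lt_cap
  have h16 : 16 * τ.wreg 0 ≤ leaves (τ.wreg 0) (edge τ) := Forest.le_leaves
  have hpos := T.pos
  have h9 : τ.wa 9 0 = blockLength (τ.wreg 0) := T.length_eq (by omega)
  rw [wordCount] at hw
  rw [realCount] at hr
  have hdiv : ∀ u s, s < 8 → (8 * u + s) / 8 = u := by omega
  have hmod : ∀ u s, s < 8 → (8 * u + s) % 8 = s := by omega
  have hdiv' : ∀ u s, s < 2 → (2 * u + s) / 2 = u := by omega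
  have hmod' : ∀ u s, s < 2 → (2 * u + s) % 2 = s := by omega
  constructor
  · rw [hw 0 (by omega)]
    simp [wordAt]
  · rw [hw 8 (by omega)]
    simp [wordAt, h9]
  · rw [hw 16 (by omega)]
    simp [wordAt, h9, T.leaves_eq]
  iterate 6
    intro u hu
    rw [hw _ (by omega), wordAt, hdiv _ _ (by norm_num), hmod _ _ (by norm_num)]
    rfl
  · intro p hp
    rw [hr _ (by omega), realAt]
    simp
  · intro p hp
    rw [hr _ (by omega), realAt, hdiv' _ _ (by norm_num), hmod' _ _ (by norm_num),
      if_neg one_ne_zero]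

end Filled

/-- The state after the computation of the data structure. -/
theorem eval_command {σ : State} (hn : 1 ≤ σ.wreg 0) (hk : 1 < σ.rreg 0) :
    ∃ τ, Filled τ ∧ τ.wreg 0 = σ.wreg 0 ∧ τ.rreg 0 = σ.rreg 0 ∧
      (∀ a < σ.cap, τ.rmem a = σ.rmem a) ∧ SameTables τ (command.eval σ) ∧
      (∀ a < wordCount τ, (command.eval σ).wmem a = wordAt τ a) ∧
      ∀ a < realCount τ, (command.eval σ).rmem a = realAt τ a := by
  have T := filled_run hn hk
  have hs := Table.sameBut_run 0 tables σ
  refine ⟨_, T, by rw [hs.wreg], by rw [hs.rreg], hs.rflat, ?_⟩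
  rw [command, Table.eval_cmds, Cmd.eval]
  generalize Table.run 0 tables σ = τ at T
  obtain ⟨h1, h2, h3⟩ := Cmd.eval_iter_store (e := wordE) (T.eval_counts (.refl τ)).1
    T.counts_le_cap.1 (fun φ h a _ => eval_wordE h a) T.wordAt_lt
  obtain ⟨h4, h5, h6⟩ := Cmd.eval_iter_rstore (e := realE) (T.eval_counts h1).2
    (by rw [State.cap_congr h1.wreg]; exact T.counts_le_cap.2)
    (fun φ h a _ => eval_realE (h1.trans h) a)
  exact ⟨h1.trans h4, fun a ha => by rw [h5, h3 a ha], h6⟩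

end Build

end DistanceOracle

/-! ### The two programs and the input of the construction -/

namespace DistanceOracle

open RAM Finset

/-- The construction. -/
def buildProgram : Program :=
  block [Build.command.comp 64, Build.wordsE.comp 64, Build.realsE.comp 65,
    .instr (.wconst 66 0), .instr (.wop .add 0 64 66), .instr (.wop .add 1 65 66)]

/-- The query. -/
def queryProgram : Program := (Cmd.rassign 0 Query.answerE).comp 64

/-- A bound for the words and the time of the programs. -/
def budget (V : ℕ) : ℕ :=
  V + Build.command.peak V + Build.wordsE.peak V + Build.realsE.peak V +
    (Cmd.rassign 0 Query.answerE).peak V + Build.command.cost V + Build.wordsE.cost V +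
    Build.realsE.cost V + 10

theorem polyBdd_budget : PolyBdd budget :=
  (((((((PolyBdd.id.add Build.command.polyBdd_peak).add Build.wordsE.polyBdd_peak).add
    Build.realsE.polyBdd_peak).add (Cmd.rassign 0 Query.answerE).polyBdd_peak).add
    Build.command.polyBdd_cost).add Build.wordsE.polyBdd_cost).add
    Build.realsE.polyBdd_cost).add (.const 10)

/-- Both lengths are first evaluated into scratch registers, since this needs the number of points
in register `0`, which the first length replaces. -/
theorem runs_buildProgram {N V : ℕ} {σ : State} (hs : Small V σ) (hV : σ.cap ≤ V)
    (hσ : σ.Bounded N) (hN : budget V ≤ N) :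
    Runs N buildProgram σ (budget V) fun τ => τ.wmem = (Build.command.eval σ).wmem ∧
      τ.rmem = (Build.command.eval σ).rmem ∧
      τ.wreg 0 = Build.wordsE.eval (Build.command.eval σ) ∧
      τ.wreg 1 = Build.realsE.eval (Build.command.eval σ) := by
  rw [budget] at hN ⊢
  have hs' : Small V (Build.command.eval σ) := hs.eval Build.command_ok hV
  have hwle : @LE.le ℕ _ (Build.wordsE.eval (Build.command.eval σ)) (Build.wordsE.peak V) :=
    Ex.eval_le_peak hs'
  have hrle : @LE.le ℕ _ (Build.realsE.eval (Build.command.eval σ)) (Build.realsE.peak V) :=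
    Ex.eval_le_peak hs'
  refine (Cmd.runs_comp _ 64 V σ Build.command_ok le_rfl hs hV hσ (by omega)).cons
    (T' := Build.wordsE.cost V + Build.realsE.cost V + 3) ?_ (by omega)
  intro ρ hρ hag
  refine Runs.cons_two le_rfl (hs'.agree hag le_rfl)
    (Build.wordsE.runs_comp 64 V ρ le_rfl (hs'.agree hag le_rfl) hρ (by omega))
    (fun τ hτ hsτ => Build.realsE.runs_comp 65 V τ (by norm_num) hsτ hτ (by omega)) (T' := 3)
    ?_ le_rfl
  intro υ hυ hag' h3 h4
  simp only [Holds] at h3 h4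
  rw [Build.wordsE.eval_congr hag] at h3
  rw [Build.realsE.eval_congr hag] at h4
  refine (runs_wconst hυ (by omega) (Q := fun τ => τ = υ.setw 66 0) rfl).cons (T' := 2) ?_
  rintro τ hτ rfl
  have e1 : WordOp.add.eval ((υ.setw 66 0).wreg 64) ((υ.setw 66 0).wreg 66) =
      Build.wordsE.eval (Build.command.eval σ) := by
    simp [WordOp.eval, State.setw_wreg, h3]
  refine (runs_wop hτ (by rw [e1]; omega) (Q := fun τ => τ = (υ.setw 66 0).setw 0
    (Build.wordsE.eval (Build.command.eval σ))) (by rw [e1])).cons (T' := 1) ?_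
  rintro τ hτ rfl
  refine (runs_wop hτ ?_ ?_).cons (fun τ hτ h => runs_nil hτ h)
  all_goals
    have e2 : WordOp.add.eval ((((υ.setw 66 0).setw 0
        (Build.wordsE.eval (Build.command.eval σ)))).wreg 65) ((((υ.setw 66 0).setw 0
        (Build.wordsE.eval (Build.command.eval σ)))).wreg 66) =
        Build.realsE.eval (Build.command.eval σ) := by
      simp [WordOp.eval, State.setw_wreg, h4]
    rw [e2]
  · omega
  · refine ⟨?_, ?_, ?_, ?_⟩
    · simp [hag'.wmem, hag.wmem]
    · simp [hag'.rmem, hag.rmem]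
    · simp [State.setw_wreg]
    · simp

theorem runs_queryProgram {N V : ℕ} {σ : State} (hs : Small V σ) (hV : σ.cap ≤ V)
    (hσ : σ.Bounded N) (hN : budget V ≤ N) :
    Runs N queryProgram σ (Query.answerE.cost 0 + 3) fun τ =>
      τ.rreg 0 = Query.answerE.eval σ := by
  rw [budget] at hN
  refine (Cmd.runs_comp (.rassign 0 Query.answerE) 64 V σ trivial le_rfl hs hV hσ
    (by omega)).mono ?_ fun τ _ h => ?_
  · rw [Cmd.cost, Query.flat_answerE.cost_eq V 0]
  · rw [h.rreg 0 (by norm_num)]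
    exact State.setr_rreg_same _ _ _

section input

variable {n : ℕ} {d : Fin n → Fin n → ℝ} {k ε : ℝ}

theorem memDist_buildInput {x y : ℕ} (hx : x < n) (hy : y < n) :
    memDist (buildInput n d k ε) x y = d ⟨x, hx⟩ ⟨y, hy⟩ := by
  have h1 : (x * n + y) % n = y := code_mod hy
  have h2 : (x * n + y) / n = x := code_div hy
  change (if h : (x * n + y) % n < n ∧ (x * n + y) / n < n then
    d ⟨(x * n + y) / n, h.2⟩ ⟨(x * n + y) % n, h.1⟩ else 0) = _
  rw [dif_pos ⟨by omega, by omega⟩]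
  simp only [h1, h2]

theorem cap_buildInput : (buildInput n d k ε).cap = (n + 1) ^ 12 := State.cap_eq _

theorem le_pow_twelve : n + 1 ≤ (n + 1) ^ 12 := Nat.le_self_pow (by norm_num) _

theorem small_buildInput : Small ((n + 1) ^ 12) (buildInput n d k ε) := by
  refine ⟨fun r _ => ?_, fun a => Nat.zero_le _⟩
  have := le_pow_twelve (n := n)
  change (if r = 0 then n else 0) ≤ _
  split_ifs <;> omega

theorem bounded_buildInput {N : ℕ} (hN : (n + 1) ^ 12 < N) : (buildInput n d k ε).Bounded N :=
  ⟨fun r => by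
    have := le_pow_twelve (n := n)
    change (if r = 0 then n else 0) < N
    split_ifs <;> omega, fun a => by change 0 < N; omega⟩

end input

end DistanceOracle

/-! ### The data structure and its guarantees -/

namespace DistanceOracle

open RAM Finset

theorem getD_map_range {α : Type*} (f : ℕ → α) (m a : ℕ) (z : α) :
    ((List.range m).map f).getD a z = if a < m then f a else z := by
  split_ifs with h <;> simp [h, List.getD]

section oracle

variable {n : ℕ} {d : Fin n → Fin n → ℝ} {k ε : ℝ} {N : ℕ}

theorem builds (hn : 1 ≤ n) (hk : 1 < k) (hN : budget ((n + 1) ^ 12) ≤ N) :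
    ∃ (D : Data) (t : ℕ) (τ : State), Builds N buildProgram n d k ε D t ∧
      t ≤ budget ((n + 1) ^ 12) ∧ (∀ a, D.words.getD a 0 ≤ (n + 1) ^ 12) ∧
      Build.Filled τ ∧ τ.wreg 0 = n ∧ τ.rreg 0 = k ∧
      (∀ a < n * n, τ.rmem a = (buildInput n d k ε).rmem a) ∧
      D.words.length = Build.wordCount τ ∧ D.reals.length = Build.realCount τ ∧
      (∀ a < Build.wordCount τ, D.words.getD a 0 = Build.wordAt τ a) ∧
      ∀ a < Build.realCount τ, D.reals.getD a 0 = Build.realAt τ a := by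
  have hcap : (buildInput n d k ε).cap = (n + 1) ^ 12 := cap_buildInput
  have hbd : (n + 1) ^ 12 + 10 ≤ budget ((n + 1) ^ 12) := by rw [budget]; omega
  obtain ⟨ρ, t, hex, ht, -, hwm, hrm, h0, h1⟩ := runs_buildProgram (σ := buildInput n d k ε)
    small_buildInput hcap.le (bounded_buildInput (by omega)) hN
  obtain ⟨τ, T, hτn, hτk, hflat, hsame, hw, hr⟩ :=
    Build.eval_command (σ := buildInput n d k ε) hn hk
  rw [(T.eval_counts hsame).1] at h0
  rw [(T.eval_counts hsame).2] at h1
  have hsmall := (small_buildInput (d := d) (k := k) (ε := ε)).eval Build.command_ok hcap.le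
  refine ⟨buildOutput ρ, t, τ, ⟨ρ, hex, rfl⟩, ht, fun a => ?_, T, hτn, hτk, fun a ha => ?_, ?_, ?_,
    fun a ha => ?_, fun a ha => ?_⟩
  · rw [buildOutput, getD_map_range, hwm]
    split_ifs
    · exact hsmall.wmem a
    · exact Nat.zero_le _
  · exact hflat a (ha.trans (State.square_lt_cap (buildInput n d k ε)))
  · simp [buildOutput, h0]
  · simp [buildOutput, h1]
  · rw [buildOutput, getD_map_range, h0, if_pos ha, hwm, hw a ha]
  · rw [buildOutput, getD_map_range, h1, if_pos ha, hrm, hr a ha]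

end oracle

/-- The oracle has all the desired properties. -/
theorem exists_data {r s : ℕ} (hr : ∀ V, 2 ≤ V → budget V ≤ V ^ r)
    (hs : Query.answerE.cost 0 = s) {X : Type*} [MetricSpace X] {n : ℕ} (hn : 1 ≤ n)
    (e : Fin n ≃ X) {k ε : ℝ} (hk : 1 < k) (hε : 0 < ε) (hε1 : ε < 1) :
    ∃ (D : Data) (t : ℕ),
      Builds ((n + 1) ^ (12 * r)) buildProgram n (fun i j => dist (e i) (e j)) k ε D t ∧
      t ≤ (2 ^ (12 * r) + 1152 + (s + 3)) * n ^ (12 * r) ∧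
      (D.size : ℝ) ≤ (2 ^ (12 * r) + 1152 + (s + 3) : ℕ) * (n : ℝ) ^ (1 + 1 / k) ∧
      ∀ i j : Fin n, ∃ (x : ℝ) (q : ℕ), Answers ((n + 1) ^ (12 * r)) queryProgram D i j x q ∧
        (q : ℝ) ≤ (2 ^ (12 * r) + 1152 + (s + 3) : ℕ) / ε ∧ dist (e i) (e j) ≤ x ∧
        x ≤ 8 * (1 + ε) * k * dist (e i) (e j) := by
  have hV2 : 2 ≤ (n + 1) ^ 12 := le_trans (by omega) le_pow_twelve
  have hN : budget ((n + 1) ^ 12) ≤ (n + 1) ^ (12 * r) := by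
    rw [pow_mul]; exact hr _ hV2
  have hbd : (n + 1) ^ 12 + 10 ≤ budget ((n + 1) ^ 12) := by rw [budget]; omega
  obtain ⟨D, t, τ, hB, ht, hDV, T, hτn, hτk, hmem, hDw, hDr, hw, hrl⟩ :=
    builds (d := fun i j => dist (e i) (e j)) (ε := ε) hn hk hN
  have hdist : ∀ x (hx : x < n) y (hy : y < n), memDist τ x y = dist (e ⟨x, hx⟩) (e ⟨y, hy⟩) := by
    intro x hx y hy
    rw [← memDist_buildInput (d := fun i j => dist (e i) (e j)) (k := k) (ε := ε) hx hy, memDist,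
      memDist, hτn]
    exact hmem _ (by
      have := Nat.mul_le_mul_right n (show x + 1 ≤ n from hx)
      rw [Nat.add_mul, one_mul] at this
      omega)
  have hd : IsDist (τ.wreg 0) (memDist τ) := by
    rw [hτn]
    refine ⟨fun x hx => ?_, fun x hx y hy => ?_, fun x hx y hy z hz => ?_⟩
    · rw [hdist x hx x hx, dist_self]
    · rw [hdist x hx y hy, hdist y hy x hx, dist_comm]
    · rw [hdist x hx y hy, hdist y hy z hz, hdist x hx z hz]
      exact dist_triangle _ _ _
  -- The constant has one summand for each claim: `2 ^ (12 * r)` passes from powers of `n + 1` to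
  -- powers of `n`, `1152 = 36 * 32` is the number of cells per leaf times the bound of `leaves_le`,
  -- and `s + 3` is the time of a query, which is at most `(s + 3) / ε` because `ε < 1`.
  refine ⟨D, t, hB, ?_, ?_, fun i j => ?_⟩
  · calc t ≤ (n + 1) ^ (12 * r) := ht.trans hN
      _ ≤ (2 * n) ^ (12 * r) := Nat.pow_le_pow_left (by omega) _
      _ = 2 ^ (12 * r) * n ^ (12 * r) := mul_pow _ _ _
      _ ≤ _ := Nat.mul_le_mul_right _ (by omega)
  · have h1 := (T.forest hd).leaves_le
    have h2 : 16 * τ.wreg 0 ≤ leaves (τ.wreg 0) (edge τ) := Forest.le_leaves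
    have h3 := T.realCount_le
    have h4 : D.size ≤ 36 * leaves (τ.wreg 0) (edge τ) := by
      rw [Data.size, hDw, hDr, Build.wordCount]
      have := T.pos
      omega
    rw [hτn, hτk] at h1
    rw [hτn] at h4
    have h5 : (D.size : ℝ) ≤ 36 * (leaves n (edge τ) : ℝ) := by exact_mod_cast h4
    have h6 : (0 : ℝ) ≤ (n : ℝ) ^ (1 + 1 / k) := by positivity
    push_cast
    have h7 : (0 : ℝ) ≤ 2 ^ (12 * r) + ((s : ℝ) + 3) := by positivity
    clear hs hN hbd hB ht
    nlinarith [mul_nonneg h7 h6]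
  · have hi := i.2
    have hj := j.2
    have hpt := le_pow_twelve (n := n)
    have hS : Query.Stored τ (queryInput D i j) := T.stored hw hrl
    obtain ⟨ρ, q, hex, hq, -, hans⟩ := runs_queryProgram (N := (n + 1) ^ (12 * r))
      (V := (n + 1) ^ 12) (σ := queryInput D i j)
      ⟨fun a _ => by
        change (if a = 0 then (i : ℕ) else if a = 1 then (j : ℕ) else 0) ≤ _
        split_ifs <;> omega, hDV⟩
      (by
        -- During a query register `0` holds `i` instead of `n`, so the capacity of this state is
        -- `(i + 1) ^ 12`.
        rw [State.cap_eq]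
        exact Nat.pow_le_pow_left (Nat.succ_le_succ hi.le) _)
      ⟨fun a => by
        change (if a = 0 then (i : ℕ) else if a = 1 then (j : ℕ) else 0) < _
        split_ifs <;> omega, fun a => (hDV a).trans_lt (by omega)⟩ hN
    rw [hs] at hq
    have hdij := hdist i hi j hj
    obtain ⟨h1, h2⟩ := hS.eval_answerE T (x := i) (y := j) rfl rfl (by omega) (by omega) hd
      fun hne => by
        rw [hdij, dist_pos]
        exact fun h => hne (congrArg Fin.val (e.injective h))
    rw [hdij, ← hans] at h1 h2
    rw [hτk] at h2
    refine ⟨ρ.rreg 0, q, ⟨ρ, hex, rfl⟩, ?_, h1, h2.trans ?_⟩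
    · rw [le_div_iff₀ hε]
      have h3 : (q : ℝ) ≤ s + 3 := by exact_mod_cast hq
      have h4 : (0 : ℝ) ≤ q := Nat.cast_nonneg q
      have h5 : (0 : ℝ) ≤ 2 ^ (12 * r) := by positivity
      push_cast
      clear hs hN hbd hB ht hex
      nlinarith
    -- The estimate is already within the factor `8 * k`, and `1 + ε` only enlarges the bound.
    · have h3 : 0 ≤ k * dist (e i) (e j) := mul_nonneg (by linarith) dist_nonneg
      have h4 := mul_nonneg hε.le h3
      linarith

end DistanceOracle

theorem theorem2 :
    ∃ (build query : RAM.Program) (C c : ℕ),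
      ∀ (X : Type*) [MetricSpace X] (n : ℕ) (_ : 1 ≤ n) (e : Fin n ≃ X) (k ε : ℝ),
        1 < k → 0 < ε → ε < 1 →
        ∃ (D : DistanceOracle.Data) (t : ℕ),
          DistanceOracle.Builds ((n + 1) ^ c) build n (fun i j => dist (e i) (e j)) k ε D t ∧
          t ≤ C * n ^ c ∧
          (D.size : ℝ) ≤ C * (n : ℝ) ^ (1 + 1 / k) ∧
          ∀ i j : Fin n, ∃ (x : ℝ) (q : ℕ),
            DistanceOracle.Answers ((n + 1) ^ c) query D i j x q ∧
            (q : ℝ) ≤ C / ε ∧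
            dist (e i) (e j) ≤ x ∧
            x ≤ 8 * (1 + ε) * k * dist (e i) (e j) := by
  obtain ⟨r, hr⟩ := DistanceOracle.polyBdd_budget
  exact ⟨DistanceOracle.buildProgram, DistanceOracle.queryProgram, _, 12 * r,
    fun X _ n hn e k ε hk hε hε1 => DistanceOracle.exists_data hr rfl hn e hk hε hε1⟩
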